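/- **Setting.** Let $n,p,m\ge 0$, $\hat n=n+p+m\ge 1$ and consider $$\min_{x\in\mathbb R^t} F(x)=f(x)+\frac1n\sum_{i=1}^n\phi_i(A_i^Tx)\quad\text{s.t. } Bx+b=0,\ g_i(x)\le 0\ (1\le i\le m)$$ (the sum is absent if $n=0$), where $A_i$ is the $i$-th column of $A\in\mathbb R^{t\times n}$, $f:\mathbb R^t\to\mathbb R$ is $\mu$-strongly convex ($\mu>0$), each $\phi_i:\mathbb R\to\mathbb R$ is convex and $M$-Lipschitz, each $g_i:\mathbb R^t\to\mathbb R$ is convex with all subgradients bounded in norm by $L_{g_i}$, there is $\bar x$ with $B\bar x+b=0$ and $g_i(\bar x)<0$ for all $i$, and the optimal value is finite. For $u\in\mathbb R^{\hat n}$ let $$L_f(x,u)=f(x)+\tfrac1n\langle u_{1:n},A^Tx\rangle+\langle u_{n+1:n+p},Bx+b\rangle+\sum_{i=1}^m u_{n+p+i}g_i(x),\qquad x^*(u)=\operatorname*{argmin}_x L_f(x,u),$$ $d(u)=-L_f(x^*(u),u)$, $\nabla d(u)=-\big[A^Tx^*(u)/n;\ Bx^*(u)+b;\ g(x^*(u))\big]$,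 and let $D(u)=d(u)+\sum_j h_j(u_j)$ be the negative dual function, with $h_j=\frac1n\phi_j^*$ for $j\le n$ ($\phi_j^*$ the convex conjugate), $h_j=0$ for $n<j\le n+p$, and $h_j$ the indicator of $[0,\infty)$ for $j>n+p$. Let $\mathbb D^*$ be the set of minimizers of $D$. Put $L_j=\|A_j\|^2/(n^2\mu)$ for $j\le n$, $L_j=\|B_{j-n,:}\|^2/\mu$ for $n<j\le n+p$, $L_j=L_{g_{j-n-p}}^2/\mu$ for $j>n+p$, and assume that all $L_j$ are positive. Let $\|u\|_L=(\sum_jL_ju_j^2)^{1/2}$ and let $\|\cdot\|_L^*$ be the norm with weights $1/L_j$ (over the corresponding coordinates), and let $\mathrm{Proj}$ be the projection onto $\mathbb D^*$ in $\|\cdot\|_L$. Assume quadratic functional growth with some $\kappa>0$: $\kappa\|u-\mathrm{Proj}(u)\|_L^2\le D(u)-D(u^*)$ for all $u$ and $u^*\in\mathbb D^*$ ($\mathbb D^*$ need not be a singleton). **Algorithm.** Let $\theta_0=1/\hat n$ and $\theta_{k+1}=\frac12\big(\sqrt{\theta_k^4+4\theta_k^2}-\theta_k^2\big)$. ARDCA$(u^0,K_0,K)$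 sets $z^0=u^0$, $\hat u^0=0$ and, for $k=0,\dots,K$: $v^k=\theta_k^2\hat u^k+z^k$; $i_k$ is uniform on $\{1,\dots,\hat n\}$; $$z^{k+1}_{i_k}=\operatorname*{argmin}_s\ \hat n\theta_kL_{i_k}(s-z^k_{i_k})^2+\nabla_{i_k}d(v^k)(s-z^k_{i_k})+h_{i_k}(s),\qquad \hat u^{k+1}_{i_k}=\hat u^k_{i_k}-\tfrac{1-\hat n\theta_k}{\theta_k^2}(z^{k+1}_{i_k}-z^k_{i_k}),$$ and the other coordinates are kept. It outputs $u^{K+1}=\theta_K^2\hat u^{K+1}+z^{K+1}$ and $\hat x^K=\big(\sum_{k=K_0}^K x^*(v^k)/\theta_k\big)/\big(\sum_{k=K_0}^K1/\theta_k\big)$. ARDCA with restart starts from $u^{0,0}$ with nonnegative last $m$ coordinates and $D(u^{0,0})<\infty$, and for $r=0,\dots,N$ runs ARDCA$(u^{r,0},K_0,K)$, with outputs $u^{r+1,0}$ and $\hat x^{r,K}$; all random indices are independent. (No parameter of the algorithm depends on $\kappa$.) **Theorem.** Optimal primal and dual solutions exist. Let $x^*$ and $u^*$ be any such solutions and put $$\rho=\frac{1+(1-\theta_0)\kappa}{1+\frac\kappa2\left(\frac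 K{2\hat n}+1\right)^2},\qquad T_{0,0}=(1-\theta_0)\big(D(u^{0,0})-D(u^*)\big)+\|u^{0,0}-\mathrm{Proj}(u^{0,0})\|_L^2 .$$ For all $N,K\ge0$, $D(u^{N,0})$ is finite for every choice of the indices, and $$(1-\theta_0)\big(\mathbb E[D(u^{N,0})]-D(u^*)\big)+\mathbb E\|u^{N,0}-\mathrm{Proj}(u^{N,0})\|_L^2\le\rho^N\,T_{0,0};$$ moreover $\rho<1$ if $K\ge\hat n$. If in addition $\|w\|_L\le C$ for all $w\in\mathbb D^*$, $\upsilon>1$, $K\ge\hat n$ and $0\le K_0\le\left\lfloor\frac K{\upsilon(1+1/\hat n)}+1\right\rfloor$, then $$\big|\mathbb E[F(\hat x^{N,K})]-F(x^*)\big|\le C_1\rho^{N/2}+C_2\rho^N,\qquad \mathbb E\left\|\begin{bmatrix}B\hat x^{N,K}+b\\ \max\{0,g(\hat x^{N,K})\}\end{bmatrix}\right\|_L^*\le C_3\rho^{N/2},$$ where $$C_1=\frac{6C\sqrt{T_{0,0}}+6M\sqrt{\sum_{i=1}^nL_i}\sqrt{T_{0,0}}}{1-1/\upsilon}+\frac{2\sqrt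 m\,C\sqrt{T_{0,0}}}{\sqrt{1-1/\upsilon}},\qquad C_2=\frac{2T_{0,0}}{1-1/\upsilon},\qquad C_3=\frac{6\sqrt{T_{0,0}}}{1-1/\upsilon}.$$ -/

import Mathlib

open scoped Matrix

noncomputable section

/-- The element of `S` at which `F` is smallest (a choice of minimizer of `F` over `S`). -/
def argminOn {α β : Type*} [Nonempty α] [Preorder β] (S : Set α) (F : α → β) : α :=
  Classical.epsilon fun x => x ∈ S ∧ ∀ y ∈ S, F x ≤ F y

/-- Expectation of `X` under the uniform distribution on a finite sample space. -/
def uniformExp {Ω : Type*} [Fintype Ω] (X : Ω → ℝ) : ℝ :=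
  (∑ ω, X ω) / Fintype.card Ω

/-- `s` is a subgradient of `G` at `x`. -/
def IsSubgradient {t : ℕ} (G : EuclideanSpace ℝ (Fin t) → ℝ) (x s : EuclideanSpace ℝ (Fin t)) :
    Prop :=
  ∀ y, G x + inner ℝ s (y - x) ≤ G y

/-- The convex conjugate, with values in the extended reals. -/
def conjugate (ψ : ℝ → ℝ) (s : ℝ) : EReal :=
  ⨆ v : ℝ, ((s * v - ψ v : ℝ) : EReal)

/-- Index set of the dual variables: `n` loss terms, `p` equality constraints,
`m` inequality constraints. -/
abbrev DualIndex (n p m : ℕ) : Type := Fin n ⊕ (Fin p ⊕ Fin m)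

/-- The dual space. -/
abbrev DualVec (n p m : ℕ) : Type := DualIndex n p m → ℝ

/-- The data of the problem
`min f(x) + (1/n) ∑ φ i (A_iᵀ x)` subject to `B x + b = 0`, `g i x ≤ 0`,
with the constants that occur in the assumptions. -/
structure ConvexProblem (t n p m : ℕ) where
  A : Matrix (Fin t) (Fin n) ℝ
  B : Matrix (Fin p) (Fin t) ℝ
  b : Fin p → ℝ
  f : EuclideanSpace ℝ (Fin t) → ℝ
  φ : Fin n → ℝ → ℝ
  g : Fin m → EuclideanSpace ℝ (Fin t) → ℝ
  /-- modulus of strong convexity of `f` -/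
  μ : ℝ
  /-- Lipschitz constant of the `φ i` -/
  M : ℝ
  /-- bounds of the subgradients of the `g i` -/
  Lg : Fin m → ℝ

namespace ConvexProblem

variable {t n p m : ℕ} (P : ConvexProblem t n p m)

/-- `A_iᵀ x`. -/
def Ax (x : EuclideanSpace ℝ (Fin t)) : Fin n → ℝ := P.Aᵀ *ᵥ x.ofLp

/-- `B x + b`. -/
def eqRes (x : EuclideanSpace ℝ (Fin t)) : Fin p → ℝ := P.B *ᵥ x.ofLp + P.b

/-- The primal objective. -/
def F (x : EuclideanSpace ℝ (Fin t)) : ℝ := P.f x + (1 / n : ℝ) * ∑ i, P.φ i (P.Ax x i)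

/-- The primal feasible set. -/
def feasible : Set (EuclideanSpace ℝ (Fin t)) :=
  {x | P.eqRes x = 0 ∧ ∀ i, P.g i x ≤ 0}

/-- The set of optimal primal solutions. -/
def primalSol : Set (EuclideanSpace ℝ (Fin t)) :=
  {x | x ∈ P.feasible ∧ ∀ y ∈ P.feasible, P.F x ≤ P.F y}

/-- The standing assumptions on the problem. -/
structure Standing : Prop where
  mu_pos : 0 < P.μ
  f_strongConvex : StrongConvexOn Set.univ P.μ P.f
  phi_convex : ∀ i, ConvexOn ℝ Set.univ (P.φ i)
  phi_lipschitz : ∀ i, ∀ x y : ℝ, |P.φ i x - P.φ i y| ≤ P.M * |x - y|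
  g_convex : ∀ i, ConvexOn ℝ Set.univ (P.g i)
  g_subgradient : ∀ i, ∀ x s, IsSubgradient (P.g i) x s → ‖s‖ ≤ P.Lg i
  slater : ∃ x, (∀ i, P.g i x < 0) ∧ P.eqRes x = 0
  value_finite : BddBelow (P.F '' P.feasible)

/-- The dual feasible set: the multipliers of the inequality constraints are nonnegative. -/
def dualFeasible (_P : ConvexProblem t n p m) : Set (DualVec n p m) :=
  {u | ∀ i : Fin m, 0 ≤ u (Sum.inr (Sum.inr i))}

/-- The part `L_f(x, u)` of the Lagrangian that depends on `x`. -/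
def Lf (x : EuclideanSpace ℝ (Fin t)) (u : DualVec n p m) : ℝ :=
  P.f x + (∑ i, u (Sum.inl i) * (P.Ax x i / n)) + (∑ i, u (Sum.inr (Sum.inl i)) * P.eqRes x i)
    + ∑ i, u (Sum.inr (Sum.inr i)) * P.g i x

/-- `x*(u)`, the minimizer of `L_f(·, u)`. -/
def xOf (u : DualVec n p m) : EuclideanSpace ℝ (Fin t) :=
  argminOn Set.univ fun x => P.Lf x u

/-- `d(u) = -L_f(x*(u), u)`. -/
def d (u : DualVec n p m) : ℝ := -P.Lf (P.xOf u) u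

/-- The gradient of `d` by Danskin's formula: minus the constraint residuals at `x*(u)`. -/
def gradd (u : DualVec n p m) : DualVec n p m
  | Sum.inl i => -(P.Ax (P.xOf u) i / n)
  | Sum.inr (Sum.inl i) => -P.eqRes (P.xOf u) i
  | Sum.inr (Sum.inr i) => -P.g i (P.xOf u)

/-- The separable part of the negative dual function. -/
def h : DualIndex n p m → ℝ → EReal
  | Sum.inl i, s => ((1 / n : ℝ) : EReal) * conjugate (P.φ i) s
  | Sum.inr (Sum.inl _), _ => 0
  | Sum.inr (Sum.inr _), s => if 0 ≤ s then 0 else ⊤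

/-- The negative of the dual function. -/
def D (u : DualVec n p m) : EReal := (P.d u : EReal) + ∑ j, P.h j (u j)

/-- The set of optimal dual solutions. -/
def dualSol : Set (DualVec n p m) := {u | ∀ v, P.D u ≤ P.D v}

/-- The coordinatewise Lipschitz constants. -/
def L : DualIndex n p m → ℝ
  | Sum.inl j => (∑ s, P.A s j ^ 2) / ((n : ℝ) ^ 2 * P.μ)
  | Sum.inr (Sum.inl j) => (∑ s, P.B j s ^ 2) / P.μ
  | Sum.inr (Sum.inr j) => P.Lg j ^ 2 / P.μ

/-- The weighted norm on the dual space. -/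
def normL (u : DualVec n p m) : ℝ := √(∑ j, P.L j * u j ^ 2)

/-- The projection onto the set of optimal dual solutions, in the weighted norm. -/
def proj (u : DualVec n p m) : DualVec n p m :=
  argminOn P.dualSol fun w => P.normL (u - w)

/-- Quadratic functional growth: `κ ‖u - Proj(u)‖_L² ≤ D(u) - D(u*)` for all `u`. -/
def QuadraticGrowth (κ : ℝ) : Prop :=
  ∀ ustar ∈ P.dualSol, ∀ u,
    ((κ * P.normL (u - P.proj u) ^ 2 : ℝ) : EReal) + P.D ustar ≤ P.D u

/-- Dual weighted norm of the vector with the blocks `B x + b` and `max {0, g(x)}`. -/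
def violation (x : EuclideanSpace ℝ (Fin t)) : ℝ :=
  √((∑ i, 1 / P.L (Sum.inr (Sum.inl i)) * P.eqRes x i ^ 2)
    + ∑ i, 1 / P.L (Sum.inr (Sum.inr i)) * max 0 (P.g i x) ^ 2)

end ConvexProblem

/-- The sequence `θ_k` for the dual dimension `nh`. -/
def theta (nh : ℕ) : ℕ → ℝ
  | 0 => 1 / nh
  | k + 1 => (√(theta nh k ^ 4 + 4 * theta nh k ^ 2) - theta nh k ^ 2) / 2

namespace ConvexProblem

variable {t n p m : ℕ} (P : ConvexProblem t n p m)

/-- The minimizer in the update of the coordinate `j`, from the current `z` and `v`. -/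
def coordStep (k : ℕ) (z v : DualVec n p m) (j : DualIndex n p m) : ℝ :=
  argminOn Set.univ fun s : ℝ =>
    ((((n + p + m : ℕ) : ℝ) * theta (n + p + m) k * P.L j * (s - z j) ^ 2
      + P.gradd v j * (s - z j) : ℝ) : EReal) + P.h j s

/-- The point `v^k = θ_k² û^k + z^k`, from the pair `(z^k, û^k)`. -/
def vOf (k : ℕ) (s : DualVec n p m × DualVec n p m) : DualVec n p m :=
  theta (n + p + m) k ^ 2 • s.2 + s.1

/-- The pair `(z^k, û^k)` of ARDCA started at `u0`, when coordinate `i k` is selected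
at iteration `k`. -/
def ardcaState (u0 : DualVec n p m) (i : ℕ → DualIndex n p m) :
    ℕ → DualVec n p m × DualVec n p m
  | 0 => (u0, 0)
  | k + 1 =>
    let s := ardcaState u0 i k
    let θ := theta (n + p + m) k
    let znew := P.coordStep k s.1 (vOf k s) (i k)
    (Function.update s.1 (i k) znew,
      Function.update s.2 (i k)
        (s.2 (i k) - (1 - ((n + p + m : ℕ) : ℝ) * θ) / θ ^ 2 * (znew - s.1 (i k))))

/-- The dual output `u^{K+1} = θ_K² û^{K+1} + z^{K+1}` of ARDCA. -/
def ardcaDual (u0 : DualVec n p m) (K : ℕ) (i : ℕ → DualIndex n p m) : DualVec n p m :=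
  vOf K (P.ardcaState u0 i (K + 1))

/-- The primal output of ARDCA: the average of `x*(v^k)`, `K0 ≤ k ≤ K`,
with weights proportional to `1 / θ_k`. -/
def ardcaPrimal (u0 : DualVec n p m) (K0 K : ℕ) (i : ℕ → DualIndex n p m) :
    EuclideanSpace ℝ (Fin t) :=
  (∑ k ∈ Finset.Icc K0 K, 1 / theta (n + p + m) k)⁻¹ •
    ∑ k ∈ Finset.Icc K0 K,
      (1 / theta (n + p + m) k) • P.xOf (vOf k (P.ardcaState u0 i k))

/-- The starting point `u^{r,0}` of outer iteration `r` of ARDCA with restart,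
when coordinate `i r k` is selected at inner iteration `k` of outer iteration `r`. -/
def restartDual (u0 : DualVec n p m) (K : ℕ) (i : ℕ → ℕ → DualIndex n p m) :
    ℕ → DualVec n p m
  | 0 => u0
  | r + 1 => P.ardcaDual (restartDual u0 K i r) K (i r)

/-- The primal output of outer iteration `r` of ARDCA with restart. -/
def restartPrimal (u0 : DualVec n p m) (K0 K : ℕ) (i : ℕ → ℕ → DualIndex n p m) (r : ℕ) :
    EuclideanSpace ℝ (Fin t) :=
  P.ardcaPrimal (P.restartDual u0 K i r) K0 K (i r)

end ConvexProblem

/-- The sample space of ARDCA with restart: the coordinates selected in the outer iterations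
`0, …, N` and the inner iterations `0, …, K`. They are independent and uniform, so that the law
on the sample space is uniform. -/
abbrev Selection (n p m N K : ℕ) : Type := Fin (N + 1) → Fin (K + 1) → DualIndex n p m

/-- The coordinate selected at the outer iteration `r ≤ N` and the inner iteration `k ≤ K`
(larger arguments never matter). -/
def Selection.at {n p m N K : ℕ} (ω : Selection n p m N K) (r k : ℕ) : DualIndex n p m :=
  ω (Fin.ofNat (N + 1) r) (Fin.ofNat (K + 1) k)

/-- The contraction factor, for the dual dimension `nh`. -/
def restartRate (nh : ℕ) (κ : ℝ) (K : ℕ) : ℝ :=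
  (1 + (1 - theta nh 0) * κ) / (1 + κ / 2 * ((K : ℝ) / (2 * nh) + 1) ^ 2)

/-- `T_{0,0} = (1 - θ_0) (D(u^{0,0}) - D(u*)) + ‖u^{0,0} - Proj(u^{0,0})‖_L²`. -/
def ConvexProblem.initialPotential {t n p m : ℕ} (P : ConvexProblem t n p m)
    (u0 ustar : DualVec n p m) : ℝ :=
  (1 - theta (n + p + m) 0) * ((P.D u0).toReal - (P.D ustar).toReal)
    + P.normL (u0 - P.proj u0) ^ 2

/-- The constant `C_1`, for the initial potential `T` and the bound `C` of the dual solutions. -/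
def ConvexProblem.constC1 {t n p m : ℕ} (P : ConvexProblem t n p m) (T C ν : ℝ) : ℝ :=
  (6 * C * √T + 6 * P.M * √(∑ i : Fin n, P.L (Sum.inl i)) * √T) / (1 - 1 / ν)
    + 2 * √(m : ℝ) * C * √T / √(1 - 1 / ν)

/-- The constant `C_2`. -/
def constC2 (T ν : ℝ) : ℝ := 2 * T / (1 - 1 / ν)

/-- The constant `C_3`. -/
def constC3 (T ν : ℝ) : ℝ := 6 * √T / (1 - 1 / ν)

end

/-!
Both solution sets, the convergence of the dual iterates and the bounds for the averaged primal
point are read off from one reformulation. With slack variables `y` the primal problem reads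
`min f x + ∑ ψ_j (y_j)` subject to `res_j x = y_j` (`≤` for the inequality constraints), where
`h_j` is the conjugate of `ψ_j` on the admissible set `slackSet j`. The optimal coordinate updates
`fullStep` are certified by slack variables `slackIter`, so that each iteration `k` produces a pair
`(x*(v^k), y^k)` and a value `lagIter` of the slack Lagrangian, at least the optimal value.

*One run.* Write `r_k = invStep` for `1 / (n̂ θ_{k-1})` and `q_k = potWeight` for `r_k²`, with
`r_0 = q_0 = 1 - 1/n̂`. The iterate `u^k` is a running convex combination of `z^0, …, z^k`, and the
dual objective at `u^k` is dominated by `dualBound`, which satisfies a one-step recursion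
(`dualBound_step`). In expectation the potential `q_k E[dualBound_k - D*] + E‖z^k - w‖²` decreases,
by half the expected squared length of the step plus the weighted gap of `lagIter`
(`potential_step`).

*Contraction.* Quadratic growth bounds the distance of `u^k` to the solution set by the objective
gap. Inserting this in the potential inequality gives the factor `restartRate` as long as
`r_{K+1} ≤ 2`, by convexity of the squared distance alone (`contraction_of_le_two`). For
`r_{K+1} ≥ 2` the expected distance of `u^k` is followed through its own recursion
(`distSq_step`), and a discrete Gronwall weight turns the two recursions into the same factor
(`contraction_of_two_le`, `run_contraction`).

*Primal point.* Over the window `K₀, …, K` the averaged difference of the residuals and their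
slack variables telescopes to a multiple of `z^{K+1} - z^{K₀}` plus a martingale (`resAvg_eq`). All
three terms are controlled by the potential (`expRes_le`). This difference bounds the constraint
violation, and with the averaged Lagrangian also the objective from above; weak duality with an
optimal multiplier bounds the objective from below (`F_upper`, `F_lower`).

*Restarts.* The coordinates of one outer iteration are independent of its starting point, so the
bounds of one run hold conditionally and the potentials multiply (`restart_contraction`).

Existence of dual solutions follows from Slater's condition by separation
(`exists_lagrange_multipliers`, `exists_dual`).
-/

noncomputable section

/-! ### Convex functions on normed spaces -/

/-- A continuous convex function has an affine minorant that touches it at a given point. -/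
lemma ConvexOn.exists_affine_minorant {E : Type*} [NormedAddCommGroup E] [NormedSpace ℝ E]
    {f : E → ℝ} (hf : ConvexOn ℝ Set.univ f) (hc : Continuous f) (x : E) :
    ∃ l : E →L[ℝ] ℝ, ∀ y, f x + l (y - x) ≤ f y := by
  have hconv : Convex ℝ {p : E × ℝ | p.1 ∈ (Set.univ : Set E) ∧ f p.1 < p.2} :=
    hf.convex_strict_epigraph
  have hopen : IsOpen {p : E × ℝ | p.1 ∈ (Set.univ : Set E) ∧ f p.1 < p.2} := by
    simpa using isOpen_lt (hc.comp continuous_fst) continuous_snd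
  obtain ⟨l, hl⟩ := geometric_hahn_banach_open_point hconv hopen
    (x := (x, f x)) (by simp)
  have hsplit : ∀ (y : E) (r : ℝ), l (y, r) = l (y, 0) + r * l (0, 1) := by
    intro y r
    have : ((y, r) : E × ℝ) = (y, 0) + r • (0, 1) := by simp
    rw [this, map_add, map_smul, smul_eq_mul]
  have key : ∀ (y : E) (r : ℝ), f y < r →
      l (y, 0) + r * l (0, 1) < l (x, 0) + f x * l (0, 1) := by
    intro y r hr
    rw [← hsplit, ← hsplit]
    exact hl (y, r) ⟨Set.mem_univ _, hr⟩
  have hneg : l (0, 1) < 0 := by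
    have := key x (f x + 1) (by linarith)
    linarith
  refine ⟨(-(l (0, 1)))⁻¹ • (l.comp (ContinuousLinearMap.inl ℝ E ℝ)), fun y => ?_⟩
  have hle : l (y, 0) + f y * l (0, 1) ≤ l (x, 0) + f x * l (0, 1) := by
    have h1 : Filter.Tendsto (fun r : ℝ => l (y, 0) + r * l (0, 1))
        (nhdsWithin (f y) (Set.Ioi (f y)))
        (nhds (l (y, 0) + f y * l (0, 1))) :=
      (Continuous.tendsto (by fun_prop) _).mono_left nhdsWithin_le_nhds
    refine le_of_tendsto h1 ?_
    filter_upwards [self_mem_nhdsWithin] with r hr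
    exact (key y r hr).le
  have hsub : l (y - x, 0) = l (y, 0) - l (x, 0) := by
    rw [← map_sub]; simp
  have happ : ((-(l (0, 1)))⁻¹ • (l.comp (ContinuousLinearMap.inl ℝ E ℝ))) (y - x)
      = (l (y, 0) - l (x, 0)) / (-(l (0, 1))) := by
    simp only [smul_apply, ContinuousLinearMap.comp_apply,
      ContinuousLinearMap.inl_apply, smul_eq_mul, hsub]
    rw [div_eq_inv_mul]
  rw [happ, ← le_sub_iff_add_le', div_le_iff₀ (by linarith)]
  linarith

/-- A minimizer of a strongly convex function is a quadratic-growth point. -/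
lemma StrongConvexOn.quadratic_growth {E : Type*} [NormedAddCommGroup E] [NormedSpace ℝ E]
    {f : E → ℝ} {μ : ℝ} (hf : StrongConvexOn Set.univ μ f) {x : E} (hx : ∀ y, f x ≤ f y) (y : E) :
    f x + μ / 2 * ‖x - y‖ ^ 2 ≤ f y := by
  have key : ∀ τ ∈ Set.Ioo (0 : ℝ) 1, f x + (1 - τ) * (μ / 2 * ‖x - y‖ ^ 2) ≤ f y := by
    intro τ hτ
    have h1 := hf.2 (Set.mem_univ x) (Set.mem_univ y)
      (show (0 : ℝ) ≤ 1 - τ by linarith [hτ.2]) hτ.1.le (by ring)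
    have h2 := hx ((1 - τ) • x + τ • y)
    simp only [smul_eq_mul] at h1
    have h3 : τ * (f x + (1 - τ) * (μ / 2 * ‖x - y‖ ^ 2)) ≤ τ * f y := by nlinarith
    exact le_of_mul_le_mul_left h3 hτ.1
  have hlim : Filter.Tendsto (fun τ : ℝ => f x + (1 - τ) * (μ / 2 * ‖x - y‖ ^ 2))
      (nhdsWithin 0 (Set.Ioi 0)) (nhds (f x + (1 - 0) * (μ / 2 * ‖x - y‖ ^ 2))) :=
    (Continuous.tendsto (by fun_prop) _).mono_left nhdsWithin_le_nhds
  rw [sub_zero, one_mul] at hlim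
  refine le_of_tendsto hlim ?_
  filter_upwards [Ioo_mem_nhdsGT (show (0 : ℝ) < 1 by norm_num)] with τ hτ using key τ hτ

/-- A strongly convex function on a Euclidean space is coercive. -/
lemma StrongConvexOn.tendsto_cocompact_atTop {t : ℕ} {f : EuclideanSpace ℝ (Fin t) → ℝ} {μ : ℝ}
    (hμ : 0 < μ) (hf : StrongConvexOn Set.univ μ f) :
    Filter.Tendsto f (Filter.cocompact _) Filter.atTop := by
  have hg := strongConvexOn_iff_convex.1 hf
  obtain ⟨l, hl⟩ := hg.exists_affine_minorant hg.locallyLipschitz.continuous 0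
  have hbound : ∀ x, f 0 + (μ / 2 * ‖x‖ ^ 2 - ‖l‖ * ‖x‖) ≤ f x := by
    intro x
    have h1 := hl x
    have h2 := (abs_le.1 ((Real.norm_eq_abs _).symm.le.trans (l.le_opNorm x))).1
    simp at h1
    linarith
  refine Filter.tendsto_atTop_mono hbound ?_
  have h1 : Filter.Tendsto (fun r : ℝ => r * (μ / 2 * r - ‖l‖)) Filter.atTop Filter.atTop := by
    refine Filter.tendsto_id.atTop_mul_atTop₀ ?_
    exact Filter.tendsto_atTop_add_const_right _ _
      (Filter.tendsto_id.const_mul_atTop (by positivity))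
  have h2 := Filter.tendsto_atTop_add_const_left _ (f 0)
    (h1.comp (tendsto_norm_cocompact_atTop (E := EuclideanSpace ℝ (Fin t))))
  refine h2.congr fun x => ?_
  simp only [Function.comp_apply]
  ring

/-- **Lagrange multipliers** for convex programs with affine equality constraints and convex
inequality constraints under Slater's condition. -/
lemma exists_lagrange_multipliers {E ι κ : Type*} [NormedAddCommGroup E] [NormedSpace ℝ E]
    [FiniteDimensional ℝ E] [Fintype ι] [Fintype κ]
    {f : E → ℝ} (hf : ConvexOn ℝ Set.univ f)
    (G : E →ₗ[ℝ] (ι → ℝ)) (c : ι → ℝ)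
    {g : κ → E → ℝ} (hg : ∀ i, ConvexOn ℝ Set.univ (g i))
    {x₀ : E} (hx₀ : G x₀ + c = 0) (hx₀' : ∀ i, g i x₀ < 0)
    {v : ℝ} (hv : ∀ x, G x + c = 0 → (∀ i, g i x ≤ 0) → v ≤ f x) :
    ∃ (l : ι → ℝ) (ν : κ → ℝ), (∀ i, 0 ≤ ν i) ∧
      ∀ x, v ≤ f x + ∑ i, l i * (G x + c) i + ∑ i, ν i * g i x := by
  have hfc := hf.locallyLipschitz.continuous
  have hgc := fun i => (hg i).locallyLipschitz.continuous
  -- The constraint residual of the equalities is perturbed through `E` itself: this makes the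
  -- set of attainable values open even if `G` is not surjective.
  let S : Set (ℝ × E × (κ → ℝ)) :=
    {p | ∃ w, G w + c = 0 ∧ f (w + p.2.1) < p.1 ∧ ∀ i, g i (w + p.2.1) < p.2.2 i}
  have hSopen : IsOpen S := by
    have : S = ⋃ w ∈ {w | G w + c = 0}, ({p : ℝ × E × (κ → ℝ) | f (w + p.2.1) < p.1} ∩
        ⋂ i, {p : ℝ × E × (κ → ℝ) | g i (w + p.2.1) < p.2.2 i}) := by
      ext p
      simp only [S, Set.mem_ofPred_eq, Set.mem_iUnion, Set.mem_inter_iff, Set.mem_iInter,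
        exists_prop]
    rw [this]
    refine isOpen_biUnion fun w _ => IsOpen.inter ?_ (isOpen_iInter_of_finite fun i => ?_)
    · exact isOpen_lt (by fun_prop) (by fun_prop)
    · have := hgc i
      exact isOpen_lt (by fun_prop) (by fun_prop)
  have hSconv : Convex ℝ S := by
    rintro p ⟨w, hw, hfw, hgw⟩ p' ⟨w', hw', hfw', hgw'⟩ a b ha hb hab
    have hcomb : ∀ e e' : E, a • w + b • w' + (a • e + b • e') = a • (w + e) + b • (w' + e') := by
      intro e e'
      module
    refine ⟨a • w + b • w', ?_, ?_, fun i => ?_⟩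
    · have : G (a • w + b • w') + c = a • (G w + c) + b • (G w' + c) := by
        rw [map_add, map_smul, map_smul, smul_add, smul_add]
        calc _ = a • G w + b • G w' + (a + b) • c := by rw [hab, one_smul]
          _ = _ := by module
      rw [this, hw, hw', smul_zero, smul_zero, add_zero]
    · have h1 := hf.2 (Set.mem_univ (w + p.2.1)) (Set.mem_univ (w' + p'.2.1)) ha hb hab
      simp only [Prod.snd_add, Prod.fst_add, Prod.smul_snd, Prod.smul_fst, hcomb]
      refine h1.trans_lt ?_
      rcases ha.eq_or_lt with rfl | ha'
      · have : b = 1 := by linarith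
        subst this; simpa using hfw'
      · exact add_lt_add_of_lt_of_le (by simpa using mul_lt_mul_of_pos_left hfw ha')
          (by simpa using mul_le_mul_of_nonneg_left hfw'.le hb)
    · have h1 := (hg i).2 (Set.mem_univ (w + p.2.1)) (Set.mem_univ (w' + p'.2.1)) ha hb hab
      simp only [Prod.snd_add, Prod.fst_add, Prod.smul_snd, Prod.smul_fst, hcomb]
      refine h1.trans_lt ?_
      rcases ha.eq_or_lt with rfl | ha'
      · have : b = 1 := by linarith
        subst this; simpa using hgw' i
      · exact add_lt_add_of_lt_of_le (by simpa using mul_lt_mul_of_pos_left (hgw i) ha')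
          (by simpa using mul_le_mul_of_nonneg_left (hgw' i).le hb)
  have hnot : ((v, 0, 0) : ℝ × E × (κ → ℝ)) ∉ S := by
    rintro ⟨w, hw, hfw, hgw⟩
    simp only [add_zero, Pi.zero_apply] at hfw hgw
    exact absurd (hv w hw fun i => (hgw i).le) (not_le.2 hfw)
  obtain ⟨L, hL⟩ := geometric_hahn_banach_open_point hSconv hSopen hnot
  classical
  obtain ⟨α, hα⟩ : ∃ α, α = L (1, 0, 0) := ⟨_, rfl⟩
  let q : E →ₗ[ℝ] ℝ := (L : ℝ × E × (κ → ℝ) →ₗ[ℝ] ℝ) ∘ₗ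
    (LinearMap.inr ℝ ℝ (E × (κ → ℝ))) ∘ₗ (LinearMap.inl ℝ E (κ → ℝ))
  let β : κ → ℝ := fun i => L (0, 0, Pi.single i 1)
  have hsplit : ∀ (r : ℝ) (e : E) (s : κ → ℝ), L (r, e, s) = r * α + q e + ∑ i, s i * β i := by
    intro r e s
    have h1 : ((r, e, s) : ℝ × E × (κ → ℝ)) = r • (1, 0, 0) + (0, e, 0)
        + ∑ i, s i • ((0, 0, Pi.single i 1) : ℝ × E × (κ → ℝ)) := by
      have h2 : ∑ i, s i • ((0, 0, Pi.single i 1) : ℝ × E × (κ → ℝ)) = (0, 0, s) := by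
        ext1
        · simp [Prod.fst_sum]
        · ext1
          · simp [Prod.fst_sum, Prod.snd_sum]
          · funext j
            simp [Prod.snd_sum, Finset.sum_apply, Pi.single_apply]
      rw [h2]; simp
    rw [h1, map_add, map_add, map_smul, map_sum, ← hα]
    simp only [map_smul, smul_eq_mul]
    simp [q, β]
  have key : ∀ (w e : E) (r : ℝ) (s : κ → ℝ), G w + c = 0 → f (w + e) < r →
      (∀ i, g i (w + e) < s i) →
      r * α + q e + ∑ i, s i * β i < v * α := by
    intro w e r s hw hr hs
    have := hL (r, e, s) ⟨w, hw, hr, hs⟩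
    rw [hsplit, hsplit] at this
    simpa using this
  have hα0 : α < 0 := by
    have h1 := key x₀ 0 (f x₀ + 1) 0 hx₀ (by simp) (by simpa using hx₀')
    have h2 := hv x₀ hx₀ fun i => (hx₀' i).le
    simp at h1
    nlinarith
  have hβ0 : ∀ i, β i ≤ 0 := by
    intro i
    by_contra! hi
    obtain ⟨N, hN⟩ : ∃ N : ℝ, 0 ≤ N ∧ v * α ≤ (f x₀ + 1) * α + N * β i := by
      refine ⟨|(v - (f x₀ + 1)) * α| / β i, by positivity, ?_⟩
      rw [div_mul_cancel₀ _ hi.ne']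
      linarith [le_abs_self ((v - (f x₀ + 1)) * α)]
    have h1 := key x₀ 0 (f x₀ + 1) (Pi.single i N) hx₀ (by simp) (fun j => by
      rw [add_zero]
      refine (hx₀' j).trans_le ?_
      by_cases hj : j = i
      · subst hj; simpa using hN.1
      · simp [hj])
    simp [Pi.single_apply] at h1
    linarith [hN.2]
  -- Passing to the limit in the strict inequalities.
  have key' : ∀ w e, G w + c = 0 →
      f (w + e) * α + q e + ∑ i, g i (w + e) * β i ≤ v * α := by
    intro w e hw
    have hlim : Filter.Tendsto (fun ε : ℝ => (f (w + e) + ε) * α + q e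
        + ∑ i, (g i (w + e) + ε) * β i) (nhdsWithin 0 (Set.Ioi 0))
        (nhds ((f (w + e) + 0) * α + q e + ∑ i, (g i (w + e) + 0) * β i)) :=
      (Continuous.tendsto (by fun_prop) _).mono_left nhdsWithin_le_nhds
    simp only [add_zero] at hlim
    refine le_of_tendsto hlim ?_
    filter_upwards [self_mem_nhdsWithin] with ε hε
    have hε' : (0 : ℝ) < ε := hε
    exact (key w e _ (fun i => g i (w + e) + ε) hw (by linarith) (fun i => by linarith)).le
  have hker : LinearMap.ker G ≤ LinearMap.ker q := by
    intro k hk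
    rw [LinearMap.mem_ker] at hk ⊢
    by_contra hne
    set Q := v * α - (f x₀ * α + ∑ i, g i x₀ * β i) with hQ
    have h1 := key' (x₀ - ((Q + 1) / q k) • k) (((Q + 1) / q k) • k) (by
      rw [map_sub, map_smul, hk, smul_zero, sub_zero, hx₀])
    rw [sub_add_cancel, map_smul, smul_eq_mul, div_mul_cancel₀ _ hne] at h1
    linarith
  have hspan : q ∈ Submodule.span ℝ (Set.range fun i => (LinearMap.proj i).comp G) := by
    refine FiniteDimensional.mem_span_of_iInf_ker_le_ker ?_
    intro k hk
    apply hker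
    simp only [Submodule.mem_iInf, LinearMap.mem_ker, LinearMap.comp_apply,
      LinearMap.proj_apply] at hk ⊢
    exact funext hk
  obtain ⟨l, hl⟩ := (Submodule.mem_span_range_iff_exists_fun ℝ).1 hspan
  have hq : ∀ e, q e = ∑ i, l i * G e i := by
    intro e
    rw [← hl]
    simp
  refine ⟨fun i => l i / α, fun i => β i / α, fun i => div_nonneg_of_nonpos (hβ0 i) hα0.le,
    fun x => ?_⟩
  have h1 := key' x₀ (x - x₀) hx₀
  rw [add_sub_cancel, hq] at h1
  have h2 : ∀ i, G (x - x₀) i = (G x + c) i := by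
    intro i
    rw [map_sub, ← sub_eq_zero]
    have := congrFun hx₀ i
    simp only [Pi.add_apply, Pi.zero_apply, Pi.sub_apply] at this ⊢
    linarith
  simp only [h2] at h1
  have h3 : ∑ i, l i / α * (G x + c) i = (∑ i, l i * (G x + c) i) / α := by
    rw [Finset.sum_div]; exact Finset.sum_congr rfl fun i _ => by ring
  have h4 : ∑ i, β i / α * g i x = (∑ i, g i x * β i) / α := by
    rw [Finset.sum_div]; exact Finset.sum_congr rfl fun i _ => by ring
  rw [h3, h4]
  have h5 : (f x * α + ∑ i, l i * (G x + c) i + ∑ i, g i x * β i) / α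
      = f x + (∑ i, l i * (G x + c) i) / α + (∑ i, g i x * β i) / α := by
    rw [add_div, add_div, mul_div_cancel_right₀ _ hα0.ne]
  rw [← h5, le_div_iff_of_neg hα0]
  exact h1

/-! ### The step size sequence -/

/-- The normalized inverse step sizes: `r_{k+1} = 1 / (n̂ θ_k)`. The value at `0` is chosen such
that the recursions below start at `k = 0`. -/
def invStep (nh : ℕ) : ℕ → ℝ
  | 0 => 1 - 1 / nh
  | k + 1 => 1 / (nh * theta nh k)

/-- The weights `q_{k+1} = 1 / (n̂ θ_k)²` of the potential functions, with `q_0 = 1 - 1 / n̂`. -/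
def potWeight (nh : ℕ) : ℕ → ℝ
  | 0 => 1 - 1 / nh
  | k + 1 => (1 / (nh * theta nh k)) ^ 2

section Theta

variable {nh : ℕ} (hnh : 0 < nh)
include hnh

lemma theta_pos (k : ℕ) : 0 < theta nh k := by
  have h0 : (0 : ℝ) < nh := by exact_mod_cast hnh
  induction k with
  | zero => simp only [theta]; positivity
  | succ k ih =>
    simp only [theta]
    have : theta nh k ^ 2 < √(theta nh k ^ 4 + 4 * theta nh k ^ 2) := by
      apply Real.lt_sqrt_of_sq_lt
      nlinarith [pow_pos ih 2]
    linarith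

omit hnh in
lemma theta_succ_sq (k : ℕ) : theta nh (k + 1) ^ 2 = (1 - theta nh (k + 1)) * theta nh k ^ 2 := by
  have h := Real.sq_sqrt (show 0 ≤ theta nh k ^ 4 + 4 * theta nh k ^ 2 by positivity)
  simp only [theta]
  nlinarith

lemma invStep_succ_pos (k : ℕ) : 0 < invStep nh (k + 1) := by
  have h0 : (0 : ℝ) < nh := by exact_mod_cast hnh
  have := theta_pos hnh k
  simp only [invStep]; positivity

lemma theta_eq (k : ℕ) : theta nh k = 1 / (nh * invStep nh (k + 1)) := by
  have h0 : (0 : ℝ) < nh := by exact_mod_cast hnh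
  have := theta_pos hnh k
  simp only [invStep]; field_simp

omit hnh in
lemma potWeight_succ (k : ℕ) : potWeight nh (k + 1) = invStep nh (k + 1) ^ 2 := rfl

lemma potWeight_succ_pos (k : ℕ) : 0 < potWeight nh (k + 1) :=
  pow_pos (invStep_succ_pos hnh k) 2

lemma potWeight_mul (k : ℕ) :
    potWeight nh k = (1 - theta nh k) * potWeight nh (k + 1) := by
  have h0 : (0 : ℝ) < nh := by exact_mod_cast hnh
  cases k with
  | zero => simp only [potWeight, theta]; field_simp
  | succ k =>
    have h1 := theta_pos hnh k
    have h2 := theta_pos hnh (k + 1)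
    have h3 := theta_succ_sq (nh := nh) k
    simp only [potWeight]
    field_simp
    linarith

lemma potWeight_sub (k : ℕ) :
    potWeight nh (k + 1) - potWeight nh k = invStep nh (k + 1) / nh := by
  have h0 : (0 : ℝ) < nh := by exact_mod_cast hnh
  have h1 := invStep_succ_pos hnh k
  rw [potWeight_mul hnh k, theta_eq hnh k, potWeight_succ]
  field_simp
  ring

lemma invStep_one : invStep nh 1 = 1 := by
  have h0 : (0 : ℝ) < nh := by exact_mod_cast hnh
  simp only [invStep, theta]; field_simp

lemma invStep_succ_succ (k : ℕ) :
    invStep nh (k + 2) ^ 2 - invStep nh (k + 1) ^ 2 = invStep nh (k + 2) / nh :=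
  potWeight_sub hnh (k + 1)

lemma invStep_add_le (k : ℕ) : invStep nh (k + 1) + 1 / (2 * nh) ≤ invStep nh (k + 2) := by
  have h0 : (0 : ℝ) < nh := by exact_mod_cast hnh
  have h1 := invStep_succ_pos hnh k
  have h2 := invStep_succ_pos hnh (k + 1)
  have h3 := invStep_succ_succ hnh k
  by_contra! h
  have h4 : 0 < invStep nh (k + 2) / nh := by positivity
  have h5 : invStep nh (k + 1) < invStep nh (k + 2) := by
    by_contra! h'; nlinarith
  have h6 : invStep nh (k + 2) / nh = 2 * invStep nh (k + 2) * (1 / (2 * nh)) := by field_simp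
  nlinarith

lemma one_add_le_invStep (k : ℕ) : 1 + k / (2 * nh) ≤ invStep nh (k + 1) := by
  induction k with
  | zero => simp [invStep_one hnh]
  | succ k ih =>
    have := invStep_add_le hnh k
    push_cast
    rw [add_div]
    linarith

lemma one_le_invStep (k : ℕ) : 1 ≤ invStep nh (k + 1) := by
  have := one_add_le_invStep hnh k
  have h : (0 : ℝ) ≤ k / (2 * nh) := by positivity
  linarith

lemma theta_le (k : ℕ) : nh * theta nh k ≤ 1 := by
  have h0 : (0 : ℝ) < nh := by exact_mod_cast hnh
  have h1 := one_le_invStep hnh k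
  rw [theta_eq hnh k]
  field_simp
  exact h1

lemma theta_le_one (k : ℕ) : theta nh k ≤ 1 := by
  have h0 : (1 : ℝ) ≤ nh := by exact_mod_cast hnh
  nlinarith [theta_le hnh k, theta_pos hnh k]

lemma one_sub_inv_nonneg : (0 : ℝ) ≤ 1 - 1 / nh := by
  have h0 : (1 : ℝ) ≤ nh := by exact_mod_cast hnh
  rw [sub_nonneg, div_le_one (by linarith)]
  exact h0

lemma mul_invStep_le (k : ℕ) : (1 - 1 / nh) * invStep nh (k + 1) ≤ invStep nh k := by
  have h0 : (0 : ℝ) < nh := by exact_mod_cast hnh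
  cases k with
  | zero => rw [invStep_one hnh]; simp [invStep]
  | succ k =>
    have h1 := one_le_invStep hnh k
    have h2 := one_le_invStep hnh (k + 1)
    have h3 := invStep_succ_succ hnh k
    have h4 := one_sub_inv_nonneg hnh
    have h5 : invStep nh (k + 2) / nh = invStep nh (k + 2) * (1 / nh) := by ring
    have h6 : (0 : ℝ) < 1 / nh := by positivity
    by_contra! h
    set x := invStep nh (k + 2)
    set y := invStep nh (k + 1)
    -- otherwise `x² - y² > (x - y) x ≥ x² / n̂ ≥ x / n̂`
    nlinarith [mul_pos h6 (show 0 < x by linarith), mul_nonneg h6.le (show 0 ≤ x - 1 by linarith)]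

lemma invStep_nonneg (k : ℕ) : 0 ≤ invStep nh k := by
  cases k with
  | zero => exact one_sub_inv_nonneg hnh
  | succ k => exact (invStep_succ_pos hnh k).le

lemma potWeight_nonneg (k : ℕ) : 0 ≤ potWeight nh k := by
  cases k with
  | zero => exact one_sub_inv_nonneg hnh
  | succ k => exact (potWeight_succ_pos hnh k).le

lemma invStep_le_potWeight (k : ℕ) : invStep nh k ≤ potWeight nh k := by
  cases k with
  | zero => exact le_rfl
  | succ k =>
    rw [potWeight_succ]
    nlinarith [one_le_invStep hnh k]

lemma potWeight_mono : Monotone (potWeight nh) := by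
  refine monotone_nat_of_le_succ fun k => ?_
  have := potWeight_sub hnh k
  have h2 : 0 ≤ invStep nh (k + 1) / nh := div_nonneg (invStep_nonneg hnh _) (by positivity)
  linarith

/-- The total weight of the averaging window `K₀, …, K` if the window is not too short. -/
lemma window_weight {K K₀ : ℕ} {ν : ℝ} (hν : 1 < ν) (hK : nh ≤ K)
    (hK₀ : K₀ ≤ ⌊(K : ℝ) / (ν * (1 + 1 / (nh : ℝ))) + 1⌋₊) :
    1 - 1 / ν ≤ potWeight nh (K + 1) - potWeight nh K₀ ∧ K₀ ≤ K + 1 := by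
  have h0 : (0 : ℝ) < nh := by exact_mod_cast hnh
  have hK' : (nh : ℝ) ≤ K := by exact_mod_cast hK
  have hKpos : (0 : ℝ) < K := by linarith
  have hKn : (1 : ℝ) ≤ K / nh := by rwa [le_div_iff₀ h0, one_mul]
  have hrK := one_add_le_invStep hnh K
  have hν' : 0 ≤ 1 / ν := by positivity
  have hKn2 : (K : ℝ) / (2 * nh) = K / nh / 2 := by field_simp
  cases K₀ with
  | zero =>
    refine ⟨?_, by omega⟩
    rw [potWeight_succ]
    have h1 : potWeight nh 0 = 1 - 1 / nh := rfl
    have h2 : (0 : ℝ) ≤ 1 / nh := by positivity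
    rw [h1]
    nlinarith
  | succ j =>
    have hj : (j : ℝ) ≤ K / ν := by
      have h1 : ((j + 1 : ℕ) : ℝ) ≤ (K : ℝ) / (ν * (1 + 1 / (nh : ℝ))) + 1 :=
        (Nat.le_floor_iff (by positivity)).1 hK₀
      push_cast at h1
      have h2 : (K : ℝ) / (ν * (1 + 1 / (nh : ℝ))) ≤ K / ν := by
        apply div_le_div_of_nonneg_left hKpos.le (by linarith)
        have : (0 : ℝ) ≤ 1 / nh := by positivity
        nlinarith
      linarith
    have hjK : (j : ℝ) ≤ K := hj.trans (div_le_self hKpos.le hν.le)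
    have hjK' : j ≤ K := by exact_mod_cast hjK
    refine ⟨?_, by omega⟩
    have hstep : ∀ i : ℕ, invStep nh (j + 1) + i / (2 * nh) ≤ invStep nh (j + i + 1) := by
      intro i
      induction i with
      | zero => simp
      | succ i ih =>
        have := invStep_add_le hnh (j + i)
        push_cast
        rw [add_div]
        have e : j + (i + 1) + 1 = j + i + 2 := by ring
        rw [e]; linarith
    have h3 := hstep (K - j)
    rw [Nat.add_sub_cancel' hjK', Nat.cast_sub hjK'] at h3
    have h4 := one_le_invStep hnh j
    rw [potWeight_succ, potWeight_succ]
    have h5 : (1 - 1 / ν) * (K / nh) ≤ (K - j) / nh := by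
      rw [← mul_div_assoc]
      apply div_le_div_of_nonneg_right _ h0.le
      have : (1 - 1 / ν) * K = K - K / ν := by ring
      linarith
    have h6 : ((K : ℝ) - j) / (2 * nh) = (K - j) / nh / 2 := by field_simp
    rw [h6] at h3
    have h7 : 0 ≤ 1 - 1 / ν := by
      rw [sub_nonneg, div_le_one (by linarith)]; exact hν.le
    have h8 : 1 - 1 / ν ≤ (K - j) / nh := by nlinarith
    have h9 : 1 ≤ invStep nh (K + 1) := one_le_invStep hnh K
    nlinarith

end Theta

/-! ### Averages along the iterations -/

/-- The averaged sequence `s_0 = a_0`, `s_{k+1} = (1 - θ_k) s_k + θ_k a_k + n̂ θ_k (a_{k+1} - a_k)`.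
The dual output of the algorithm is the averaged sequence of the `z^k`. -/
def runAvg {E : Type*} [AddCommGroup E] [Module ℝ E] (nh : ℕ) (a : ℕ → E) : ℕ → E
  | 0 => a 0
  | k + 1 => (1 - theta nh k) • runAvg nh a k + theta nh k • a k
      + (nh * theta nh k) • (a (k + 1) - a k)

lemma map_runAvg {E F : Type*} [AddCommGroup E] [Module ℝ E] [AddCommGroup F] [Module ℝ F]
    (l : E →ₗ[ℝ] F) (nh : ℕ) (a : ℕ → E) (k : ℕ) :
    l (runAvg nh a k) = runAvg nh (fun i => l (a i)) k := by
  induction k with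
  | zero => rfl
  | succ k ih => simp only [runAvg, map_add, map_smul, map_sub, ih]

/-- After scaling by the weights, a step of the averaged sequence is a difference of two terms
with known coefficients. -/
lemma potWeight_smul_runAvg_succ {E : Type*} [AddCommGroup E] [Module ℝ E] {nh : ℕ} (hnh : 0 < nh)
    (a : ℕ → E) (k : ℕ) :
    potWeight nh (k + 1) • runAvg nh a (k + 1)
      = potWeight nh k • runAvg nh a k + invStep nh (k + 1) • a (k + 1)
        - ((1 - 1 / nh) * invStep nh (k + 1)) • a k := by
  have h0 : (0 : ℝ) < nh := by exact_mod_cast hnh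
  have h1 := invStep_succ_pos hnh k
  have e1 : potWeight nh (k + 1) * theta nh k = invStep nh (k + 1) / nh := by
    rw [theta_eq hnh k, potWeight_succ]; field_simp
  have e2 : potWeight nh (k + 1) * (nh * theta nh k) = invStep nh (k + 1) := by
    rw [theta_eq hnh k, potWeight_succ]; field_simp
  have e3 : potWeight nh (k + 1) * (1 - theta nh k) = potWeight nh k := by
    rw [potWeight_mul hnh k]; ring
  simp only [runAvg, smul_add, smul_smul, e1, e2, e3, smul_sub]
  have e4 : (1 - 1 / nh) * invStep nh (k + 1) = invStep nh (k + 1) - invStep nh (k + 1) / nh := by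
    ring
  rw [e4, sub_smul]
  abel

/-- The averaged sequence stays in every convex set that contains the original sequence: its
coefficients are nonnegative although the recursion has a negative one. -/
lemma Convex.runAvg_mem {E : Type*} [AddCommGroup E] [Module ℝ E] {S : Set E} (hS : Convex ℝ S)
    {nh : ℕ} (hnh : 0 < nh) {a : ℕ → E} {k : ℕ} (ha : ∀ i ≤ k, a i ∈ S) : runAvg nh a k ∈ S := by
  open scoped Pointwise in
  have key : ∀ i ≤ k, potWeight nh i • runAvg nh a i - invStep nh i • a i
      ∈ (potWeight nh i - invStep nh i) • S := by
    intro i hi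
    induction i with
    | zero =>
      have : potWeight nh 0 = invStep nh 0 := rfl
      rw [this, sub_self, Set.zero_smul_set ⟨_, ha 0 hi⟩]
      simp [runAvg]
    | succ i ih =>
      have hi' : i ≤ k := by omega
      have h1 := potWeight_smul_runAvg_succ hnh a i
      have h2 := invStep_le_potWeight hnh i
      have h3 := mul_invStep_le hnh i
      have h4 := potWeight_sub hnh i
      have e1 : potWeight nh (i + 1) • runAvg nh a (i + 1) - invStep nh (i + 1) • a (i + 1)
          = (potWeight nh i • runAvg nh a i - invStep nh i • a i)
            + (invStep nh i - (1 - 1 / nh) * invStep nh (i + 1)) • a i := by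
        rw [h1, sub_smul]; abel
      have e2 : potWeight nh (i + 1) - invStep nh (i + 1) = (potWeight nh i - invStep nh i)
          + (invStep nh i - (1 - 1 / nh) * invStep nh (i + 1)) := by
        have : (1 - 1 / (nh : ℝ)) * invStep nh (i + 1)
          = invStep nh (i + 1) - invStep nh (i + 1) / nh := by ring
        linarith
      rw [e1, e2, hS.add_smul (by linarith) (by linarith)]
      exact Set.add_mem_add (ih hi') (Set.smul_mem_smul_set (ha i hi'))
  cases k with
  | zero => exact ha 0 le_rfl
  | succ k =>
    have h1 := key (k + 1) le_rfl
    have h2 := Set.add_mem_add h1 (Set.smul_mem_smul_set (a := invStep nh (k + 1))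
      (ha (k + 1) le_rfl))
    rw [sub_add_cancel, ← hS.add_smul (sub_nonneg.2 (invStep_le_potWeight hnh _))
      (invStep_nonneg hnh _), sub_add_cancel] at h2
    exact (Set.smul_mem_smul_set_iff₀ (potWeight_succ_pos hnh k).ne' _ _).1 h2

/-- Jensen's inequality for the averaged sequence. -/
lemma ConvexOn.map_runAvg_le {E : Type*} [AddCommGroup E] [Module ℝ E] {S : Set E} {f : E → ℝ}
    (hf : ConvexOn ℝ S f) {nh : ℕ} (hnh : 0 < nh) {a : ℕ → E} {k : ℕ} (ha : ∀ i ≤ k, a i ∈ S) :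
    f (runAvg nh a k) ≤ runAvg nh (fun i => f (a i)) k := by
  have h1 := hf.convex_epigraph.runAvg_mem hnh (a := fun i => (a i, f (a i))) (k := k)
    fun i hi => ⟨ha i hi, le_rfl⟩
  have h2 := map_runAvg (LinearMap.fst ℝ E ℝ) nh (fun i => (a i, f (a i))) k
  have h3 := map_runAvg (LinearMap.snd ℝ E ℝ) nh (fun i => (a i, f (a i))) k
  simp only [LinearMap.fst_apply, LinearMap.snd_apply] at h2 h3
  have h4 := h1.2
  rwa [h2, h3] at h4

/-! ### Contraction of the potential: the scalar recursions -/

/-- The discrete Gronwall factors of the growth constant `κ`. -/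
def gronwall (nh : ℕ) (κ : ℝ) : ℕ → ℝ
  | 0 => 1
  | k + 1 => gronwall nh κ k * ((1 + κ * ((1 - 1 / nh) * invStep nh (k + 1)))
      / (1 + κ * invStep nh k))

section Contraction

variable {nh : ℕ} (hnh : 0 < nh) {κ : ℝ} (hκ : 0 < κ)
include hnh hκ

lemma gronwall_pos (k : ℕ) : 0 < gronwall nh κ k := by
  induction k with
  | zero => exact one_pos
  | succ k ih =>
    have h1 := invStep_nonneg hnh k
    have h2 := invStep_nonneg hnh (k + 1)
    have h3 := one_sub_inv_nonneg hnh
    rw [gronwall]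
    positivity

lemma gronwall_lower (k : ℕ) :
    (1 - κ / 2 * potWeight nh k) / (1 + κ / 2 * potWeight nh k)
      ≤ gronwall nh κ k / (1 + κ * invStep nh k) := by
  induction k with
  | zero =>
    have h3 := one_sub_inv_nonneg hnh
    simp only [gronwall, potWeight, invStep]
    rw [div_le_div_iff₀ (by positivity) (by positivity)]
    nlinarith [mul_nonneg hκ.le h3, mul_nonneg (mul_nonneg hκ.le h3) (mul_nonneg hκ.le h3)]
  | succ k ih =>
    have hq0 := potWeight_nonneg hnh k
    have hq1 := potWeight_nonneg hnh (k + 1)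
    have hr0 := invStep_nonneg hnh k
    have hr1 := invStep_nonneg hnh (k + 1)
    have hc := one_sub_inv_nonneg hnh
    have hd := potWeight_sub hnh k
    have hg := gronwall_pos hnh hκ k
    have hn0 : (0 : ℝ) < nh := by exact_mod_cast hnh
    have hi0 : (0 : ℝ) ≤ 1 / nh := by positivity
    by_cases hsmall : 1 - κ / 2 * potWeight nh (k + 1) ≤ 0
    · exact (div_nonpos_of_nonpos_of_nonneg hsmall (by positivity)).trans
        (div_nonneg (gronwall_pos hnh hκ _).le (by positivity))
    push Not at hsmall
    have e : gronwall nh κ (k + 1) / (1 + κ * invStep nh (k + 1))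
        = gronwall nh κ k / (1 + κ * invStep nh k)
          * ((1 + κ * ((1 - 1 / nh) * invStep nh (k + 1))) / (1 + κ * invStep nh (k + 1))) := by
      rw [gronwall]; ring
    rw [e]
    refine le_trans ?_ (mul_le_mul_of_nonneg_right ih (by positivity))
    rw [div_mul_div_comm, div_le_div_iff₀ (by positivity) (by positivity)]
    have hdiv : invStep nh (k + 1) / nh = invStep nh (k + 1) * (1 / nh) := by ring
    rw [hdiv] at hd
    obtain ⟨δ, hδ⟩ : ∃ δ, δ = κ * (invStep nh (k + 1) * (1 / nh)) := ⟨_, rfl⟩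
    obtain ⟨R, hR⟩ : ∃ R, R = κ * invStep nh (k + 1) := ⟨_, rfl⟩
    obtain ⟨Y, hY⟩ : ∃ Y, Y = κ / 2 * potWeight nh k := ⟨_, rfl⟩
    have hX : κ / 2 * potWeight nh (k + 1) = Y + δ / 2 := by
      rw [hY, hδ, ← hd]; ring
    have e1 : κ * ((1 - 1 / nh) * invStep nh (k + 1)) = R - δ := by rw [hR, hδ]; ring
    have hδ0 : 0 ≤ δ := by rw [hδ]; positivity
    have hY0 : 0 ≤ Y := by rw [hY]; positivity
    have hδR : δ ≤ R := by
      rw [hδ, hR]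
      have : invStep nh (k + 1) * (1 / nh) ≤ invStep nh (k + 1) := by
        refine mul_le_of_le_one_right hr1 (by linarith)
      exact mul_le_mul_of_nonneg_left this hκ.le
    rw [hX] at hsmall ⊢
    rw [e1, ← hR, ← hY]
    nlinarith [mul_nonneg hδ0 (show 0 ≤ R - δ / 2 by linarith),
      mul_nonneg hδ0 (mul_nonneg hY0 (show 0 ≤ Y + δ / 2 by linarith)), mul_nonneg hδ0 hY0]

end Contraction

/-- The growth condition at all iterates, accumulated by the factors `gronwall`. -/
lemma gronwall_bound {nh : ℕ} (hnh : 0 < nh) {κ : ℝ} (hκ : 0 < κ) {K : ℕ}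
    {a x y s : ℕ → ℝ} {T : ℝ} (hs : ∀ k, 0 ≤ s k)
    (hsum : ∀ k ≤ K + 1, a k + potWeight nh k * x k ≤ T - (∑ i ∈ Finset.range k, s i) / 2)
    (hy : ∀ k ≤ K, potWeight nh (k + 1) * y (k + 1) ≤ potWeight nh k * y k
      + invStep nh (k + 1) * (a (k + 1) - (1 - 1 / nh) * a k) + (1 - 1 / nh) * s k)
    (hy0 : y 0 ≤ a 0) (hgrowth : ∀ k ≤ K + 1, κ * y k ≤ x k) :
    ∀ k ≤ K + 1, potWeight nh k * y k ≤ invStep nh k * a k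
        + (1 - gronwall nh κ k) / κ * T + (1 - 1 / nh) * ∑ i ∈ Finset.range k, s i := by
  have hc := one_sub_inv_nonneg hnh
  have hn0 : (0 : ℝ) < nh := by exact_mod_cast hnh
  have hqn := potWeight_nonneg hnh
  have hrn := invStep_nonneg hnh
  have hSn : ∀ k, 0 ≤ ∑ i ∈ Finset.range k, s i := fun k => Finset.sum_nonneg fun i _ => hs i
  obtain ⟨c, hcdef⟩ : ∃ c : ℝ, c = 1 - 1 / nh := ⟨_, rfl⟩
  rw [← hcdef] at hc ⊢
  intro k hk
  induction k with
  | zero =>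
    have : potWeight nh 0 = invStep nh 0 := rfl
    rw [this]
    simpa [gronwall] using mul_le_mul_of_nonneg_left hy0 (hrn 0)
  | succ k ih =>
    have h1 := ih (by omega)
    have h2 := hy k (by omega)
    have h3 := mul_invStep_le hnh k
    have hgk := mul_le_mul_of_nonneg_left (hgrowth k (by omega)) (hqn k)
    have hsk : a k + potWeight nh k * x k ≤ T := by
      have := hsum k (by omega); have h7 := hSn k; linarith
    have hS := mul_nonneg hc (hSn k)
    have hsk0 := mul_nonneg hc (hs k)
    have hg0 := gronwall_pos hnh hκ k
    obtain ⟨η, hη⟩ : ∃ η, η = (1 + κ * (c * invStep nh (k + 1))) / (1 + κ * invStep nh k) :=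
      ⟨_, rfl⟩
    have hden : 0 < 1 + κ * invStep nh k := by have := hrn k; positivity
    have hη1 : η ≤ 1 := by
      rw [hη, div_le_one hden]
      rw [← hcdef] at h3
      nlinarith
    have hη0 : 0 ≤ η := by
      have h5 := hrn (k + 1)
      rw [hη]; positivity
    have hηeq : η * (1 + κ * invStep nh k) = 1 + κ * (c * invStep nh (k + 1)) := by
      rw [hη, div_mul_cancel₀ _ hden.ne']
    have hgs : gronwall nh κ (k + 1) = gronwall nh κ k * η := by rw [gronwall, hη, hcdef]
    rw [← hcdef] at h2
    rw [hgs, Finset.sum_range_succ]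
    -- split `q y = η q y + (1 - η) q y` and use the growth condition on the second part
    have h5 := mul_le_mul_of_nonneg_left h1 hη0
    have h6 : (1 - η) * (potWeight nh k * y k) ≤ (1 - η) * ((T - a k) / κ) := by
      refine mul_le_mul_of_nonneg_left ?_ (by linarith)
      rw [le_div_iff₀ hκ]; nlinarith
    have h7 : η * invStep nh k - (1 - η) / κ = c * invStep nh (k + 1) := by
      field_simp
      linarith
    have h8 : η * (invStep nh k * a k + (1 - gronwall nh κ k) / κ * T
          + c * ∑ i ∈ Finset.range k, s i) + (1 - η) * ((T - a k) / κ)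
        = (η * invStep nh k - (1 - η) / κ) * a k + (1 - gronwall nh κ k * η) / κ * T
          + η * (c * ∑ i ∈ Finset.range k, s i) := by
      field_simp; ring
    rw [h7] at h8
    have h9 : η * (c * ∑ i ∈ Finset.range k, s i) ≤ c * ∑ i ∈ Finset.range k, s i :=
      mul_le_of_le_one_left hS hη1
    nlinarith

/-- A bound of `y + r x` gives a bound of `c x + y` under the growth condition `κ y ≤ x`. -/
lemma contraction_of_bound {x y κ c r Q B T : ℝ} (hκ : 0 < κ) (hc : 0 ≤ c) (hcr : c ≤ r)
    (hQ : 0 ≤ Q) (hg : κ * y ≤ x) (hB : y + r * x ≤ B)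
    (hBT : B * (1 + κ / 2 * Q) ≤ (1 + κ * r) * T) :
    c * x + y ≤ (1 + c * κ) / (1 + κ / 2 * Q) * T := by
  have hpos : 0 < 1 + κ * r := by have := hc.trans hcr; positivity
  have h1 : (c * x + y) * (1 + κ * r) ≤ (1 + c * κ) * B := by
    have h2 := mul_nonneg (sub_nonneg.2 hcr) (sub_nonneg.2 hg)
    have h3 : (c * x + y) * (1 + κ * r) ≤ (1 + c * κ) * (y + r * x) := by linarith
    exact h3.trans (mul_le_mul_of_nonneg_left hB (by positivity))
  rw [div_mul_eq_mul_div, le_div_iff₀ (by positivity)]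
  refine le_of_mul_le_mul_right ?_ hpos
  calc _ = (c * x + y) * (1 + κ * r) * (1 + κ / 2 * Q) := by ring
    _ ≤ (1 + c * κ) * B * (1 + κ / 2 * Q) := mul_le_mul_of_nonneg_right h1 (by positivity)
    _ = (1 + c * κ) * (B * (1 + κ / 2 * Q)) := by ring
    _ ≤ (1 + c * κ) * ((1 + κ * r) * T) := mul_le_mul_of_nonneg_left hBT (by positivity)
    _ = _ := by ring

/-- The convexity bound suffices as long as `r ≤ 2`. -/
lemma contraction_of_le_two {x y W a κ c r Q T : ℝ} (hκ : 0 < κ) (hc : 0 ≤ c) (hcr : c ≤ r)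
    (hr : 0 < r) (hr2 : r ≤ 2) (hQ : 0 ≤ Q) (hQr : Q ≤ r ^ 2) (hT : 0 ≤ T) (hg : κ * y ≤ x)
    (hW : r ^ 2 * W ≤ r * a + (r ^ 2 - r) * T) (hyW : y ≤ W) (ha : a + r ^ 2 * x ≤ T) :
    c * x + y ≤ (1 + c * κ) / (1 + κ / 2 * Q) * T := by
  refine contraction_of_bound (B := T) hκ hc hcr hQ hg ?_ ?_
  · have h3 := mul_le_mul_of_nonneg_left hyW (sq_nonneg r)
    have h4 := mul_le_mul_of_nonneg_left ha hr.le
    have h5 : r ^ 2 * (y + r * x) ≤ r ^ 2 * T := by linarith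
    exact le_of_mul_le_mul_left h5 (by positivity)
  · have h6 : κ * (Q / 2) ≤ κ * r := mul_le_mul_of_nonneg_left (by nlinarith) hκ.le
    have h7 := mul_le_mul_of_nonneg_left h6 hT
    linarith

/-- The accumulated growth condition suffices as soon as `r ≥ 2`. -/
lemma contraction_of_two_le {x y a κ c r Q T S Γ : ℝ} (hκ : 0 < κ) (hc : 0 ≤ c) (hc1 : c ≤ 1)
    (hr2 : 2 ≤ r) (hQ : 0 ≤ Q) (hQr : Q ≤ r ^ 2) (hT : 0 ≤ T) (hS : 0 ≤ S) (hg : κ * y ≤ x)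
    (hy : r ^ 2 * y ≤ r * a + (1 - Γ) / κ * T + c * S) (ha : a + r ^ 2 * x + S / 2 ≤ T)
    (hΓ : (1 - κ / 2 * r ^ 2) / (1 + κ / 2 * r ^ 2) ≤ Γ / (1 + κ * r)) :
    c * x + y ≤ (1 + c * κ) / (1 + κ / 2 * Q) * T := by
  have h2 : r ^ 2 * (y + r * x) ≤ (r + (1 - Γ) / κ) * T := by
    have h3 := mul_le_mul_of_nonneg_left ha (show 0 ≤ r by linarith)
    have h4 : 0 ≤ (r / 2 - c) * S := mul_nonneg (by linarith) hS
    linarith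
  have h4 : (r + (1 - Γ) / κ) * T = (1 - Γ + κ * r) / κ * T := by
    field_simp; ring
  have h3 : y + r * x ≤ (1 - Γ + κ * r) * T / (κ * r ^ 2) := by
    rw [le_div_iff₀ (by positivity)]
    calc (y + r * x) * (κ * r ^ 2) = κ * (r ^ 2 * (y + r * x)) := by ring
      _ ≤ κ * ((1 - Γ + κ * r) / κ * T) := mul_le_mul_of_nonneg_left (h4 ▸ h2) hκ.le
      _ = _ := by field_simp
  have hκq : (1 - Γ + κ * r) * (1 + κ / 2 * r ^ 2) ≤ κ * r ^ 2 * (1 + κ * r) := by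
    rw [div_le_div_iff₀ (by positivity) (by positivity)] at hΓ
    linarith
  refine contraction_of_bound hκ hc (by linarith) hQ hg h3 ?_
  rw [div_mul_eq_mul_div, div_le_iff₀ (by positivity)]
  have h5 : (1 - Γ + κ * r) * (1 + κ / 2 * Q) ≤ κ * r ^ 2 * (1 + κ * r) := by
    rcases le_or_gt 0 (1 - Γ + κ * r) with h | h
    · refine le_trans (mul_le_mul_of_nonneg_left ?_ h) hκq
      have := mul_le_mul_of_nonneg_left hQr (show 0 ≤ κ / 2 by positivity)
      linarith
    · exact (mul_nonpos_of_nonpos_of_nonneg h.le (by positivity)).trans (by positivity)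
  have h6 := mul_le_mul_of_nonneg_right h5 hT
  linarith

/-- The scalar core of the linear rate of one restart cycle. In the application `a k` is the
expected squared distance of `z^k` to a fixed dual solution, `x k` an upper bound of the expected
dual gap and `y k` the expected squared distance to the dual solution set at the averaged iterate,
`W k` the averaged sequence of `a`, and `s k` the expected squared length of the `k`-th step.

For `q_{K+1} < 4` the convexity bound `y ≤ W` is sharp enough. For `q_{K+1} ≥ 4` the growth
condition has to be used at all earlier iterates; the variance terms `s k` that enter then are
absorbed by the decrease of `a k + q_k x k`. -/
lemma cycle_contraction {nh : ℕ} (hnh : 0 < nh) {κ : ℝ} (hκ : 0 < κ) {K : ℕ}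
    {a x y W s : ℕ → ℝ} {T : ℝ}
    (ha : ∀ k, 0 ≤ a k) (hx : ∀ k ≤ K + 1, 0 ≤ x k) (hs : ∀ k, 0 ≤ s k)
    (hT : a 0 + potWeight nh 0 * x 0 ≤ T)
    (hdecr : ∀ k ≤ K, a (k + 1) + potWeight nh (k + 1) * x (k + 1) + s k / 2
      ≤ a k + potWeight nh k * x k)
    (hy : ∀ k ≤ K, potWeight nh (k + 1) * y (k + 1) ≤ potWeight nh k * y k
      + invStep nh (k + 1) * (a (k + 1) - (1 - 1 / nh) * a k) + (1 - 1 / nh) * s k)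
    (hW : ∀ k ≤ K, potWeight nh (k + 1) * W (k + 1) = potWeight nh k * W k
      + invStep nh (k + 1) * (a (k + 1) - (1 - 1 / nh) * a k))
    (hW0 : W 0 = a 0) (hy0 : y 0 ≤ a 0) (hyW : y (K + 1) ≤ W (K + 1))
    (hgrowth : ∀ k ≤ K + 1, κ * y k ≤ x k) :
    (1 - 1 / nh) * x (K + 1) + y (K + 1)
      ≤ (1 + (1 - 1 / nh) * κ) / (1 + κ / 2 * ((K : ℝ) / (2 * nh) + 1) ^ 2) * T := by
  have hc := one_sub_inv_nonneg hnh
  have hn0 : (0 : ℝ) < nh := by exact_mod_cast hnh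
  have hi0 : (0 : ℝ) ≤ 1 / nh := by positivity
  have hqn := potWeight_nonneg hnh
  have hrn := invStep_nonneg hnh
  have hr1 := one_le_invStep hnh K
  have hrK := one_add_le_invStep hnh K
  have hqK := potWeight_succ (nh := nh) K
  -- the decrease, summed
  have hsum : ∀ k ≤ K + 1, a k + potWeight nh k * x k + (∑ i ∈ Finset.range k, s i) / 2 ≤ T := by
    intro k hk
    induction k with
    | zero => simpa using hT
    | succ k ih =>
      have h1 := ih (by omega)
      have h2 := hdecr k (by omega)
      rw [Finset.sum_range_succ]
      linarith
  have hSn : ∀ k, 0 ≤ ∑ i ∈ Finset.range k, s i := fun k => Finset.sum_nonneg fun i _ => hs i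
  have hT0 : 0 ≤ T := by
    have := hsum 0 (by omega)
    have h1 := mul_nonneg (hqn 0) (hx 0 (by omega))
    have h2 := ha 0
    have h3 := hSn 0
    linarith
  have hbase : (0 : ℝ) ≤ K / (2 * nh) := by positivity
  obtain ⟨Q, hQ⟩ : ∃ Q, Q = ((K : ℝ) / (2 * nh) + 1) ^ 2 := ⟨_, rfl⟩
  have hQq : Q ≤ potWeight nh (K + 1) := by
    rw [hqK, hQ]; exact pow_le_pow_left₀ (by positivity) (by linarith) 2
  have hQ0 : 0 ≤ Q := by rw [hQ]; positivity
  obtain ⟨r, hr⟩ : ∃ r, r = invStep nh (K + 1) := ⟨_, rfl⟩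
  obtain ⟨c, hcdef⟩ : ∃ c : ℝ, c = 1 - 1 / nh := ⟨_, rfl⟩
  have hc1 : c ≤ 1 := by rw [hcdef]; linarith
  rw [← hr] at hr1 hrK
  rw [← hr] at hqK
  rw [← hQ, ← hcdef]
  rw [← hcdef] at hc
  have hxK := hx (K + 1) le_rfl
  have hgK := hgrowth (K + 1) le_rfl
  have hsK := hsum (K + 1) le_rfl
  rcases lt_or_ge (potWeight nh (K + 1)) 4 with hq4 | hq4
  · have hWk : ∀ k ≤ K + 1, potWeight nh k * W k
        ≤ invStep nh k * a k + (potWeight nh k - invStep nh k) * T := by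
      intro k hk
      induction k with
      | zero =>
        have : potWeight nh 0 = invStep nh 0 := rfl
        rw [this, hW0, sub_self]; simp
      | succ k ih =>
        have h1 := ih (by omega)
        have h2 := hW k (by omega)
        have h3 := mul_invStep_le hnh k
        have h4 := potWeight_sub hnh k
        have h5 : a k ≤ T := by
          have := hsum k (by omega)
          have h6 := mul_nonneg (hqn k) (hx k (by omega))
          have h7 := hSn k
          linarith
        have h8 := mul_le_mul_of_nonneg_left h5 (sub_nonneg.2 h3)
        have h9 : invStep nh (k + 1) / nh = invStep nh (k + 1) * (1 / nh) := by ring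
        rw [h9] at h4
        rw [h2]
        have h10 : (potWeight nh (k + 1) - potWeight nh k - invStep nh (k + 1) * (1 / nh)) * T
          = 0 := by rw [h4]; ring
        nlinarith
    have h1 := hWk (K + 1) le_rfl
    have h2 : a (K + 1) ≤ T - potWeight nh (K + 1) * x (K + 1) := by
      have := hSn (K + 1); linarith
    rw [← hr, hqK] at h1
    rw [hqK] at hq4 hQq h2
    exact contraction_of_le_two hκ hc (by linarith) (by linarith) (by nlinarith) hQ0 hQq hT0 hgK h1
      hyW (by linarith)
  · -- the Gronwall argument
    have hyk := gronwall_bound (T := T) hnh hκ hs (fun k hk => by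
      have := hsum k hk; linarith) hy hy0 hgrowth
    rw [← hcdef] at hyk
    have h1 := hyk (K + 1) le_rfl
    have hlow := gronwall_lower hnh hκ (K + 1)
    rw [← hr] at h1 hlow
    rw [hqK] at h1 hsK hQq hq4 hlow
    exact contraction_of_two_le hκ hc hc1 (by nlinarith) hQ0 hQq hT0 (hSn _) hgK h1 hsK hlow

/-! ### The dual problem as a conjugate -/

namespace ConvexProblem

variable {t n p m : ℕ} (P : ConvexProblem t n p m)

/-- The constraint residuals, one for each dual variable. -/
def res (x : EuclideanSpace ℝ (Fin t)) : DualVec n p m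
  | Sum.inl i => P.Ax x i / n
  | Sum.inr (Sum.inl i) => P.eqRes x i
  | Sum.inr (Sum.inr i) => P.g i x

/-- The admissible values of the slack variable that is compared with the residual `j`. The primal
problem is `min f x + ∑ ψ_j y_j` subject to `res_j x = y_j` (`≤` for the inequality constraints)
and `y_j ∈ slackSet j`. -/
def slackSet : DualIndex n p m → Set ℝ
  | Sum.inl _ => Set.univ
  | Sum.inr (Sum.inl _) => {0}
  | Sum.inr (Sum.inr _) => Set.Iic 0

/-- The cost of the slack variables: `h_j` is the conjugate of `slackCost j` on `slackSet j`. -/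
def slackCost : DualIndex n p m → ℝ → ℝ
  | Sum.inl i, v => P.φ i (n * v) / n
  | Sum.inr _, _ => 0

/-- The domain of `h_j`. -/
def hDom (j : DualIndex n p m) : Set ℝ := {s | P.h j s ≠ ⊤}

/-- The real-valued version of `h_j`, meaningful on `hDom j`. -/
def hReal (j : DualIndex n p m) (s : ℝ) : ℝ := (P.h j s).toReal

lemma Lf_eq (x : EuclideanSpace ℝ (Fin t)) (u : DualVec n p m) :
    P.Lf x u = P.f x + ∑ j, u j * P.res x j := by
  simp only [Lf, res, Fintype.sum_sum_type]
  ring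

lemma gradd_eq (u : DualVec n p m) (j : DualIndex n p m) :
    P.gradd u j = -P.res (P.xOf u) j := by
  rcases j with i | i | i <;> rfl

lemma F_eq (x : EuclideanSpace ℝ (Fin t)) :
    P.F x = P.f x + ∑ i : Fin n, P.slackCost (Sum.inl i) (P.res x (Sum.inl i)) := by
  simp only [F, slackCost, res, Finset.mul_sum]
  congr 1
  refine Finset.sum_congr rfl fun i _ => ?_
  have : (0 : ℝ) < n := by exact_mod_cast i.pos
  rw [mul_div_cancel₀ _ this.ne']
  ring

lemma slackSet_nonempty (j : DualIndex n p m) : (slackSet j).Nonempty := by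
  rcases j with i | i | i
  · exact ⟨0, Set.mem_univ _⟩
  · exact ⟨0, rfl⟩
  · exact ⟨0, Set.mem_Iic.2 le_rfl⟩

lemma le_h {j : DualIndex n p m} {v : ℝ} (hv : v ∈ slackSet j) (s : ℝ) :
    ((s * v - P.slackCost j v : ℝ) : EReal) ≤ P.h j s := by
  rcases j with i | i | i
  · have hn : (0 : ℝ) < n := by exact_mod_cast i.pos
    have h1 : ((s * (n * v) - P.φ i (n * v) : ℝ) : EReal) ≤ conjugate (P.φ i) s :=
      le_iSup (fun v : ℝ => ((s * v - P.φ i v : ℝ) : EReal)) (n * v)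
    have h2 : ((1 / n : ℝ) : EReal) * ((s * (n * v) - P.φ i (n * v) : ℝ) : EReal)
        ≤ ((1 / n : ℝ) : EReal) * conjugate (P.φ i) s :=
      mul_le_mul_of_nonneg_left h1 (EReal.coe_nonneg.2 (by positivity))
    refine le_trans (le_of_eq ?_) h2
    rw [← EReal.coe_mul]
    congr 1
    simp only [slackCost]
    field_simp
  · have : v = 0 := hv
    subst this
    simp [slackCost, h]
  · have hv' : v ≤ 0 := hv
    simp only [slackCost, h, sub_zero]
    split_ifs with hs
    · exact_mod_cast mul_nonpos_of_nonneg_of_nonpos hs hv'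
    · exact le_top

lemma h_le {j : DualIndex n p m} {s r : ℝ}
    (hr : ∀ v ∈ slackSet j, s * v - P.slackCost j v ≤ r) : P.h j s ≤ (r : EReal) := by
  rcases j with i | i | i
  · have hn : (0 : ℝ) < n := by exact_mod_cast i.pos
    have h1 : conjugate (P.φ i) s ≤ ((n * r : ℝ) : EReal) := by
      refine iSup_le fun v => EReal.coe_le_coe_iff.2 ?_
      have h2 := hr (v / n) (Set.mem_univ _)
      simp only [slackCost] at h2
      rw [mul_div_cancel₀ _ hn.ne'] at h2
      calc s * v - P.φ i v = n * (s * (v / n) - P.φ i v / n) := by field_simp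
        _ ≤ n * r := mul_le_mul_of_nonneg_left h2 hn.le
    refine (mul_le_mul_of_nonneg_left h1
      (EReal.coe_nonneg.2 (show 0 ≤ 1 / (n : ℝ) by positivity))).trans (le_of_eq ?_)
    rw [← EReal.coe_mul]
    congr 1
    field_simp
  · have := hr 0 rfl
    simp only [slackCost, mul_zero, sub_zero] at this
    simp only [h]
    exact_mod_cast this
  · simp only [h]
    split_ifs with hs
    · have := hr 0 (le_refl (0 : ℝ))
      simp only [slackCost, mul_zero, sub_zero] at this
      exact_mod_cast this
    · exfalso
      push Not at hs
      have h0 := hr 0 (le_refl (0 : ℝ))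
      have h1 := hr ((r + 1) / s) (div_nonpos_of_nonneg_of_nonpos
        (by simp only [slackCost, mul_zero, sub_zero] at h0; linarith) hs.le)
      simp only [slackCost, sub_zero, mul_div_cancel₀ _ hs.ne] at h1
      linarith

lemma h_ne_bot (j : DualIndex n p m) (s : ℝ) : P.h j s ≠ ⊥ := by
  obtain ⟨v, hv⟩ := slackSet_nonempty j
  exact ((EReal.bot_lt_coe _).trans_le (P.le_h hv s)).ne'

variable {P}

lemma coe_hReal {j : DualIndex n p m} {s : ℝ} (hs : s ∈ P.hDom j) :
    (P.hReal j s : EReal) = P.h j s :=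
  EReal.coe_toReal hs (P.h_ne_bot j s)

/-- The Fenchel–Young inequality. -/
lemma le_hReal {j : DualIndex n p m} {s v : ℝ} (hs : s ∈ P.hDom j) (hv : v ∈ slackSet j) :
    s * v - P.slackCost j v ≤ P.hReal j s := by
  have := P.le_h hv s
  rw [← coe_hReal hs] at this
  exact_mod_cast this

lemma mem_hDom {j : DualIndex n p m} {s r : ℝ}
    (hr : ∀ v ∈ slackSet j, s * v - P.slackCost j v ≤ r) : s ∈ P.hDom j ∧ P.hReal j s ≤ r := by
  have h1 := P.h_le hr
  have h2 : s ∈ P.hDom j := (h1.trans_lt (EReal.coe_lt_top r)).ne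
  refine ⟨h2, ?_⟩
  rw [← coe_hReal h2] at h1
  exact_mod_cast h1

lemma nonneg_of_mem_hDom {i : Fin m} {s : ℝ} (hs : s ∈ P.hDom (Sum.inr (Sum.inr i))) : 0 ≤ s := by
  by_contra hlt
  exact hs (by simp [h, hlt])

lemma hReal_convexOn (j : DualIndex n p m) : ConvexOn ℝ (P.hDom j) (P.hReal j) := by
  have key : ∀ s ∈ P.hDom j, ∀ s' ∈ P.hDom j, ∀ a b : ℝ, 0 ≤ a → 0 ≤ b → a + b = 1 →
      ∀ v ∈ slackSet j, (a • s + b • s') * v - P.slackCost j v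
        ≤ a • P.hReal j s + b • P.hReal j s' := by
    intro s hs s' hs' a b ha hb hab v hv
    have h1 := mul_le_mul_of_nonneg_left (le_hReal hs hv) ha
    have h2 := mul_le_mul_of_nonneg_left (le_hReal hs' hv) hb
    simp only [smul_eq_mul]
    have h3 : P.slackCost j v = a * P.slackCost j v + b * P.slackCost j v := by
      rw [← add_mul, hab, one_mul]
    rw [h3]
    linarith
  exact ⟨fun s hs s' hs' a b ha hb hab => (mem_hDom (key s hs s' hs' a b ha hb hab)).1,
    fun s hs s' hs' a b ha hb hab => (mem_hDom (key s hs s' hs' a b ha hb hab)).2⟩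

lemma sum_h_ne_bot (S : Finset (DualIndex n p m)) (u : DualVec n p m) :
    ∑ j ∈ S, P.h j (u j) ≠ ⊥ := by
  classical
  induction S using Finset.induction_on with
  | empty => simp
  | insert a S ha ih =>
    rw [Finset.sum_insert ha]
    exact EReal.add_ne_bot_iff.2 ⟨P.h_ne_bot _ _, ih⟩

lemma D_eq {u : DualVec n p m} (hu : ∀ j, u j ∈ P.hDom j) :
    P.D u = ((P.d u + ∑ j, P.hReal j (u j) : ℝ) : EReal) := by
  classical
  have hsum : ∀ S : Finset (DualIndex n p m),
      ∑ j ∈ S, P.h j (u j) = ((∑ j ∈ S, P.hReal j (u j) : ℝ) : EReal) := by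
    intro S
    induction S using Finset.induction_on with
    | empty => simp
    | insert a S ha ih =>
      rw [Finset.sum_insert ha, Finset.sum_insert ha, ih, EReal.coe_add, coe_hReal (hu a)]
  rw [D, EReal.coe_add, hsum]

lemma D_ne_bot (u : DualVec n p m) : P.D u ≠ ⊥ :=
  EReal.add_ne_bot_iff.2 ⟨EReal.coe_ne_bot _, sum_h_ne_bot _ _⟩

lemma mem_hDom_of_D_ne_top {u : DualVec n p m} (hu : P.D u ≠ ⊤) (j : DualIndex n p m) :
    u j ∈ P.hDom j := by
  classical
  intro htop
  apply hu
  rw [D, ← Finset.add_sum_erase _ _ (Finset.mem_univ j), htop,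
    EReal.top_add_of_ne_bot (sum_h_ne_bot _ _), EReal.coe_add_top]

lemma mem_dualFeasible {u : DualVec n p m} (hu : ∀ j, u j ∈ P.hDom j) : u ∈ P.dualFeasible :=
  fun _ => nonneg_of_mem_hDom (hu _)

/-! ### Convexity and Lipschitz continuity of the residuals -/

lemma res_combo_of_not_ineq {j : DualIndex n p m} (hj : ∀ i, j ≠ Sum.inr (Sum.inr i))
    (x y : EuclideanSpace ℝ (Fin t)) {a b : ℝ} (hab : a + b = 1) :
    P.res (a • x + b • y) j = a * P.res x j + b * P.res y j := by
  rcases j with i | i | i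
  · simp only [res, Ax, WithLp.ofLp_add, WithLp.ofLp_smul, Matrix.mulVec_add, Matrix.mulVec_smul,
      Pi.add_apply, Pi.smul_apply, smul_eq_mul]
    ring
  · simp only [res, eqRes, WithLp.ofLp_add, WithLp.ofLp_smul, Matrix.mulVec_add,
      Matrix.mulVec_smul, Pi.add_apply, Pi.smul_apply, smul_eq_mul]
    have : P.b i = a * P.b i + b * P.b i := by rw [← add_mul, hab, one_mul]
    linarith
  · exact absurd rfl (hj i)

lemma Standing.res_convexOn (hP : P.Standing) (j : DualIndex n p m) :
    ConvexOn ℝ Set.univ fun x => P.res x j := by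
  rcases j with i | i | i
  · exact ⟨convex_univ, fun x _ y _ a b _ _ hab => (res_combo_of_not_ineq (by simp) x y hab).le⟩
  · exact ⟨convex_univ, fun x _ y _ a b _ _ hab => (res_combo_of_not_ineq (by simp) x y hab).le⟩
  · exact hP.g_convex i

lemma Standing.mul_res_convexOn (hP : P.Standing) {u : DualVec n p m} (hu : u ∈ P.dualFeasible)
    (j : DualIndex n p m) : ConvexOn ℝ Set.univ fun x => u j * P.res x j := by
  by_cases hj : ∃ i, j = Sum.inr (Sum.inr i)
  · obtain ⟨i, rfl⟩ := hj
    exact (hP.res_convexOn _).smul (hu i)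
  · push Not at hj
    refine ⟨convex_univ, fun x _ y _ a b _ _ hab => le_of_eq ?_⟩
    simp only [res_combo_of_not_ineq hj x y hab, smul_eq_mul]
    ring

lemma Standing.Lf_strongConvexOn (hP : P.Standing) {u : DualVec n p m}
    (hu : u ∈ P.dualFeasible) : StrongConvexOn Set.univ P.μ fun x => P.Lf x u := by
  have h1 : ConvexOn ℝ Set.univ fun x => ∑ j, u j * P.res x j := by
    refine ⟨convex_univ, fun x hx y hy a b ha hb hab => ?_⟩
    simp only [smul_eq_mul, Finset.mul_sum, ← Finset.sum_add_distrib]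
    exact Finset.sum_le_sum fun j _ => (hP.mul_res_convexOn hu j).2 hx hy ha hb hab
  have h2 := UniformConvexOn.add hP.f_strongConvex (uniformConvexOn_zero.2 h1)
  rw [add_zero] at h2
  refine (show (fun x => P.Lf x u) = _ from funext fun x => ?_) ▸ h2
  rw [Lf_eq]
  rfl

lemma Standing.f_convexOn (hP : P.Standing) : ConvexOn ℝ Set.univ P.f :=
  UniformConvexOn.convexOn hP.f_strongConvex fun r => by
    have := hP.mu_pos
    simp only [Pi.zero_apply]; positivity

/-- `x*(u)` minimizes the Lagrangian. -/
lemma Standing.Lf_xOf_le (hP : P.Standing) {u : DualVec n p m} (hu : u ∈ P.dualFeasible)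
    (y : EuclideanSpace ℝ (Fin t)) : P.Lf (P.xOf u) u ≤ P.Lf y u := by
  have hsc := hP.Lf_strongConvexOn hu
  have hcont : Continuous fun x => P.Lf x u := by
    refine (UniformConvexOn.convexOn hsc fun r => ?_).locallyLipschitz.continuous
    have := hP.mu_pos
    simp only [Pi.zero_apply]; positivity
  obtain ⟨x, hx⟩ := hcont.exists_forall_le (hsc.tendsto_cocompact_atTop hP.mu_pos)
  have h := Classical.epsilon_spec (p := fun x => x ∈ (Set.univ : Set (EuclideanSpace ℝ (Fin t))) ∧
    ∀ y ∈ (Set.univ : Set (EuclideanSpace ℝ (Fin t))), P.Lf x u ≤ P.Lf y u)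
    ⟨x, Set.mem_univ _, fun y _ => hx y⟩
  exact h.2 y (Set.mem_univ _)

lemma Standing.Lf_growth (hP : P.Standing) {u : DualVec n p m} (hu : u ∈ P.dualFeasible)
    (y : EuclideanSpace ℝ (Fin t)) :
    P.Lf (P.xOf u) u + P.μ / 2 * ‖P.xOf u - y‖ ^ 2 ≤ P.Lf y u :=
  (hP.Lf_strongConvexOn hu).quadratic_growth (hP.Lf_xOf_le hu) y

lemma Standing.g_sub_le (hP : P.Standing) (i : Fin m) (x y : EuclideanSpace ℝ (Fin t)) :
    P.g i x - P.g i y ≤ P.Lg i * ‖x - y‖ := by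
  obtain ⟨l, hl⟩ := (hP.g_convex i).exists_affine_minorant
    (hP.g_convex i).locallyLipschitz.continuous x
  obtain ⟨s, hs⟩ := (InnerProductSpace.toDual ℝ (EuclideanSpace ℝ (Fin t))).surjective l
  have hsl : ∀ z, l z = inner ℝ s z := by
    intro z; rw [← hs]; rfl
  have h1 : ‖s‖ ≤ P.Lg i := hP.g_subgradient i x s fun z => by rw [← hsl]; exact hl z
  have h2 := hl y
  have h3 : -l (y - x) ≤ ‖s‖ * ‖x - y‖ := by
    rw [← map_neg, neg_sub, hsl]; exact real_inner_le_norm _ _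
  have h4 := mul_le_mul_of_nonneg_right h1 (norm_nonneg (x - y))
  linarith

lemma Standing.res_sub_sq_le (hP : P.Standing) (j : DualIndex n p m)
    (x y : EuclideanSpace ℝ (Fin t)) :
    (P.res x j - P.res y j) ^ 2 ≤ P.μ * P.L j * ‖x - y‖ ^ 2 := by
  have hμ := hP.mu_pos
  rcases j with i | i | i
  · have hn : (0 : ℝ) < n := by exact_mod_cast i.pos
    have h1 : P.res x (Sum.inl i) - P.res y (Sum.inl i)
        = (∑ s, P.A s i * (x - y) s) / n := by
      simp only [res, Ax, Matrix.mulVec, dotProduct, Matrix.transpose_apply, ← sub_div,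
        ← Finset.sum_sub_distrib, ← mul_sub, PiLp.sub_apply]
    have h2 := Finset.sum_mul_sq_le_sq_mul_sq Finset.univ (fun s => P.A s i) (fun s => (x - y) s)
    rw [h1, EuclideanSpace.real_norm_sq_eq, div_pow, div_le_iff₀ (by positivity)]
    refine h2.trans (le_of_eq ?_)
    simp only [L]
    field_simp
  · have h1 : P.res x (Sum.inr (Sum.inl i)) - P.res y (Sum.inr (Sum.inl i))
        = ∑ s, P.B i s * (x - y) s := by
      simp only [res, eqRes, Matrix.mulVec, dotProduct, Pi.add_apply, add_sub_add_right_eq_sub,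
        ← Finset.sum_sub_distrib, ← mul_sub, PiLp.sub_apply]
    have h2 := Finset.sum_mul_sq_le_sq_mul_sq Finset.univ (fun s => P.B i s) (fun s => (x - y) s)
    rw [h1, EuclideanSpace.real_norm_sq_eq]
    refine h2.trans (le_of_eq ?_)
    simp only [L]
    field_simp
  · have h1 := hP.g_sub_le i x y
    have h2 := hP.g_sub_le i y x
    rw [norm_sub_rev] at h2
    have h3 : P.μ * P.L (Sum.inr (Sum.inr i)) * ‖x - y‖ ^ 2 = (P.Lg i * ‖x - y‖) ^ 2 := by
      simp only [L]; field_simp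
    rw [h3, ← sq_abs]
    change |P.g i x - P.g i y| ^ 2 ≤ _
    exact pow_le_pow_left₀ (abs_nonneg _) (abs_le.2 ⟨by linarith, h1⟩) 2

/-- Every value of the Lagrangian bounds the dual function: `d` is the supremum of the affine
functions `-L_f(x, ·)`. -/
lemma Standing.neg_Lf_le_d (hP : P.Standing) {u : DualVec n p m} (hu : u ∈ P.dualFeasible)
    (x : EuclideanSpace ℝ (Fin t)) : -P.Lf x u ≤ P.d u :=
  neg_le_neg (hP.Lf_xOf_le hu x)

/-- The coordinate descent inequality of `d`, from the strong convexity of the Lagrangian. -/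
lemma Standing.d_update_le (hP : P.Standing) {u : DualVec n p m} (hu : u ∈ P.dualFeasible)
    {j : DualIndex n p m} {δ : ℝ} (hw : u + Pi.single j δ ∈ P.dualFeasible) :
    P.d (u + Pi.single j δ) ≤ P.d u + P.gradd u j * δ + P.L j / 2 * δ ^ 2 := by
  have hμ := hP.mu_pos
  set w := u + Pi.single j δ with hwdef
  have h1 := hP.Lf_growth hu (P.xOf w)
  have h2 := hP.res_sub_sq_le j (P.xOf u) (P.xOf w)
  have h3 : P.Lf (P.xOf w) w = P.Lf (P.xOf w) u + δ * P.res (P.xOf w) j := by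
    rw [Lf_eq, Lf_eq, hwdef]
    simp only [Pi.add_apply, add_mul, Finset.sum_add_distrib, Pi.single_apply, ite_mul, zero_mul,
      Finset.sum_ite_eq', Finset.mem_univ, if_true]
    ring
  simp only [d, gradd_eq, h3]
  set ρ := ‖P.xOf u - P.xOf w‖
  set e := P.res (P.xOf u) j - P.res (P.xOf w) j with he
  have h4 : P.res (P.xOf w) j = P.res (P.xOf u) j - e := by rw [he]; ring
  rw [h4]
  have h5 : δ * e ≤ P.L j / 2 * δ ^ 2 + P.μ / 2 * ρ ^ 2 := by
    have hL : 0 ≤ P.L j := by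
      rcases j with i | i | i <;> simp only [L] <;> positivity
    have h6 : (δ * e) ^ 2 ≤ (P.L j * δ ^ 2) * (P.μ * ρ ^ 2) := by
      calc (δ * e) ^ 2 = δ ^ 2 * e ^ 2 := by ring
        _ ≤ δ ^ 2 * (P.μ * P.L j * ρ ^ 2) := mul_le_mul_of_nonneg_left h2 (sq_nonneg _)
        _ = _ := by ring
    have h7 : 0 ≤ P.L j * δ ^ 2 := by positivity
    have h8 : 0 ≤ P.μ * ρ ^ 2 := by positivity
    refine (le_abs_self _).trans (abs_le_of_sq_le_sq (h6.trans ?_) (by linarith))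
    linarith [sq_nonneg (P.L j * δ ^ 2 - P.μ * ρ ^ 2)]
  linarith

end ConvexProblem

namespace ConvexProblem

variable {t n p m : ℕ} {P : ConvexProblem t n p m}

/-! ### Strong duality -/

lemma Standing.res_continuous (hP : P.Standing) (j : DualIndex n p m) :
    Continuous fun x => P.res x j :=
  (hP.res_convexOn j).locallyLipschitz.continuous

lemma Standing.slackCost_convexOn (hP : P.Standing) (j : DualIndex n p m) :
    ConvexOn ℝ Set.univ (P.slackCost j) := by
  rcases j with i | i
  · have hn : (0 : ℝ) < n := by exact_mod_cast i.pos
    refine ⟨convex_univ, fun x _ y _ a b ha hb hab => ?_⟩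
    have h1 := (hP.phi_convex i).2 (Set.mem_univ (n * x)) (Set.mem_univ (n * y)) ha hb hab
    simp only [slackCost, smul_eq_mul] at h1 ⊢
    have h2 : (n : ℝ) * (a * x + b * y) = a * (n * x) + b * (n * y) := by ring
    rw [h2, div_le_iff₀ hn]
    refine h1.trans (le_of_eq ?_)
    field_simp
  · exact convexOn_const 0 convex_univ

lemma Standing.F_strongConvexOn (hP : P.Standing) : StrongConvexOn Set.univ P.μ P.F := by
  have h1 : ConvexOn ℝ Set.univ
      fun x => ∑ i : Fin n, P.slackCost (Sum.inl i) (P.res x (Sum.inl i)) := by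
    refine ⟨convex_univ, fun x _ y _ a b ha hb hab => ?_⟩
    simp only [smul_eq_mul, Finset.mul_sum, ← Finset.sum_add_distrib]
    refine Finset.sum_le_sum fun i _ => ?_
    rw [res_combo_of_not_ineq (by simp) x y hab]
    exact (hP.slackCost_convexOn (Sum.inl i)).2 (Set.mem_univ _) (Set.mem_univ _) ha hb hab
  have h2 := UniformConvexOn.add hP.f_strongConvex (uniformConvexOn_zero.2 h1)
  rw [add_zero] at h2
  refine (show P.F = _ from funext fun x => ?_) ▸ h2
  rw [F_eq]
  rfl

lemma Standing.primalSol_nonempty (hP : P.Standing) : P.primalSol.Nonempty := by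
  have hcl : IsClosed P.feasible := by
    have : P.feasible = (⋂ i, {x | P.res x (Sum.inr (Sum.inl i)) = 0}) ∩
        ⋂ i, {x | P.res x (Sum.inr (Sum.inr i)) ≤ 0} := by
      ext x
      simp only [feasible, Set.mem_ofPred_eq, Set.mem_inter_iff, Set.mem_iInter, funext_iff, res,
        Pi.zero_apply]
    rw [this]
    exact (isClosed_iInter fun i => isClosed_eq (hP.res_continuous _) continuous_const).inter
      (isClosed_iInter fun i => isClosed_le (hP.res_continuous _) continuous_const)
  have hF := hP.F_strongConvexOn
  have hcont : Continuous P.F := by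
    refine (UniformConvexOn.convexOn hF fun r => ?_).locallyLipschitz.continuous
    have := hP.mu_pos
    simp only [Pi.zero_apply]; positivity
  obtain ⟨x₀, hx₀, hx₀'⟩ := hP.slater
  have hmem : x₀ ∈ P.feasible := ⟨hx₀', fun i => (hx₀ i).le⟩
  obtain ⟨x, hx, hmin⟩ := hcont.continuousOn.exists_isMinOn' hcl hmem
    (((hF.tendsto_cocompact_atTop hP.mu_pos).eventually_ge_atTop (P.F x₀)).filter_mono inf_le_left)
  exact ⟨x, hx, fun y hy => hmin hy⟩

/-- A bound of `∑ (u_j y_j - ψ_j y_j)` that is uniform in the slack variables bounds the sum of the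
conjugates. -/
lemma sum_hReal_le {u : DualVec n p m} {r : ℝ}
    (hr : ∀ y : DualVec n p m, (∀ j, y j ∈ slackSet j) →
      ∑ j, (u j * y j - P.slackCost j (y j)) ≤ r) :
    (∀ j, u j ∈ P.hDom j) ∧ ∑ j, P.hReal j (u j) ≤ r := by
  classical
  choose y₀ hy₀ using fun j : DualIndex n p m => slackSet_nonempty j
  set k : DualIndex n p m → ℝ → ℝ := fun j v => u j * v - P.slackCost j v with hk
  have hdom : ∀ j, u j ∈ P.hDom j := by
    intro j
    refine (mem_hDom (r := r - ∑ i ∈ Finset.univ.erase j, k i (y₀ i)) fun v hv => ?_).1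
    have h1 := hr (Function.update y₀ j v) (fun i => by
      by_cases hi : i = j
      · subst hi; simpa using hv
      · simpa [hi] using hy₀ i)
    rw [← Finset.add_sum_erase _ _ (Finset.mem_univ j)] at h1
    have h2 : ∑ i ∈ Finset.univ.erase j, (u i * Function.update y₀ j v i
        - P.slackCost i (Function.update y₀ j v i)) = ∑ i ∈ Finset.univ.erase j, k i (y₀ i) := by
      refine Finset.sum_congr rfl fun i hi => ?_
      rw [Function.update_of_ne (Finset.ne_of_mem_erase hi)]
    rw [h2, Function.update_self] at h1
    linarith
  refine ⟨hdom, le_of_forall_pos_le_add fun ε hε => ?_⟩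
  have hex : ∀ j, ∃ v ∈ slackSet j,
      P.hReal j (u j) - ε / (Fintype.card (DualIndex n p m) + 1) < k j v := by
    intro j
    by_contra! hcon
    have h1 := (mem_hDom hcon).2
    have h2 : 0 < ε / ((Fintype.card (DualIndex n p m) : ℝ) + 1) := by positivity
    linarith
  choose y hy hlt using hex
  have h1 := hr y hy
  have h2 : ∑ j, P.hReal j (u j) ≤ ∑ j, (k j (y j)
      + ε / (Fintype.card (DualIndex n p m) + 1)) :=
    Finset.sum_le_sum fun j _ => by linarith [hlt j]
  rw [Finset.sum_add_distrib, Finset.sum_const, nsmul_eq_mul, Finset.card_univ] at h2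
  have h3 : (Fintype.card (DualIndex n p m) : ℝ) * (ε / (Fintype.card (DualIndex n p m) + 1))
      ≤ ε := by
    rw [mul_div_assoc', div_le_iff₀ (by positivity)]
    nlinarith
  linarith

/-- Weak duality in the slack form. -/
lemma Standing.neg_slackLagrangian_le (hP : P.Standing) {u : DualVec n p m}
    (hu : ∀ j, u j ∈ P.hDom j) (x : EuclideanSpace ℝ (Fin t)) {y : DualVec n p m}
    (hy : ∀ j, y j ∈ slackSet j) :
    -(P.f x + ∑ j, P.slackCost j (y j) + ∑ j, u j * (P.res x j - y j))
      ≤ P.d u + ∑ j, P.hReal j (u j) := by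
  have h1 := hP.neg_Lf_le_d (mem_dualFeasible hu) x
  have h2 : ∑ j, (u j * y j - P.slackCost j (y j)) ≤ ∑ j, P.hReal j (u j) :=
    Finset.sum_le_sum fun j _ => le_hReal (hu j) (hy j)
  rw [Lf_eq] at h1
  simp only [mul_sub, Finset.sum_sub_distrib] at h2 ⊢
  linarith

lemma sum_slackCost (y : DualVec n p m) :
    ∑ j, P.slackCost j (y j) = ∑ i : Fin n, P.slackCost (Sum.inl i) (y (Sum.inl i)) := by
  simp [Fintype.sum_sum_type, slackCost]

lemma Standing.weak_duality (hP : P.Standing) {x : EuclideanSpace ℝ (Fin t)}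
    (hx : x ∈ P.feasible) (u : DualVec n p m) : ((-P.F x : ℝ) : EReal) ≤ P.D u := by
  by_cases hu : P.D u = ⊤
  · rw [hu]; exact le_top
  have hdom := mem_hDom_of_D_ne_top hu
  rw [D_eq hdom]
  refine EReal.coe_le_coe_iff.2 ?_
  have h1 := hP.neg_slackLagrangian_le hdom x (y := P.res x) (by
    rintro (i | i | i)
    · exact Set.mem_univ _
    · exact congrFun hx.1 i
    · exact hx.2 i)
  simp only [sub_self, mul_zero, Finset.sum_const_zero, add_zero, sum_slackCost] at h1
  rwa [F_eq]

/-- Strong duality: a vector of Lagrange multipliers of the problem in the slack form attains the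
negative of the optimal value. -/
lemma Standing.exists_dual (hP : P.Standing) {x : EuclideanSpace ℝ (Fin t)}
    (hx : x ∈ P.primalSol) : ∃ u, P.D u ≤ ((-P.F x : ℝ) : EReal) := by
  let f' : EuclideanSpace ℝ (Fin t) × (Fin n → ℝ) → ℝ :=
    fun z => P.f z.1 + ∑ i, P.slackCost (Sum.inl i) (z.2 i)
  have hf' : ConvexOn ℝ Set.univ f' := by
    refine ⟨convex_univ, fun z _ w _ a b ha hb hab => ?_⟩
    have h1 := hP.f_convexOn.2 (Set.mem_univ z.1) (Set.mem_univ w.1) ha hb hab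
    have h2 : ∑ i, P.slackCost (Sum.inl i) ((a • z + b • w).2 i)
        ≤ ∑ i, (a * P.slackCost (Sum.inl i) (z.2 i) + b * P.slackCost (Sum.inl i) (w.2 i)) :=
      Finset.sum_le_sum fun i _ => (hP.slackCost_convexOn (Sum.inl i)).2 (Set.mem_univ _)
        (Set.mem_univ _) ha hb hab
    rw [Finset.sum_add_distrib, ← Finset.mul_sum, ← Finset.mul_sum] at h2
    simp only [f', smul_eq_mul, Prod.fst_add, Prod.smul_fst] at h1 ⊢
    linarith
  let G : EuclideanSpace ℝ (Fin t) × (Fin n → ℝ) →ₗ[ℝ] (Fin n ⊕ Fin p → ℝ) :=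
    { toFun := fun z => Sum.elim (fun i => P.Ax z.1 i / n - z.2 i) (P.B *ᵥ z.1.ofLp)
      map_add' := by
        intro z w
        funext i
        rcases i with i | i
        · simp only [Ax, Sum.elim_inl, Prod.fst_add, Prod.snd_add, WithLp.ofLp_add,
            Matrix.mulVec_add, Pi.add_apply]
          ring
        · simp only [Sum.elim_inr, Prod.fst_add, WithLp.ofLp_add, Matrix.mulVec_add, Pi.add_apply]
      map_smul' := by
        intro a z
        funext i
        rcases i with i | i
        · simp only [Ax, Sum.elim_inl, Prod.smul_fst, Prod.smul_snd, WithLp.ofLp_smul,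
            Matrix.mulVec_smul, Pi.smul_apply, smul_eq_mul, RingHom.id_apply]
          ring
        · simp only [Sum.elim_inr, Prod.smul_fst, WithLp.ofLp_smul, Matrix.mulVec_smul,
            Pi.smul_apply, RingHom.id_apply] }
  let c : Fin n ⊕ Fin p → ℝ := Sum.elim 0 P.b
  have hGl : ∀ z i, (G z + c) (Sum.inl i) = P.res z.1 (Sum.inl i) - z.2 i := by
    intro z i
    simp [G, c, res]
  have hGr : ∀ z i, (G z + c) (Sum.inr i) = P.res z.1 (Sum.inr (Sum.inl i)) := by
    intro z i
    simp [G, c, res, eqRes]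
  obtain ⟨x₀, hx₀, hx₀'⟩ := hP.slater
  obtain ⟨l, ν, hν, hmain⟩ := exists_lagrange_multipliers hf' G c
    (g := fun i z => P.g i z.1) (fun i => ⟨convex_univ, fun z _ w _ a b ha hb hab =>
      (hP.g_convex i).2 (Set.mem_univ z.1) (Set.mem_univ w.1) ha hb hab⟩)
    (x₀ := (x₀, fun i => P.res x₀ (Sum.inl i)))
    (by
      funext i
      rcases i with i | i
      · rw [hGl]; simp
      · rw [hGr]; exact congrFun hx₀' i)
    hx₀ (v := P.F x) (by
      rintro ⟨z, y⟩ hz hg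
      have hy : y = fun i => P.res z (Sum.inl i) := by
        funext i
        have := congrFun hz (Sum.inl i)
        rw [hGl] at this
        simp only [Pi.zero_apply] at this
        linarith
      have hzf : z ∈ P.feasible := by
        refine ⟨funext fun i => ?_, hg⟩
        have := congrFun hz (Sum.inr i)
        rwa [hGr] at this
      have := hx.2 z hzf
      rw [P.F_eq z] at this
      simpa [f', hy] using this)
  let u : DualVec n p m := Sum.elim (fun i => l (Sum.inl i))
    (Sum.elim (fun i => l (Sum.inr i)) ν)
  have hbound : ∀ y : DualVec n p m, (∀ j, y j ∈ slackSet j) →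
      ∑ j, (u j * y j - P.slackCost j (y j)) ≤ P.Lf (P.xOf u) u - P.F x := by
    intro y hy
    have h1 := hmain (P.xOf u, fun i => y (Sum.inl i))
    have h2 : ∑ i, u (Sum.inr (Sum.inl i)) * y (Sum.inr (Sum.inl i)) = 0 :=
      Finset.sum_eq_zero fun i _ => by
        rw [show y (Sum.inr (Sum.inl i)) = 0 from hy (Sum.inr (Sum.inl i)), mul_zero]
    have h3 : ∑ i, u (Sum.inr (Sum.inr i)) * y (Sum.inr (Sum.inr i)) ≤ 0 :=
      Finset.sum_nonpos fun i _ => mul_nonpos_of_nonneg_of_nonpos (hν i) (hy (Sum.inr (Sum.inr i)))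
    simp only [Fintype.sum_sum_type, hGl, hGr, mul_sub, Finset.sum_sub_distrib, f'] at h1
    rw [Finset.sum_sub_distrib, sum_slackCost, Lf_eq]
    simp only [Fintype.sum_sum_type]
    rw [h2]
    simp only [u, Sum.elim_inl, Sum.elim_inr] at h3 ⊢
    simp only [u] at h1
    have h4 : ∀ z i, P.res z (Sum.inr (Sum.inr i)) = P.g i z := fun _ _ => rfl
    simp only [h4]
    linarith
  obtain ⟨hdom, hle⟩ := sum_hReal_le hbound
  refine ⟨u, ?_⟩
  rw [D_eq hdom]
  refine EReal.coe_le_coe_iff.2 ?_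
  simp only [d]
  linarith

section DualSol

variable (hP : P.Standing) {xs : EuclideanSpace ℝ (Fin t)} (hxs : xs ∈ P.primalSol)
include hP hxs

lemma Standing.mem_dualSol_iff {u : DualVec n p m} :
    u ∈ P.dualSol ↔ P.D u ≤ ((-P.F xs : ℝ) : EReal) := by
  constructor
  · intro hu
    obtain ⟨w, hw⟩ := hP.exists_dual hxs
    exact (hu w).trans hw
  · intro hu v
    exact hu.trans (hP.weak_duality hxs.1 v)

lemma Standing.D_eq_of_mem_dualSol {u : DualVec n p m} (hu : u ∈ P.dualSol) :
    P.D u = ((-P.F xs : ℝ) : EReal) :=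
  le_antisymm ((hP.mem_dualSol_iff hxs).1 hu) (hP.weak_duality hxs.1 u)

lemma Standing.mem_hDom_of_mem_dualSol {u : DualVec n p m} (hu : u ∈ P.dualSol)
    (j : DualIndex n p m) : u j ∈ P.hDom j :=
  mem_hDom_of_D_ne_top (by rw [hP.D_eq_of_mem_dualSol hxs hu]; exact EReal.coe_ne_top _) j

lemma Standing.D_real_of_mem_dualSol {u : DualVec n p m} (hu : u ∈ P.dualSol) :
    P.d u + ∑ j, P.hReal j (u j) = -P.F xs := by
  have h1 := hP.D_eq_of_mem_dualSol hxs hu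
  rw [D_eq (hP.mem_hDom_of_mem_dualSol hxs hu)] at h1
  exact_mod_cast h1

lemma Standing.neg_F_le_D_real {u : DualVec n p m} (hu : ∀ j, u j ∈ P.hDom j) :
    -P.F xs ≤ P.d u + ∑ j, P.hReal j (u j) := by
  have h1 := hP.weak_duality hxs.1 u
  rw [D_eq hu] at h1
  exact_mod_cast h1

/-- The dual solution set as an intersection of half-spaces. -/
lemma Standing.dualSol_eq : P.dualSol = {u | u ∈ P.dualFeasible ∧
    ∀ x, ∀ y : DualVec n p m, (∀ j, y j ∈ slackSet j) →
      -(P.f x + ∑ j, P.slackCost j (y j) + ∑ j, u j * (P.res x j - y j)) ≤ -P.F xs} := by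
  ext u
  constructor
  · intro hu
    have hdom := hP.mem_hDom_of_mem_dualSol hxs hu
    refine ⟨mem_dualFeasible hdom, fun x y hy => ?_⟩
    rw [← hP.D_real_of_mem_dualSol hxs hu]
    exact hP.neg_slackLagrangian_le hdom x hy
  · rintro ⟨hu, hall⟩
    obtain ⟨hdom, hle⟩ := sum_hReal_le (P := P) (u := u) (r := P.Lf (P.xOf u) u - P.F xs)
      (fun y hy => by
        have := hall (P.xOf u) y hy
        rw [Lf_eq]
        simp only [mul_sub, Finset.sum_sub_distrib] at this ⊢
        linarith)
    rw [hP.mem_dualSol_iff hxs, D_eq hdom]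
    refine EReal.coe_le_coe_iff.2 ?_
    simp only [d]
    linarith

lemma Standing.dualSol_isClosed : IsClosed P.dualSol := by
  rw [hP.dualSol_eq hxs]
  have : {u : DualVec n p m | u ∈ P.dualFeasible ∧
      ∀ x, ∀ y : DualVec n p m, (∀ j, y j ∈ slackSet j) →
        -(P.f x + ∑ j, P.slackCost j (y j) + ∑ j, u j * (P.res x j - y j)) ≤ -P.F xs}
      = (⋂ i, {u : DualVec n p m | 0 ≤ u (Sum.inr (Sum.inr i))}) ∩
        ⋂ x, ⋂ y : DualVec n p m, ⋂ _ : ∀ j, y j ∈ slackSet j, {u : DualVec n p m |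
          -(P.f x + ∑ j, P.slackCost j (y j) + ∑ j, u j * (P.res x j - y j)) ≤ -P.F xs} := by
    ext u
    simp only [dualFeasible, Set.mem_ofPred_eq, Set.mem_inter_iff, Set.mem_iInter]
  rw [this]
  refine (isClosed_iInter fun i => isClosed_le continuous_const (by fun_prop)).inter
    (isClosed_iInter fun x => isClosed_iInter fun y => isClosed_iInter fun _ =>
      isClosed_le (by fun_prop) continuous_const)

lemma Standing.dualSol_convex : Convex ℝ P.dualSol := by
  rw [hP.dualSol_eq hxs]
  rintro u ⟨hu, hu'⟩ w ⟨hw, hw'⟩ a b ha hb hab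
  refine ⟨fun i => ?_, fun x y hy => ?_⟩
  · have h1 := mul_nonneg ha (hu i)
    have h2 := mul_nonneg hb (hw i)
    simpa using add_nonneg h1 h2
  · have h1 := mul_le_mul_of_nonneg_left (hu' x y hy) ha
    have h2 := mul_le_mul_of_nonneg_left (hw' x y hy) hb
    have h3 : ∑ j, (a • u + b • w) j * (P.res x j - y j)
        = a * ∑ j, u j * (P.res x j - y j) + b * ∑ j, w j * (P.res x j - y j) := by
      rw [Finset.mul_sum, Finset.mul_sum, ← Finset.sum_add_distrib]
      refine Finset.sum_congr rfl fun j _ => ?_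
      simp only [Pi.add_apply, Pi.smul_apply, smul_eq_mul]
      ring
    rw [h3]
    obtain rfl : b = 1 - a := by linarith
    linarith

lemma Standing.dualSol_nonempty : P.dualSol.Nonempty := by
  obtain ⟨w, hw⟩ := hP.exists_dual hxs
  exact ⟨w, (hP.mem_dualSol_iff hxs).2 hw⟩

end DualSol

/-! ### The weighted norm and the projection -/

lemma Standing.L_nonneg (hP : P.Standing) (j : DualIndex n p m) : 0 ≤ P.L j := by
  have := hP.mu_pos
  rcases j with i | i | i <;> simp only [L] <;> positivity

lemma Standing.normL_sq (hP : P.Standing) (u : DualVec n p m) :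
    P.normL u ^ 2 = ∑ j, P.L j * u j ^ 2 :=
  Real.sq_sqrt (Finset.sum_nonneg fun j _ => mul_nonneg (hP.L_nonneg j) (sq_nonneg _))

lemma normL_nonneg (u : DualVec n p m) : 0 ≤ P.normL u := Real.sqrt_nonneg _

lemma Standing.proj_spec (hP : P.Standing) (hL : ∀ j, 0 < P.L j) (u : DualVec n p m) :
    P.proj u ∈ P.dualSol ∧ ∀ w ∈ P.dualSol, P.normL (u - P.proj u) ≤ P.normL (u - w) := by
  obtain ⟨xs, hxs⟩ := hP.primalSol_nonempty
  obtain ⟨w₀, hw₀⟩ := hP.dualSol_nonempty hxs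
  have hcont : Continuous fun w : DualVec n p m => P.normL (u - w) := by
    simp only [normL, Pi.sub_apply]; fun_prop
  have hbd : Bornology.IsBounded {w : DualVec n p m | P.normL (u - w) ≤ P.normL (u - w₀)} := by
    refine (Bornology.IsBounded.pi fun j =>
      Metric.isBounded_closedBall (x := u j) (r := P.normL (u - w₀) / √(P.L j))).subset ?_
    intro w hw j _
    rw [Metric.mem_closedBall, dist_comm, Real.dist_eq, le_div_iff₀ (Real.sqrt_pos.2 (hL j))]
    refine le_trans ?_ (show P.normL (u - w) ≤ P.normL (u - w₀) from hw)
    refine Real.le_sqrt_of_sq_le ?_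
    rw [mul_pow, sq_abs, Real.sq_sqrt (hL j).le, mul_comm]
    exact Finset.single_le_sum (f := fun j => P.L j * (u - w) j ^ 2)
      (fun j _ => mul_nonneg (hL j).le (sq_nonneg _)) (Finset.mem_univ j)
  have hev : ∀ᶠ w in Filter.cocompact _ ⊓ Filter.principal P.dualSol,
      P.normL (u - w₀) ≤ P.normL (u - w) := by
    refine Filter.Eventually.filter_mono inf_le_left ?_
    have h1 := hbd.isCompact_closure.compl_mem_cocompact
    filter_upwards [h1] with w hw
    by_contra! hlt
    exact hw (subset_closure hlt.le)
  obtain ⟨w, hw, hmin⟩ := hcont.continuousOn.exists_isMinOn' (hP.dualSol_isClosed hxs) hw₀ hev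
  exact Classical.epsilon_spec (p := fun w => w ∈ P.dualSol ∧
    ∀ y ∈ P.dualSol, P.normL (u - w) ≤ P.normL (u - y)) ⟨w, hw, fun y hy => hmin hy⟩

lemma Standing.proj_sq_le (hP : P.Standing) (hL : ∀ j, 0 < P.L j) (u : DualVec n p m)
    {w : DualVec n p m} (hw : w ∈ P.dualSol) :
    P.normL (u - P.proj u) ^ 2 ≤ P.normL (u - w) ^ 2 :=
  pow_le_pow_left₀ (normL_nonneg _) ((hP.proj_spec hL u).2 w hw) 2

/-! ### The coordinate update -/

lemma coe_add_h_le_iff {j : DualIndex n p m} {q s r : ℝ} :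
    (q : EReal) + P.h j s ≤ (r : EReal) ↔
      ∀ v ∈ slackSet j, q + (s * v - P.slackCost j v) ≤ r := by
  constructor
  · intro hle v hv
    have h1 := (add_le_add_right (P.le_h hv s) (q : EReal)).trans hle
    rw [← EReal.coe_add] at h1
    exact_mod_cast h1
  · intro hall
    have h1 := P.h_le (j := j) (s := s) (r := r - q) fun v hv => by linarith [hall v hv]
    refine (add_le_add_right h1 (q : EReal)).trans (le_of_eq ?_)
    rw [← EReal.coe_add, add_sub_cancel]

lemma exists_prox (j : DualIndex n p m) {α : ℝ} (hα : 0 < α) (β z : ℝ)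
    (hz : (P.hDom j).Nonempty) : ∃ s, ∀ s' : ℝ,
      ((α * (s - z) ^ 2 + β * (s - z) : ℝ) : EReal) + P.h j s
        ≤ ((α * (s' - z) ^ 2 + β * (s' - z) : ℝ) : EReal) + P.h j s' := by
  set Ψ : ℝ → EReal := fun s => ((α * (s - z) ^ 2 + β * (s - z) : ℝ) : EReal) + P.h j s with hΨ
  have hlsc : LowerSemicontinuous Ψ := by
    rw [lowerSemicontinuous_iff_isClosed_preimage]
    intro c
    induction c using EReal.rec with
    | bot =>
      have : Ψ ⁻¹' Set.Iic ⊥ = ∅ := by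
        ext s
        simp only [Set.mem_preimage, Set.mem_Iic, le_bot_iff, Set.mem_empty_iff_false, iff_false]
        exact EReal.add_ne_bot_iff.2 ⟨EReal.coe_ne_bot _, P.h_ne_bot _ _⟩
      rw [this]; exact isClosed_empty
    | coe r =>
      have : Ψ ⁻¹' Set.Iic (r : EReal) = ⋂ v ∈ slackSet j,
          {s | α * (s - z) ^ 2 + β * (s - z) + (s * v - P.slackCost j v) ≤ r} := by
        ext s
        simp only [Set.mem_preimage, Set.mem_Iic, hΨ, coe_add_h_le_iff, Set.mem_iInter,
          Set.mem_ofPred_eq]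
      rw [this]
      exact isClosed_biInter fun v _ => isClosed_le (by fun_prop) continuous_const
    | top => simp
  obtain ⟨s₀, hs₀⟩ := hz
  obtain ⟨v, hv⟩ := slackSet_nonempty j
  set c₀ := α * (s₀ - z) ^ 2 + β * (s₀ - z) + P.hReal j s₀
  have hc₀ : Ψ s₀ = (c₀ : EReal) := by
    simp only [hΨ, ← coe_hReal hs₀, ← EReal.coe_add, c₀]
  set R := (|β + v| + |c₀ - (z * v - P.slackCost j v)|) / α + 1 with hR
  have hR1 : 1 ≤ R := by rw [hR]; linarith [show 0 ≤ (|β + v| +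
    |c₀ - (z * v - P.slackCost j v)|) / α by positivity]
  have hout : ∀ s, R < |s - z| → Ψ s₀ ≤ Ψ s := by
    intro s hs
    rw [hc₀]
    refine le_trans ?_ (add_le_add_right (P.le_h hv s) _)
    rw [← EReal.coe_add]
    refine EReal.coe_le_coe_iff.2 ?_
    set x := s - z
    have h1 : s = z + x := by ring
    rw [h1]
    have h2 : |β + v| + |c₀ - (z * v - P.slackCost j v)| ≤ α * |x| := by
      have : (|β + v| + |c₀ - (z * v - P.slackCost j v)|) / α ≤ |x| := by linarith
      rwa [div_le_iff₀' hα] at this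
    have h3 : -(|β + v| * |x|) ≤ (β + v) * x := by
      rw [← abs_mul]; exact neg_abs_le _
    have h4 := le_abs_self (c₀ - (z * v - P.slackCost j v))
    have h5 : 1 ≤ |x| := by linarith
    have h6 := mul_le_mul_of_nonneg_right h2 (abs_nonneg x)
    have h7 : |x| * |x| = x ^ 2 := by rw [← sq, sq_abs]
    have h8 : |c₀ - (z * v - P.slackCost j v)| ≤ |c₀ - (z * v - P.slackCost j v)| * |x| :=
      le_mul_of_one_le_right (abs_nonneg _) h5
    have h9 : α * |x| * |x| = α * x ^ 2 := by rw [mul_assoc, h7]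
    linarith
  obtain ⟨s₁, hs₁, hmin⟩ := LowerSemicontinuousOn.exists_isMinOn (s := Set.Icc (z - R) (z + R))
    (f := Ψ) ⟨z, by constructor <;> linarith⟩ isCompact_Icc (hlsc.lowerSemicontinuousOn _)
  by_cases hcmp : Ψ s₁ ≤ Ψ s₀
  · refine ⟨s₁, fun s' => ?_⟩
    by_cases hs' : |s' - z| ≤ R
    · rw [abs_le] at hs'
      exact hmin (show s' ∈ Set.Icc (z - R) (z + R) by constructor <;> linarith)
    · exact hcmp.trans (hout s' (not_le.1 hs'))
  · refine ⟨s₀, fun s' => ?_⟩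
    by_cases hs' : |s' - z| ≤ R
    · rw [abs_le] at hs'
      exact (not_le.1 hcmp).le.trans
        (hmin (show s' ∈ Set.Icc (z - R) (z + R) by constructor <;> linarith))
    · exact hout s' (not_le.1 hs')

/-- An affine minorant of `h_j` that touches it at `s` has a slope in the slack set, and the slack
cost of the slope is given by equality in the Fenchel–Young inequality. -/
lemma Standing.fenchel_eq (hP : P.Standing) {j : DualIndex n p m} {s y : ℝ} (hs : s ∈ P.hDom j)
    (hy : ∀ s' ∈ P.hDom j, P.hReal j s + y * (s' - s) ≤ P.hReal j s') :
    y ∈ slackSet j ∧ P.hReal j s = s * y - P.slackCost j y := by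
  rcases j with i | i | i
  · refine ⟨Set.mem_univ _, le_antisymm ?_ (le_hReal hs (Set.mem_univ _))⟩
    -- a subgradient of the cost at `y` is a point where the minorant can be evaluated
    have hconv := hP.slackCost_convexOn (Sum.inl i)
    obtain ⟨l, hl⟩ := hconv.exists_affine_minorant hconv.locallyLipschitz.continuous y
    have hl' : ∀ r, l r = l 1 * r := by
      intro r
      have : l r = l (r • 1) := by simp
      rw [this, map_smul, smul_eq_mul, mul_comm]
    obtain ⟨h1, h2⟩ := mem_hDom (P := P) (j := Sum.inl i) (s := l 1)
      (r := l 1 * y - P.slackCost (Sum.inl i) y) (fun v _ => by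
        have := hl v
        rw [hl'] at this
        linarith)
    have h3 := hy _ h1
    linarith
  · have hdom : ∀ s', s' ∈ P.hDom (Sum.inr (Sum.inl i)) := fun s' => by simp [hDom, h]
    have hz : ∀ s', P.hReal (Sum.inr (Sum.inl i)) s' = 0 := fun s' => by simp [hReal, h]
    have h1 := hy (s + y) (hdom _)
    rw [hz, hz] at h1
    have h2 : y = 0 := by nlinarith [sq_nonneg y]
    subst h2
    exact ⟨rfl, by simp [hz, slackCost]⟩
  · have hs0 := nonneg_of_mem_hDom hs
    have hdom : ∀ s', 0 ≤ s' → s' ∈ P.hDom (Sum.inr (Sum.inr i)) := fun s' hs' => by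
      simp [hDom, h, hs']
    have hz : ∀ s', 0 ≤ s' → P.hReal (Sum.inr (Sum.inr i)) s' = 0 := fun s' hs' => by
      simp [hReal, h, hs']
    have h1 := hy (s + 1) (hdom _ (by linarith))
    have h2 := hy 0 (hdom _ le_rfl)
    rw [hz _ hs0, hz _ (by linarith)] at h1
    rw [hz _ hs0, hz _ le_rfl] at h2
    have hy0 : y ≤ 0 := by linarith
    refine ⟨hy0, ?_⟩
    rw [hz _ hs0]
    simp only [slackCost]
    nlinarith [mul_nonneg hs0 (neg_nonneg.2 hy0)]

/-- Optimality of a proximal step: the slack variable `-β - 2 α (s - z)` is optimal for the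
conjugate at the new point. -/
lemma Standing.prox_optimality (hP : P.Standing) {j : DualIndex n p m} {α : ℝ} {β z s : ℝ}
    (hz : (P.hDom j).Nonempty)
    (hs : ∀ s' : ℝ, ((α * (s - z) ^ 2 + β * (s - z) : ℝ) : EReal) + P.h j s
      ≤ ((α * (s' - z) ^ 2 + β * (s' - z) : ℝ) : EReal) + P.h j s') :
    s ∈ P.hDom j ∧ -β - 2 * α * (s - z) ∈ slackSet j ∧
      P.hReal j s = s * (-β - 2 * α * (s - z)) - P.slackCost j (-β - 2 * α * (s - z)) := by
  have hdom : s ∈ P.hDom j := by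
    obtain ⟨s₀, hs₀⟩ := hz
    intro htop
    have h1 := hs s₀
    rw [htop, EReal.coe_add_top, top_le_iff, ← coe_hReal hs₀, ← EReal.coe_add] at h1
    exact EReal.coe_ne_top _ h1
  refine ⟨hdom, hP.fenchel_eq hdom fun s' hs' => ?_⟩
  have hreal : ∀ r ∈ P.hDom j, α * (s - z) ^ 2 + β * (s - z) + P.hReal j s
      ≤ α * (r - z) ^ 2 + β * (r - z) + P.hReal j r := by
    intro r hr
    have h1 := hs r
    rw [← coe_hReal hdom, ← coe_hReal hr, ← EReal.coe_add, ← EReal.coe_add] at h1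
    exact_mod_cast h1
  have key : ∀ τ ∈ Set.Ioo (0 : ℝ) 1, P.hReal j s + (-β - 2 * α * (s - z)) * (s' - s)
      - τ * (α * (s' - s) ^ 2) ≤ P.hReal j s' := by
    intro τ hτ
    have hc := P.hReal_convexOn j
    have hcomb := hc.1 hdom hs' (show (0 : ℝ) ≤ 1 - τ by linarith [hτ.2]) hτ.1.le (by ring)
    have h1 := hc.2 hdom hs' (show (0 : ℝ) ≤ 1 - τ by linarith [hτ.2]) hτ.1.le (by ring)
    have h2 := hreal _ hcomb
    simp only [smul_eq_mul] at h1 h2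
    have h3 : τ * (P.hReal j s + (-β - 2 * α * (s - z)) * (s' - s) - τ * (α * (s' - s) ^ 2))
        ≤ τ * P.hReal j s' := by
      have e : (1 - τ) * s + τ * s' - z = (s - z) + τ * (s' - s) := by ring
      rw [e] at h2
      linarith
    exact le_of_mul_le_mul_left h3 hτ.1
  have hlim : Filter.Tendsto (fun τ : ℝ => P.hReal j s + (-β - 2 * α * (s - z)) * (s' - s)
      - τ * (α * (s' - s) ^ 2)) (nhdsWithin 0 (Set.Ioi 0))
      (nhds (P.hReal j s + (-β - 2 * α * (s - z)) * (s' - s) - 0 * (α * (s' - s) ^ 2))) :=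
    (Continuous.tendsto (by fun_prop) _).mono_left nhdsWithin_le_nhds
  rw [zero_mul, sub_zero] at hlim
  refine le_of_tendsto hlim ?_
  filter_upwards [Ioo_mem_nhdsGT (show (0 : ℝ) < 1 by norm_num)] with τ hτ using key τ hτ

end ConvexProblem

namespace ConvexProblem

variable {t n p m : ℕ} (P : ConvexProblem t n p m)

/-! ### The iterates of one run -/

/-- The squared weighted norm. -/
def sqL (u : DualVec n p m) : ℝ := ∑ j, P.L j * u j ^ 2

/-- The squared weighted distance to the dual solution set. -/
def distSq (u : DualVec n p m) : ℝ := P.normL (u - P.proj u) ^ 2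

/-- The iterate `z^k` when coordinate `i k` is selected at iteration `k`. -/
def zIter (u0 : DualVec n p m) (i : ℕ → DualIndex n p m) (k : ℕ) : DualVec n p m :=
  (P.ardcaState u0 i k).1

/-- The point `v^k` at which the gradient is evaluated. -/
def vIter (u0 : DualVec n p m) (i : ℕ → DualIndex n p m) (k : ℕ) : DualVec n p m :=
  vOf k (P.ardcaState u0 i k)

/-- The dual iterate `u^k`, as an average of `z^0, …, z^k`. -/
def uIter (u0 : DualVec n p m) (i : ℕ → DualIndex n p m) (k : ℕ) : DualVec n p m :=
  runAvg (n + p + m) (P.zIter u0 i) k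

/-- The vector of the coordinate updates at iteration `k`, for all coordinates at once. -/
def fullStep (u0 : DualVec n p m) (i : ℕ → DualIndex n p m) (k : ℕ) : DualVec n p m :=
  fun j => P.coordStep k (P.zIter u0 i k) (P.vIter u0 i k) j

/-- The slack variables that certify the optimality of the coordinate updates. -/
def slackIter (u0 : DualVec n p m) (i : ℕ → DualIndex n p m) (k : ℕ) : DualVec n p m :=
  fun j => P.res (P.xOf (P.vIter u0 i k)) j
    - 2 * (((n + p + m : ℕ) : ℝ) * theta (n + p + m) k * P.L j)
      * (P.fullStep u0 i k j - P.zIter u0 i k j)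

/-- The separable part of the dual objective, averaged along the run. -/
def hIter (u0 : DualVec n p m) (i : ℕ → DualIndex n p m) (k : ℕ) : ℝ :=
  runAvg (n + p + m) (fun s => ∑ j, P.hReal j (P.zIter u0 i s j)) k

/-- An upper bound of `D (u^k)` that satisfies a one-step recursion. -/
def dualBound (u0 : DualVec n p m) (i : ℕ → DualIndex n p m) (k : ℕ) : ℝ :=
  P.d (P.uIter u0 i k) + P.hIter u0 i k

/-- The Lagrangian of the slack form at the iterate `x*(v^k)` and its slack variables. -/
def lagIter (u0 : DualVec n p m) (i : ℕ → DualIndex n p m) (k : ℕ) (w : DualVec n p m) : ℝ :=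
  P.f (P.xOf (P.vIter u0 i k)) + ∑ j, P.slackCost j (P.slackIter u0 i k j)
    + ∑ j, w j * (P.res (P.xOf (P.vIter u0 i k)) j - P.slackIter u0 i k j)

variable {P}

lemma Standing.normL_sq_eq (hP : P.Standing) (u : DualVec n p m) : P.normL u ^ 2 = P.sqL u :=
  hP.normL_sq u

lemma Standing.sqL_nonneg (hP : P.Standing) (u : DualVec n p m) : 0 ≤ P.sqL u :=
  Finset.sum_nonneg fun j _ => mul_nonneg (hP.L_nonneg j) (sq_nonneg _)

lemma distSq_nonneg (u : DualVec n p m) : 0 ≤ P.distSq u := sq_nonneg _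

lemma Standing.distSq_le (hP : P.Standing) (hL : ∀ j, 0 < P.L j) (u : DualVec n p m)
    {w : DualVec n p m} (hw : w ∈ P.dualSol) : P.distSq u ≤ P.sqL (u - w) := by
  rw [← hP.normL_sq_eq]
  exact hP.proj_sq_le hL u hw

/-- Replacing one coordinate changes the squared norm in that coordinate only. -/
lemma sqL_add_single (u : DualVec n p m) (j : DualIndex n p m) (δ : ℝ) :
    P.sqL (u + Pi.single j δ) = P.sqL u + P.L j * ((u j + δ) ^ 2 - u j ^ 2) := by
  classical
  simp only [sqL]
  rw [← Finset.add_sum_erase _ _ (Finset.mem_univ j),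
    ← Finset.add_sum_erase _ (fun j => P.L j * u j ^ 2) (Finset.mem_univ j)]
  have : ∑ x ∈ Finset.univ.erase j, P.L x * (u + Pi.single j δ : DualVec n p m) x ^ 2
      = ∑ x ∈ Finset.univ.erase j, P.L x * u x ^ 2 := by
    refine Finset.sum_congr rfl fun x hx => ?_
    rw [Pi.add_apply, Pi.single_eq_of_ne (Finset.ne_of_mem_erase hx), add_zero]
  rw [this, Pi.add_apply, Pi.single_eq_same]
  ring

section Run

variable {u0 : DualVec n p m} {i : ℕ → DualIndex n p m}

lemma zIter_succ (k : ℕ) : P.zIter u0 i (k + 1)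
    = Function.update (P.zIter u0 i k) (i k) (P.fullStep u0 i k (i k)) := rfl

lemma ardcaState_congr {i' : ℕ → DualIndex n p m} {k : ℕ} (h : ∀ s < k, i s = i' s) :
    P.ardcaState u0 i k = P.ardcaState u0 i' k := by
  induction k with
  | zero => rfl
  | succ k ih =>
    have h1 := ih fun s hs => h s (by omega)
    simp only [ardcaState, h1, h k (by omega)]

lemma zIter_congr {i' : ℕ → DualIndex n p m} {k : ℕ} (h : ∀ s < k, i s = i' s) :
    P.zIter u0 i k = P.zIter u0 i' k := by
  rw [zIter, ardcaState_congr h]; rfl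

lemma vIter_congr {i' : ℕ → DualIndex n p m} {k : ℕ} (h : ∀ s < k, i s = i' s) :
    P.vIter u0 i k = P.vIter u0 i' k := by
  rw [vIter, ardcaState_congr h]; rfl

lemma fullStep_congr {i' : ℕ → DualIndex n p m} {k : ℕ} (h : ∀ s < k, i s = i' s) :
    P.fullStep u0 i k = P.fullStep u0 i' k := by
  funext j
  simp only [fullStep, zIter_congr h, vIter_congr h]

lemma runAvg_congr {E : Type*} [AddCommGroup E] [Module ℝ E] {nh : ℕ} {a b : ℕ → E} {k : ℕ}
    (h : ∀ s ≤ k, a s = b s) : runAvg nh a k = runAvg nh b k := by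
  induction k with
  | zero => exact h 0 le_rfl
  | succ k ih =>
    simp only [runAvg, ih fun s hs => h s (by omega), h k (by omega), h (k + 1) le_rfl]

lemma uIter_congr {i' : ℕ → DualIndex n p m} {k : ℕ} (h : ∀ s < k, i s = i' s) :
    P.uIter u0 i k = P.uIter u0 i' k :=
  runAvg_congr fun s hs => zIter_congr fun r hr => h r (by omega)

lemma hIter_congr {i' : ℕ → DualIndex n p m} {k : ℕ} (h : ∀ s < k, i s = i' s) :
    P.hIter u0 i k = P.hIter u0 i' k :=
  runAvg_congr fun s hs => by rw [zIter_congr fun r hr => h r (by omega)]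

lemma dualBound_congr {i' : ℕ → DualIndex n p m} {k : ℕ} (h : ∀ s < k, i s = i' s) :
    P.dualBound u0 i k = P.dualBound u0 i' k := by
  rw [dualBound, uIter_congr h, hIter_congr h]; rfl

lemma update_agree (k : ℕ) (j : DualIndex n p m) : ∀ s < k, Function.update i k j s = i s :=
  fun _ hs => Function.update_of_ne (by omega) _ _

lemma zIter_update_succ (k : ℕ) (j : DualIndex n p m) :
    P.zIter u0 (Function.update i k j) (k + 1)
      = P.zIter u0 i k + Pi.single j (P.fullStep u0 i k j - P.zIter u0 i k j) := by
  rw [zIter_succ, Function.update_self, zIter_congr (update_agree k j),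
    fullStep_congr (update_agree k j)]
  funext j'
  by_cases hj : j' = j
  · subst hj; simp
  · simp [hj]

lemma ardcaState_succ_snd (k : ℕ) : theta (n + p + m) k ^ 2 • (P.ardcaState u0 i (k + 1)).2
    = theta (n + p + m) k ^ 2 • (P.ardcaState u0 i k).2
      - (1 - ((n + p + m : ℕ) : ℝ) * theta (n + p + m) k) •
        (P.zIter u0 i (k + 1) - P.zIter u0 i k) := by
  have hpos : 0 < n + p + m := by
    have := Fintype.card_pos_iff.2 ⟨i 0⟩
    simpa [add_assoc] using this
  have hθ := theta_pos hpos k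
  funext j
  rw [zIter_succ]
  by_cases hj : j = i k
  · subst hj
    simp only [ardcaState, Pi.smul_apply, Pi.sub_apply, Function.update_self, smul_eq_mul, zIter,
      fullStep, vIter]
    field_simp
  · simp [ardcaState, hj, zIter]

lemma vIter_eq (k : ℕ) : P.vIter u0 i k
    = (1 - theta (n + p + m) k) • P.uIter u0 i k + theta (n + p + m) k • P.zIter u0 i k := by
  induction k with
  | zero =>
    simp only [vIter, vOf, ardcaState, smul_zero, zero_add, uIter, runAvg, zIter]
    module
  | succ k ih =>
    have h1 := ardcaState_succ_snd (P := P) (u0 := u0) (i := i) k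
    have h2 : P.uIter u0 i (k + 1) - P.zIter u0 i (k + 1)
        = theta (n + p + m) k ^ 2 • (P.ardcaState u0 i (k + 1)).2 := by
      have h3 : P.uIter u0 i (k + 1) = P.vIter u0 i k
          + (((n + p + m : ℕ) : ℝ) * theta (n + p + m) k)
            • (P.zIter u0 i (k + 1) - P.zIter u0 i k) := by
        rw [ih]; rfl
      rw [h1, h3, vIter, vOf]
      change _ + P.zIter u0 i k + _ - _ = _
      module
    have h4 : P.vIter u0 i (k + 1) = theta (n + p + m) (k + 1) ^ 2 • (P.ardcaState u0 i (k + 1)).2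
      + P.zIter u0 i (k + 1) := rfl
    rw [h4, theta_succ_sq, mul_smul, ← h2]
    module

lemma uIter_succ (k : ℕ) : P.uIter u0 i (k + 1) = P.vIter u0 i k
    + (((n + p + m : ℕ) : ℝ) * theta (n + p + m) k)
      • (P.zIter u0 i (k + 1) - P.zIter u0 i k) := by
  rw [vIter_eq]; rfl

lemma ardcaDual_eq (K : ℕ) : P.ardcaDual u0 K i = P.uIter u0 i (K + 1) := by
  rw [uIter_succ, ardcaDual, vOf, ardcaState_succ_snd, vIter, vOf]
  change _ + P.zIter u0 i (K + 1) = _ + P.zIter u0 i K + _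
  module

lemma uIter_update_succ (k : ℕ) (j : DualIndex n p m) :
    P.uIter u0 (Function.update i k j) (k + 1) = P.vIter u0 i k
      + Pi.single j (((n + p + m : ℕ) : ℝ) * theta (n + p + m) k
        * (P.fullStep u0 i k j - P.zIter u0 i k j)) := by
  rw [uIter_succ, vIter_congr (update_agree k j), zIter_update_succ,
    zIter_congr (update_agree k j), add_sub_cancel_left, ← Pi.single_smul', smul_eq_mul]

end Run

/-! ### Feasibility of the iterates -/

section Feasible

variable (hP : P.Standing) (hL : ∀ j, 0 < P.L j) {u0 : DualVec n p m}
  (hu0 : ∀ j, u0 j ∈ P.hDom j) (i : ℕ → DualIndex n p m)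

lemma card_dualIndex : Fintype.card (DualIndex n p m) = n + p + m := by
  simp [add_assoc]

include i in
lemma dim_pos : 0 < n + p + m := by
  rw [← card_dualIndex]
  exact Fintype.card_pos_iff.2 ⟨i 0⟩

/-- The product of the domains of the `h_j`. -/
def domSet (P : ConvexProblem t n p m) : Set (DualVec n p m) := {u | ∀ j, u j ∈ P.hDom j}

lemma domSet_convex : Convex ℝ P.domSet := fun _ hu _ hw _ _ ha hb hab j =>
  (P.hReal_convexOn j).1 (hu j) (hw j) ha hb hab

lemma sum_hReal_convexOn : ConvexOn ℝ P.domSet fun u => ∑ j, P.hReal j (u j) := by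
  refine ⟨domSet_convex, fun u hu w hw a b ha hb hab => ?_⟩
  simp only [smul_eq_mul, Finset.mul_sum, ← Finset.sum_add_distrib]
  exact Finset.sum_le_sum fun j _ => (P.hReal_convexOn j).2 (hu j) (hw j) ha hb hab

include hP hL in
lemma Standing.coordStep_spec (k : ℕ) {z : DualVec n p m} (hz : z ∈ P.domSet)
    (v : DualVec n p m) (j : DualIndex n p m) :
    P.coordStep k z v j ∈ P.hDom j ∧
      (P.res (P.xOf v) j - 2 * (((n + p + m : ℕ) : ℝ) * theta (n + p + m) k * P.L j)
        * (P.coordStep k z v j - z j)) ∈ slackSet j ∧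
      P.hReal j (P.coordStep k z v j) = P.coordStep k z v j *
          (P.res (P.xOf v) j - 2 * (((n + p + m : ℕ) : ℝ) * theta (n + p + m) k * P.L j)
            * (P.coordStep k z v j - z j))
        - P.slackCost j
          (P.res (P.xOf v) j - 2 * (((n + p + m : ℕ) : ℝ) * theta (n + p + m) k * P.L j)
            * (P.coordStep k z v j - z j)) := by
  have hpos : 0 < n + p + m := dim_pos fun _ => j
  have hα : 0 < ((n + p + m : ℕ) : ℝ) * theta (n + p + m) k * P.L j := by
    have h1 : (0 : ℝ) < ((n + p + m : ℕ) : ℝ) := by exact_mod_cast hpos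
    have h2 := theta_pos hpos k
    have h3 := hL j
    positivity
  obtain ⟨s, hs⟩ := exists_prox (P := P) j hα (P.gradd v j) (z j) ⟨_, hz j⟩
  have hmin := (Classical.epsilon_spec (p := fun s => s ∈ (Set.univ : Set ℝ) ∧
    ∀ s' ∈ (Set.univ : Set ℝ),
      ((((n + p + m : ℕ) : ℝ) * theta (n + p + m) k * P.L j * (s - z j) ^ 2
        + P.gradd v j * (s - z j) : ℝ) : EReal) + P.h j s
      ≤ ((((n + p + m : ℕ) : ℝ) * theta (n + p + m) k * P.L j * (s' - z j) ^ 2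
        + P.gradd v j * (s' - z j) : ℝ) : EReal) + P.h j s')
    ⟨s, Set.mem_univ _, fun s' _ => hs s'⟩).2
  have h1 := hP.prox_optimality (s := P.coordStep k z v j) ⟨_, hz j⟩
    fun s' => hmin s' (Set.mem_univ _)
  rwa [gradd_eq, neg_neg] at h1

include hP hL hu0

lemma Standing.zIter_mem (k : ℕ) : P.zIter u0 i k ∈ P.domSet := by
  induction k with
  | zero => exact hu0
  | succ k ih =>
    intro j
    rw [zIter_succ]
    by_cases hj : j = i k
    · subst hj
      rw [Function.update_self]
      exact (hP.coordStep_spec hL k ih _ _).1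
    · rw [Function.update_of_ne hj]
      exact ih j

lemma Standing.uIter_mem (k : ℕ) : P.uIter u0 i k ∈ P.domSet :=
  domSet_convex.runAvg_mem (dim_pos i) fun s _ => hP.zIter_mem hL hu0 i s

lemma Standing.vIter_mem (k : ℕ) : P.vIter u0 i k ∈ P.domSet := by
  rw [vIter_eq]
  exact domSet_convex (hP.uIter_mem hL hu0 i k) (hP.zIter_mem hL hu0 i k)
    (sub_nonneg.2 (theta_le_one (dim_pos i) k)) (theta_pos (dim_pos i) k).le (by ring)

lemma Standing.slackIter_mem (k : ℕ) (j : DualIndex n p m) :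
    P.slackIter u0 i k j ∈ slackSet j :=
  (hP.coordStep_spec hL k (hP.zIter_mem hL hu0 i k) (P.vIter u0 i k) j).2.1

lemma Standing.hReal_fullStep (k : ℕ) (j : DualIndex n p m) :
    P.hReal j (P.fullStep u0 i k j) = P.fullStep u0 i k j * P.slackIter u0 i k j
      - P.slackCost j (P.slackIter u0 i k j) :=
  (hP.coordStep_spec hL k (hP.zIter_mem hL hu0 i k) (P.vIter u0 i k) j).2.2

lemma Standing.sum_hReal_le_hIter (k : ℕ) :
    ∑ j, P.hReal j (P.uIter u0 i k j) ≤ P.hIter u0 i k :=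
  sum_hReal_convexOn.map_runAvg_le (dim_pos i) fun s _ => hP.zIter_mem hL hu0 i s

/-! ### One iteration -/

/-- The expected decrease of `dualBound` in one iteration, compared with an arbitrary point `w`. -/
lemma Standing.dualBound_step (k : ℕ) (w : DualVec n p m) :
    (∑ j, P.dualBound u0 (Function.update i k j) (k + 1)) / ((n + p + m : ℕ) : ℝ)
      ≤ (1 - theta (n + p + m) k) * P.dualBound u0 i k
        - theta (n + p + m) k * P.lagIter u0 i k w
        + ((n + p + m : ℕ) : ℝ) * theta (n + p + m) k ^ 2 *
          (P.sqL (P.zIter u0 i k - w) - P.sqL (P.fullStep u0 i k - w)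
            - P.sqL (P.fullStep u0 i k - P.zIter u0 i k) / 2) := by
  have hpos := dim_pos i
  have hnpos : (0 : ℝ) < ((n + p + m : ℕ) : ℝ) := by exact_mod_cast hpos
  obtain ⟨N, hN⟩ : ∃ N : ℝ, N = ((n + p + m : ℕ) : ℝ) := ⟨_, rfl⟩
  obtain ⟨θ, hθ⟩ : ∃ θ, θ = theta (n + p + m) k := ⟨_, rfl⟩
  have hθ0 : 0 < θ := hθ ▸ theta_pos hpos k
  have hθ1 : θ ≤ 1 := hθ ▸ theta_le_one hpos k
  set z := P.zIter u0 i k with hz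
  set zf := P.fullStep u0 i k with hzf
  set v := P.vIter u0 i k with hv
  set uk := P.uIter u0 i k with huk
  set x := P.xOf v with hx
  set y := P.slackIter u0 i k with hy
  have hvf := mem_dualFeasible (hP.vIter_mem hL hu0 i k)
  have huf := mem_dualFeasible (hP.uIter_mem hL hu0 i k)
  -- the smooth part
  have hd : ∀ j, P.d (P.uIter u0 (Function.update i k j) (k + 1))
      ≤ P.d v - P.res x j * (N * θ * (zf j - z j)) + P.L j / 2 * (N * θ * (zf j - z j)) ^ 2 := by
    intro j
    have h1 := mem_dualFeasible (hP.uIter_mem hL hu0 (Function.update i k j) (k + 1))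
    rw [uIter_update_succ, ← hN, ← hθ] at h1 ⊢
    refine (hP.d_update_le hvf h1).trans (le_of_eq ?_)
    rw [gradd_eq]
    ring
  -- the separable part
  have hh : ∀ j, P.hIter u0 (Function.update i k j) (k + 1)
      = (1 - θ) * P.hIter u0 i k + θ * ∑ j, P.hReal j (z j)
        + N * θ * (P.hReal j (zf j) - P.hReal j (z j)) := by
    intro j
    have h1 : P.hIter u0 (Function.update i k j) (k + 1)
        = (1 - θ) * P.hIter u0 (Function.update i k j) k
          + θ * ∑ j', P.hReal j' (P.zIter u0 (Function.update i k j) k j')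
          + N * θ * (∑ j', P.hReal j' (P.zIter u0 (Function.update i k j) (k + 1) j')
            - ∑ j', P.hReal j' (P.zIter u0 (Function.update i k j) k j')) := by
      rw [hN, hθ]; rfl
    have h2 : ∑ j', (P.hReal j' (P.zIter u0 (Function.update i k j) (k + 1) j')
        - P.hReal j' (z j')) = P.hReal j (zf j) - P.hReal j (z j) := by
      rw [zIter_update_succ]
      refine (Finset.sum_eq_single j (fun j' _ hj' => ?_) (by simp)).trans ?_
      · rw [Pi.add_apply, Pi.single_eq_of_ne hj', add_zero, sub_self]
      · rw [Pi.add_apply, Pi.single_eq_same, add_sub_cancel]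
    rw [h1, hIter_congr (update_agree k j), zIter_congr (update_agree k j),
      ← Finset.sum_sub_distrib, h2]
  have hcard : ∀ c : ℝ, ∑ _j : DualIndex n p m, c = N * c := by
    intro c
    rw [Finset.sum_const, Finset.card_univ, card_dualIndex, hN, nsmul_eq_mul]
  have hsum : ∑ j, P.dualBound u0 (Function.update i k j) (k + 1)
      ≤ N * (P.d v + (1 - θ) * P.hIter u0 i k + θ * ∑ j, P.hReal j (z j))
        + N * ∑ j, (θ * (P.hReal j (zf j) - P.hReal j (z j)) - θ * P.res x j * (zf j - z j)
          + N * θ ^ 2 / 2 * (P.L j * (zf j - z j) ^ 2)) := by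
    rw [← hcard, Finset.mul_sum Finset.univ _ N, ← Finset.sum_add_distrib]
    refine Finset.sum_le_sum fun j _ => ?_
    rw [dualBound, hh j]
    have := hd j
    linarith
  rw [div_le_iff₀ hnpos, ← hN, ← hθ]
  refine hsum.trans ?_
  rw [← mul_add, mul_comm _ N]
  refine mul_le_mul_of_nonneg_left ?_ (hN ▸ hnpos.le)
  -- the affine minorant of `d` at `v`
  have hdv : P.d v = -(P.f x) - ∑ j, v j * P.res x j := by
    rw [d, Lf_eq]; ring
  have hduk : -(P.f x) - ∑ j, uk j * P.res x j ≤ P.d uk := by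
    have := hP.neg_Lf_le_d huf x
    rw [Lf_eq] at this
    linarith
  have hvj : ∀ j, v j = (1 - θ) * uk j + θ * z j := by
    intro j
    rw [hv, vIter_eq, ← hθ]
    rfl
  have hfen := hP.hReal_fullStep hL hu0 i k
  have hyj : ∀ j, y j = P.res x j - 2 * (N * θ * P.L j) * (zf j - z j) := by
    intro j
    rw [hN, hθ]; rfl
  have hid : P.d v + ∑ j, (θ * P.hReal j (zf j) - θ * P.res x j * (zf j - z j)
      + N * θ ^ 2 / 2 * (P.L j * (zf j - z j) ^ 2))
      = (1 - θ) * (-(P.f x) - ∑ j, uk j * P.res x j) - θ * P.lagIter u0 i k w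
        + N * θ ^ 2 * (P.sqL (z - w) - P.sqL (zf - w) - P.sqL (zf - z) / 2) := by
    rw [hdv]
    simp only [lagIter, sqL]
    simp only [← hx, ← hy, ← hv]
    have h1 : (1 - θ) * (-(P.f x) - ∑ j, uk j * P.res x j)
        - θ * (P.f x + ∑ j, P.slackCost j (y j) + ∑ j, w j * (P.res x j - y j))
        + N * θ ^ 2 * (∑ j, P.L j * (z - w) j ^ 2 - ∑ j, P.L j * (zf - w) j ^ 2
          - (∑ j, P.L j * (zf - z) j ^ 2) / 2)
        = -(P.f x) + ∑ j, (-((1 - θ) * (uk j * P.res x j)) - θ * P.slackCost j (y j)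
            - θ * (w j * (P.res x j - y j))
            + N * θ ^ 2 * (P.L j * (z - w) j ^ 2 - P.L j * (zf - w) j ^ 2
              - P.L j * (zf - z) j ^ 2 / 2)) := by
      simp only [Finset.sum_add_distrib, Finset.sum_sub_distrib, Finset.sum_neg_distrib,
        ← Finset.mul_sum, ← Finset.sum_div]
      ring
    rw [h1, sub_eq_add_neg, add_assoc, ← Finset.sum_neg_distrib, ← Finset.sum_add_distrib]
    congr 1
    refine Finset.sum_congr rfl fun j _ => ?_
    rw [hfen j, hvj j]
    have h2 : P.res x j = y j + 2 * (N * θ * P.L j) * (zf j - z j) := by rw [hyj]; ring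
    simp only [Pi.sub_apply]
    change _ + (θ * (zf j * y j - P.slackCost j (y j)) - _ + _) = _
    rw [h2]
    ring
  have hsplit : ∑ j, (θ * (P.hReal j (zf j) - P.hReal j (z j)) - θ * P.res x j * (zf j - z j)
          + N * θ ^ 2 / 2 * (P.L j * (zf j - z j) ^ 2))
      = ∑ j, (θ * P.hReal j (zf j) - θ * P.res x j * (zf j - z j)
          + N * θ ^ 2 / 2 * (P.L j * (zf j - z j) ^ 2)) - θ * ∑ j, P.hReal j (z j) := by
    rw [Finset.mul_sum, ← Finset.sum_sub_distrib]
    exact Finset.sum_congr rfl fun j _ => by ring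
  have hmul := mul_le_mul_of_nonneg_left hduk (sub_nonneg.2 hθ1)
  rw [hsplit, dualBound]
  linarith

omit hP hL hu0 in
/-- The expected squared distance of `z^{k+1}` to a fixed point. -/
lemma sqL_zIter_step (k : ℕ) (w : DualVec n p m) :
    (∑ j, P.sqL (P.zIter u0 (Function.update i k j) (k + 1) - w)) / ((n + p + m : ℕ) : ℝ)
      = (1 - 1 / ((n + p + m : ℕ) : ℝ)) * P.sqL (P.zIter u0 i k - w)
        + P.sqL (P.fullStep u0 i k - w) / ((n + p + m : ℕ) : ℝ) := by
  have hnpos : (0 : ℝ) < ((n + p + m : ℕ) : ℝ) := by exact_mod_cast dim_pos i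
  have h1 : ∀ j, P.sqL (P.zIter u0 (Function.update i k j) (k + 1) - w)
      = P.sqL (P.zIter u0 i k - w) + (P.L j * (P.fullStep u0 i k - w) j ^ 2
        - P.L j * (P.zIter u0 i k - w) j ^ 2) := by
    intro j
    rw [zIter_update_succ, add_sub_right_comm, sqL_add_single]
    simp only [Pi.sub_apply]
    ring
  simp only [h1, Finset.sum_add_distrib, Finset.sum_sub_distrib, Finset.sum_const,
    Finset.card_univ, card_dualIndex, nsmul_eq_mul]
  rw [← sqL, ← sqL]
  field_simp
  ring

omit hu0 in
/-- The expected squared distance of `u^{k+1}` to the dual solution set. The last term is the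
variance of the random coordinate step. -/
lemma Standing.distSq_step (k : ℕ) {w : DualVec n p m} (hw : w ∈ P.dualSol) :
    (∑ j, P.distSq (P.uIter u0 (Function.update i k j) (k + 1))) / ((n + p + m : ℕ) : ℝ)
      ≤ (1 - theta (n + p + m) k) * P.distSq (P.uIter u0 i k)
        + theta (n + p + m) k * P.sqL (P.fullStep u0 i k - w)
        + (((n + p + m : ℕ) : ℝ) - 1) * theta (n + p + m) k ^ 2
          * P.sqL (P.fullStep u0 i k - P.zIter u0 i k) := by
  obtain ⟨xs, hxs⟩ := hP.primalSol_nonempty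
  have hpos := dim_pos i
  have hnpos : (0 : ℝ) < ((n + p + m : ℕ) : ℝ) := by exact_mod_cast hpos
  obtain ⟨N, hN⟩ : ∃ N : ℝ, N = ((n + p + m : ℕ) : ℝ) := ⟨_, rfl⟩
  obtain ⟨θ, hθ⟩ : ∃ θ, θ = theta (n + p + m) k := ⟨_, rfl⟩
  have hθ0 : 0 < θ := hθ ▸ theta_pos hpos k
  have hθ1 : θ ≤ 1 := hθ ▸ theta_le_one hpos k
  set z := P.zIter u0 i k with hz
  set zf := P.fullStep u0 i k with hzf
  set v := P.vIter u0 i k with hv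
  set uk := P.uIter u0 i k with huk
  set q := P.proj uk with hq
  have hvj : ∀ j, v j = (1 - θ) * uk j + θ * z j := by
    intro j
    rw [hv, vIter_eq, ← hθ]
    rfl
  set w' : DualVec n p m := (1 - θ) • q + θ • w with hw'
  have hw'mem : w' ∈ P.dualSol := hP.dualSol_convex hxs (hP.proj_spec hL uk).1 hw
    (sub_nonneg.2 hθ1) hθ0.le (by ring)
  have h1 : ∀ j, P.distSq (P.uIter u0 (Function.update i k j) (k + 1))
      ≤ P.sqL (v - w') + P.L j * (2 * (v j - w' j) * (N * θ * (zf j - z j))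
        + (N * θ * (zf j - z j)) ^ 2) := by
    intro j
    refine (hP.distSq_le hL _ hw'mem).trans (le_of_eq ?_)
    rw [uIter_update_succ, ← hN, ← hθ, add_sub_right_comm, sqL_add_single]
    simp only [Pi.sub_apply]
    ring
  have h2 : ∑ j, P.distSq (P.uIter u0 (Function.update i k j) (k + 1))
      ≤ N * (P.sqL (v - w') + ∑ j, P.L j * (2 * (v j - w' j) * (θ * (zf j - z j))
        + N * θ ^ 2 * (zf j - z j) ^ 2)) := by
    refine (Finset.sum_le_sum fun j _ => h1 j).trans (le_of_eq ?_)
    rw [Finset.sum_add_distrib, Finset.sum_const, Finset.card_univ, card_dualIndex, nsmul_eq_mul,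
      ← hN, mul_add, Finset.mul_sum]
    congr 1
    exact Finset.sum_congr rfl fun j _ => by ring
  rw [div_le_iff₀ hnpos, ← hN, ← hθ]
  refine h2.trans ?_
  rw [mul_comm _ N]
  refine mul_le_mul_of_nonneg_left ?_ (hN ▸ hnpos.le)
  rw [distSq, hP.normL_sq_eq]
  simp only [sqL, Finset.mul_sum, ← Finset.sum_add_distrib]
  refine Finset.sum_le_sum fun j _ => ?_
  have hw'j : w' j = (1 - θ) * q j + θ * w j := rfl
  simp only [Pi.sub_apply]
  -- convexity of the square at `v + θ (zf - z) - w' = (1 - θ) (uk - q) + θ (zf - w)`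
  have h3 : (v j - w' j) ^ 2
      + (2 * (v j - w' j) * (θ * (zf j - z j)) + N * θ ^ 2 * (zf j - z j) ^ 2)
      ≤ (1 - θ) * (uk j - q j) ^ 2 + θ * (zf j - w j) ^ 2
        + (N - 1) * θ ^ 2 * (zf j - z j) ^ 2 := by
    have h4 := mul_nonneg (mul_nonneg hθ0.le (sub_nonneg.2 hθ1))
      (sq_nonneg ((uk j - q j) - (zf j - w j)))
    rw [hvj, hw'j]
    linarith
  have h5 := mul_le_mul_of_nonneg_left h3 (hL j).le
  linarith

end Feasible

end ConvexProblem

/-! ### Expectations over the selected coordinates -/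

section UniformExp

variable {Ω : Type*} [Fintype Ω]

lemma uniformExp_add (X Y : Ω → ℝ) :
    uniformExp (fun ω => X ω + Y ω) = uniformExp X + uniformExp Y := by
  simp only [uniformExp, Finset.sum_add_distrib, add_div]

lemma uniformExp_sub (X Y : Ω → ℝ) :
    uniformExp (fun ω => X ω - Y ω) = uniformExp X - uniformExp Y := by
  simp only [uniformExp, Finset.sum_sub_distrib, sub_div]

lemma uniformExp_const_mul (c : ℝ) (X : Ω → ℝ) :
    uniformExp (fun ω => c * X ω) = c * uniformExp X := by
  simp only [uniformExp, ← Finset.mul_sum, mul_div_assoc]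

lemma uniformExp_div_const (X : Ω → ℝ) (c : ℝ) :
    uniformExp (fun ω => X ω / c) = uniformExp X / c := by
  simp only [uniformExp, ← Finset.sum_div, div_right_comm]

lemma uniformExp_sum {ι : Type*} (S : Finset ι) (X : ι → Ω → ℝ) :
    uniformExp (fun ω => ∑ i ∈ S, X i ω) = ∑ i ∈ S, uniformExp (X i) := by
  simp only [uniformExp, Finset.sum_div]
  exact Finset.sum_comm

lemma uniformExp_mono {X Y : Ω → ℝ} (h : ∀ ω, X ω ≤ Y ω) : uniformExp X ≤ uniformExp Y :=
  div_le_div_of_nonneg_right (Finset.sum_le_sum fun ω _ => h ω) (Nat.cast_nonneg _)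

lemma uniformExp_nonneg {X : Ω → ℝ} (h : ∀ ω, 0 ≤ X ω) : 0 ≤ uniformExp X :=
  div_nonneg (Finset.sum_nonneg fun ω _ => h ω) (Nat.cast_nonneg _)

lemma uniformExp_const [Nonempty Ω] (c : ℝ) : uniformExp (fun _ : Ω => c) = c := by
  have : (0 : ℝ) < Fintype.card Ω := by exact_mod_cast Fintype.card_pos
  simp only [uniformExp, Finset.sum_const, Finset.card_univ, nsmul_eq_mul]
  field_simp

/-- Jensen's inequality for the square. -/
lemma uniformExp_sq_le [Nonempty Ω] (X : Ω → ℝ) :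
    uniformExp X ^ 2 ≤ uniformExp fun ω => X ω ^ 2 := by
  have h1 : 0 ≤ uniformExp fun ω => (X ω - uniformExp X) ^ 2 :=
    uniformExp_nonneg fun ω => sq_nonneg _
  have h2 : (fun ω => (X ω - uniformExp X) ^ 2)
      = fun ω => X ω ^ 2 - (2 * uniformExp X) * X ω + uniformExp X ^ 2 := by
    funext ω; ring
  rw [h2, uniformExp_add, uniformExp_sub, uniformExp_const_mul, uniformExp_const] at h1
  linarith

lemma uniformExp_le_of_sq [Nonempty Ω] {X Y : Ω → ℝ} {b : ℝ} (hb : 0 ≤ b)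
    (h : ∀ ω, X ω ^ 2 ≤ Y ω) (hY : uniformExp Y ≤ b ^ 2) : uniformExp X ≤ b :=
  (le_abs_self _).trans (abs_le_of_sq_le_sq
    ((uniformExp_sq_le X).trans ((uniformExp_mono h).trans hY)) hb)

/-- Resampling one coordinate of a uniformly distributed sequence does not change its law. -/
lemma uniformExp_resample {ι B : Type*} [Fintype ι] [DecidableEq ι] [Fintype B] [Nonempty B]
    (X : (ι → B) → ℝ) (a : ι) :
    uniformExp X = uniformExp fun ω => uniformExp fun b => X (Function.update ω a b) := by
  have hB : (0 : ℝ) < Fintype.card B := by exact_mod_cast Fintype.card_pos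
  let σ : (ι → B) × B → (ι → B) × B := fun q => (Function.update q.1 a q.2, q.1 a)
  have hσ : Function.Involutive σ := by
    rintro ⟨ω, b⟩
    simp [σ]
  have h1 : ∑ q : (ι → B) × B, X (Function.update q.1 a q.2) = ∑ q : (ι → B) × B, X q.1 :=
    Fintype.sum_equiv hσ.toPerm _ _ fun q => rfl
  rw [Fintype.sum_prod_type, Fintype.sum_prod_type] at h1
  simp only [uniformExp, ← Finset.sum_div, h1, Finset.sum_const, Finset.card_univ, nsmul_eq_mul]
  rw [← Finset.mul_sum]
  field_simp

end UniformExp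

/-- The sequence of selected coordinates of one run (only the entries up to `K` matter). -/
def pathOf {n p m K : ℕ} (π : Fin (K + 1) → DualIndex n p m) (k : ℕ) : DualIndex n p m :=
  π (Fin.ofNat (K + 1) k)

/-- Expectation over the coordinates selected in one run. -/
def pathExp {n p m : ℕ} (K : ℕ) (X : (ℕ → DualIndex n p m) → ℝ) : ℝ :=
  uniformExp fun π : Fin (K + 1) → DualIndex n p m => X (pathOf π)

section PathExp

variable {n p m K : ℕ} {X Y : (ℕ → DualIndex n p m) → ℝ}

lemma pathExp_add (X Y : (ℕ → DualIndex n p m) → ℝ) :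
    pathExp K (fun i => X i + Y i) = pathExp K X + pathExp K Y := uniformExp_add _ _

lemma pathExp_sub (X Y : (ℕ → DualIndex n p m) → ℝ) :
    pathExp K (fun i => X i - Y i) = pathExp K X - pathExp K Y := uniformExp_sub _ _

lemma pathExp_const_mul (c : ℝ) (X : (ℕ → DualIndex n p m) → ℝ) :
    pathExp K (fun i => c * X i) = c * pathExp K X := uniformExp_const_mul _ _

lemma pathExp_div_const (X : (ℕ → DualIndex n p m) → ℝ) (c : ℝ) :
    pathExp K (fun i => X i / c) = pathExp K X / c := uniformExp_div_const _ _

lemma pathExp_sum {ι : Type*} (S : Finset ι) (X : ι → (ℕ → DualIndex n p m) → ℝ) :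
    pathExp K (fun i => ∑ s ∈ S, X s i) = ∑ s ∈ S, pathExp K (X s) := uniformExp_sum _ _

lemma pathExp_mono (h : ∀ i, X i ≤ Y i) : pathExp K X ≤ pathExp K Y :=
  uniformExp_mono fun _ => h _

lemma pathExp_nonneg (h : ∀ i, 0 ≤ X i) : 0 ≤ pathExp K X := uniformExp_nonneg fun _ => h _

lemma pathExp_const (hpos : 0 < n + p + m) (c : ℝ) :
    pathExp K (fun _ : ℕ → DualIndex n p m => c) = c := by
  have : Nonempty (DualIndex n p m) :=
    Fintype.card_pos_iff.1 (by rw [ConvexProblem.card_dualIndex]; exact hpos)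
  exact uniformExp_const c

/-- Conditioning on the past: the coordinate `k` may be averaged out. -/
lemma pathExp_step (hpos : 0 < n + p + m) {k : ℕ} (hk : k ≤ K)
    (hX : ∀ i i', (∀ s < k + 1, i s = i' s) → X i = X i') :
    pathExp K X = pathExp K fun i => (∑ j, X (Function.update i k j)) / ((n + p + m : ℕ) : ℝ) := by
  have : Nonempty (DualIndex n p m) :=
    Fintype.card_pos_iff.1 (by rw [ConvexProblem.card_dualIndex]; exact hpos)
  rw [pathExp, uniformExp_resample _ (Fin.ofNat (K + 1) k), pathExp]
  congr 1
  funext π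
  rw [uniformExp, ConvexProblem.card_dualIndex]
  congr 1
  refine Finset.sum_congr rfl fun j _ => hX _ _ fun s hs => ?_
  simp only [pathOf]
  by_cases hsk : s = k
  · subst hsk; simp
  · rw [Function.update_of_ne hsk, Function.update_of_ne]
    · rfl
    · intro h
      apply hsk
      have h1 := congrArg Fin.val h
      simpa [Fin.ofNat, Nat.mod_eq_of_lt (show s < K + 1 by omega),
        Nat.mod_eq_of_lt (show k < K + 1 by omega)] using h1

end PathExp

namespace ConvexProblem

variable {t n p m : ℕ} {P : ConvexProblem t n p m}

/-- The real-valued version of the negative dual function, meaningful on `domSet`. -/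
def dReal (P : ConvexProblem t n p m) (u : DualVec n p m) : ℝ := P.d u + ∑ j, P.hReal j (u j)

lemma D_toReal {u : DualVec n p m} (hu : u ∈ P.domSet) : (P.D u).toReal = P.dReal u := by
  rw [D_eq hu, EReal.toReal_coe, dReal]

lemma sqL_convexOn (hP : P.Standing) (w : DualVec n p m) :
    ConvexOn ℝ Set.univ fun u : DualVec n p m => P.sqL (u - w) := by
  refine ⟨convex_univ, fun u _ u' _ a b ha hb hab => ?_⟩
  simp only [sqL, smul_eq_mul, Finset.mul_sum, ← Finset.sum_add_distrib]
  refine Finset.sum_le_sum fun j _ => ?_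
  simp only [Pi.sub_apply, Pi.add_apply, Pi.smul_apply, smul_eq_mul]
  have h1 := mul_nonneg (hP.L_nonneg j) (mul_nonneg (mul_nonneg ha hb) (sq_nonneg (u j - u' j)))
  obtain rfl : b = 1 - a := by linarith
  linarith

/-! ### The rate of one run -/

section RunRate

variable (hP : P.Standing) (hL : ∀ j, 0 < P.L j) (hpos : 0 < n + p + m) {u0 : DualVec n p m}
  (hu0 : u0 ∈ P.domSet) {K : ℕ}

/-- The expected squared distance of `z^k` to `w`. -/
def expSq (P : ConvexProblem t n p m) (u0 : DualVec n p m) (K : ℕ) (w : DualVec n p m) (k : ℕ) :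
    ℝ := pathExp K fun i => P.sqL (P.zIter u0 i k - w)

/-- The expected squared length of the `k`-th step. -/
def expStep (P : ConvexProblem t n p m) (u0 : DualVec n p m) (K : ℕ) (k : ℕ) : ℝ :=
  pathExp K (fun i => P.sqL (P.fullStep u0 i k - P.zIter u0 i k)) / ((n + p + m : ℕ) : ℝ)

include hpos in
lemma expSq_succ {k : ℕ} (hk : k ≤ K) (w : DualVec n p m) :
    P.expSq u0 K w (k + 1) = (1 - 1 / ((n + p + m : ℕ) : ℝ)) * P.expSq u0 K w k
      + pathExp K (fun i => P.sqL (P.fullStep u0 i k - w)) / ((n + p + m : ℕ) : ℝ) := by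
  rw [expSq, pathExp_step hpos hk fun i i' h => by rw [zIter_congr h]]
  simp only [sqL_zIter_step, pathExp_add, pathExp_const_mul, pathExp_div_const]
  rfl

include hP hL hpos hu0

/-- The one-step inequality for the potential `q_k E[dualBound] + E‖z^k - w‖²`. -/
lemma Standing.potential_step {k : ℕ} (hk : k ≤ K) (w : DualVec n p m) :
    potWeight (n + p + m) (k + 1) * pathExp K (fun i => P.dualBound u0 i (k + 1))
        + P.expSq u0 K w (k + 1) + P.expStep u0 K k / 2
        + (potWeight (n + p + m) (k + 1) - potWeight (n + p + m) k)
          * pathExp K (fun i => P.lagIter u0 i k w)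
      ≤ potWeight (n + p + m) k * pathExp K (fun i => P.dualBound u0 i k) + P.expSq u0 K w k := by
  have hnpos : (0 : ℝ) < ((n + p + m : ℕ) : ℝ) := by exact_mod_cast hpos
  have h1 : pathExp K (fun i => P.dualBound u0 i (k + 1))
      ≤ (1 - theta (n + p + m) k) * pathExp K (fun i => P.dualBound u0 i k)
        - theta (n + p + m) k * pathExp K (fun i => P.lagIter u0 i k w)
        + ((n + p + m : ℕ) : ℝ) * theta (n + p + m) k ^ 2 *
          (P.expSq u0 K w k - pathExp K (fun i => P.sqL (P.fullStep u0 i k - w))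
            - pathExp K (fun i => P.sqL (P.fullStep u0 i k - P.zIter u0 i k)) / 2) := by
    rw [pathExp_step hpos hk fun i i' h => dualBound_congr h]
    refine (pathExp_mono fun i => hP.dualBound_step hL hu0 i k w).trans (le_of_eq ?_)
    simp only [pathExp_add, pathExp_sub, pathExp_const_mul, pathExp_div_const]
    rfl
  have h2 := expSq_succ (P := P) (u0 := u0) hpos hk w
  have h3 := mul_le_mul_of_nonneg_left h1 (potWeight_nonneg hpos (k + 1))
  have h4 := potWeight_sub hpos k
  have h5 := potWeight_mul hpos k
  have hr := invStep_succ_pos hpos k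
  have h6 : potWeight (n + p + m) (k + 1) * (((n + p + m : ℕ) : ℝ) * theta (n + p + m) k ^ 2)
      = 1 / ((n + p + m : ℕ) : ℝ) := by
    rw [theta_eq hpos k, potWeight_succ]; field_simp
  rw [expStep]
  have e : potWeight (n + p + m) (k + 1) * ((1 - theta (n + p + m) k)
        * pathExp K (fun i => P.dualBound u0 i k)
        - theta (n + p + m) k * pathExp K (fun i => P.lagIter u0 i k w)
        + ((n + p + m : ℕ) : ℝ) * theta (n + p + m) k ^ 2 *
          (P.expSq u0 K w k - pathExp K (fun i => P.sqL (P.fullStep u0 i k - w))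
            - pathExp K (fun i => P.sqL (P.fullStep u0 i k - P.zIter u0 i k)) / 2))
      = potWeight (n + p + m) k * pathExp K (fun i => P.dualBound u0 i k)
        - (potWeight (n + p + m) (k + 1) - potWeight (n + p + m) k)
          * pathExp K (fun i => P.lagIter u0 i k w)
        + 1 / ((n + p + m : ℕ) : ℝ) *
          (P.expSq u0 K w k - pathExp K (fun i => P.sqL (P.fullStep u0 i k - w))
            - pathExp K (fun i => P.sqL (P.fullStep u0 i k - P.zIter u0 i k)) / 2) := by
    rw [← h6, h5]; ring
  rw [e] at h3
  rw [h2]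
  have e2 : 1 / ((n + p + m : ℕ) : ℝ) *
          (P.expSq u0 K w k - pathExp K (fun i => P.sqL (P.fullStep u0 i k - w))
            - pathExp K (fun i => P.sqL (P.fullStep u0 i k - P.zIter u0 i k)) / 2)
      = 1 / ((n + p + m : ℕ) : ℝ) * P.expSq u0 K w k
        - pathExp K (fun i => P.sqL (P.fullStep u0 i k - w)) / ((n + p + m : ℕ) : ℝ)
        - pathExp K (fun i => P.sqL (P.fullStep u0 i k - P.zIter u0 i k))
          / ((n + p + m : ℕ) : ℝ) / 2 := by ring
  linarith

omit hu0 in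
lemma Standing.expDist_succ {k : ℕ} (hk : k ≤ K) {w : DualVec n p m} (hw : w ∈ P.dualSol) :
    potWeight (n + p + m) (k + 1) * pathExp K (fun i => P.distSq (P.uIter u0 i (k + 1)))
      ≤ potWeight (n + p + m) k * pathExp K (fun i => P.distSq (P.uIter u0 i k))
        + invStep (n + p + m) (k + 1) * (P.expSq u0 K w (k + 1)
          - (1 - 1 / ((n + p + m : ℕ) : ℝ)) * P.expSq u0 K w k)
        + (1 - 1 / ((n + p + m : ℕ) : ℝ)) * P.expStep u0 K k := by
  have hnpos : (0 : ℝ) < ((n + p + m : ℕ) : ℝ) := by exact_mod_cast hpos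
  have h1 : pathExp K (fun i => P.distSq (P.uIter u0 i (k + 1)))
      ≤ (1 - theta (n + p + m) k) * pathExp K (fun i => P.distSq (P.uIter u0 i k))
        + theta (n + p + m) k * pathExp K (fun i => P.sqL (P.fullStep u0 i k - w))
        + (((n + p + m : ℕ) : ℝ) - 1) * theta (n + p + m) k ^ 2
          * pathExp K (fun i => P.sqL (P.fullStep u0 i k - P.zIter u0 i k)) := by
    rw [pathExp_step hpos hk fun i i' h => by rw [uIter_congr h]]
    refine (pathExp_mono fun i => hP.distSq_step hL i k hw).trans (le_of_eq ?_)
    simp only [pathExp_add, pathExp_const_mul]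
  have h2 := expSq_succ (P := P) (u0 := u0) hpos hk w
  have h3 := mul_le_mul_of_nonneg_left h1 (potWeight_nonneg hpos (k + 1))
  have h5 := potWeight_mul hpos k
  have hr := invStep_succ_pos hpos k
  have h6 : potWeight (n + p + m) (k + 1) * theta (n + p + m) k
      = invStep (n + p + m) (k + 1) / ((n + p + m : ℕ) : ℝ) := by
    rw [theta_eq hpos k, potWeight_succ]; field_simp
  have h7 : potWeight (n + p + m) (k + 1)
        * ((((n + p + m : ℕ) : ℝ) - 1) * theta (n + p + m) k ^ 2)
      = (1 - 1 / ((n + p + m : ℕ) : ℝ)) / ((n + p + m : ℕ) : ℝ) := by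
    rw [theta_eq hpos k, potWeight_succ]; field_simp
  rw [expStep, h2, h5]
  calc _ ≤ _ := h3
    _ = (1 - theta (n + p + m) k) * potWeight (n + p + m) (k + 1)
          * pathExp K (fun i => P.distSq (P.uIter u0 i k))
        + (potWeight (n + p + m) (k + 1) * theta (n + p + m) k)
          * pathExp K (fun i => P.sqL (P.fullStep u0 i k - w))
        + potWeight (n + p + m) (k + 1)
          * ((((n + p + m : ℕ) : ℝ) - 1) * theta (n + p + m) k ^ 2)
          * pathExp K (fun i => P.sqL (P.fullStep u0 i k - P.zIter u0 i k)) := by ring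
    _ = _ := by rw [h6, h7]; ring

omit hpos in
lemma Standing.dReal_uIter_le (i : ℕ → DualIndex n p m) (k : ℕ) :
    P.dReal (P.uIter u0 i k) ≤ P.dualBound u0 i k := by
  have := hP.sum_hReal_le_hIter hL hu0 i k
  rw [dReal, dualBound]
  linarith

omit hpos in
lemma Standing.neg_F_le_dualBound {xs : EuclideanSpace ℝ (Fin t)} (hxs : xs ∈ P.primalSol)
    (i : ℕ → DualIndex n p m) (k : ℕ) : -P.F xs ≤ P.dualBound u0 i k :=
  (hP.neg_F_le_D_real hxs (hP.uIter_mem hL hu0 i k)).trans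
    (hP.dReal_uIter_le hL hu0 i k)

omit hpos in
lemma Standing.F_le_lagIter {xs : EuclideanSpace ℝ (Fin t)} (hxs : xs ∈ P.primalSol)
    {w : DualVec n p m} (hw : w ∈ P.dualSol) (i : ℕ → DualIndex n p m) (k : ℕ) :
    P.F xs ≤ P.lagIter u0 i k w := by
  have h1 := hP.neg_slackLagrangian_le (hP.mem_hDom_of_mem_dualSol hxs hw)
    (P.xOf (P.vIter u0 i k)) (hP.slackIter_mem hL hu0 i k)
  rw [hP.D_real_of_mem_dualSol hxs hw] at h1
  rw [lagIter]
  linarith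

/-- The potential `E‖z^k - w‖² + q_k E[dualBound - D*]` decreases along a run. -/
lemma Standing.potential_decrease {xs : EuclideanSpace ℝ (Fin t)} (hxs : xs ∈ P.primalSol)
    {w : DualVec n p m} (hw : w ∈ P.dualSol) {k : ℕ} (hk : k ≤ K) :
    P.expSq u0 K w (k + 1)
        + potWeight (n + p + m) (k + 1) * (pathExp K (fun i => P.dualBound u0 i (k + 1)) + P.F xs)
        + P.expStep u0 K k / 2
      ≤ P.expSq u0 K w k
        + potWeight (n + p + m) k * (pathExp K (fun i => P.dualBound u0 i k) + P.F xs) := by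
  have h1 := hP.potential_step hL hpos hu0 hk w
  have h2 : P.F xs ≤ pathExp K (fun i => P.lagIter u0 i k w) := by
    rw [← pathExp_const (K := K) hpos (P.F xs)]
    exact pathExp_mono fun i => hP.F_le_lagIter hL hu0 hxs hw i k
  have h3 := mul_le_mul_of_nonneg_left h2
    (sub_nonneg.2 (potWeight_mono hpos (Nat.le_succ k)))
  linarith

omit hu0 hL hpos in
lemma Standing.expSq_nonneg (w : DualVec n p m) (k : ℕ) : 0 ≤ P.expSq u0 K w k :=
  pathExp_nonneg fun _ => hP.sqL_nonneg _

omit hu0 hL hpos in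
lemma Standing.expStep_nonneg (k : ℕ) : 0 ≤ P.expStep u0 K k :=
  div_nonneg (pathExp_nonneg fun _ => hP.sqL_nonneg _) (Nat.cast_nonneg _)

/-- **Contraction of one run** under quadratic functional growth. -/
lemma Standing.run_contraction {xs : EuclideanSpace ℝ (Fin t)} (hxs : xs ∈ P.primalSol)
    {κ : ℝ} (hκ : 0 < κ) (hgrowth : ∀ u ∈ P.domSet, κ * P.distSq u ≤ P.dReal u + P.F xs) :
    (1 - 1 / ((n + p + m : ℕ) : ℝ))
          * (pathExp K (fun i => P.dReal (P.uIter u0 i (K + 1))) + P.F xs)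
        + pathExp K (fun i => P.distSq (P.uIter u0 i (K + 1)))
      ≤ restartRate (n + p + m) κ K
        * ((1 - 1 / ((n + p + m : ℕ) : ℝ)) * (P.dReal u0 + P.F xs) + P.distSq u0) := by
  have hw := (hP.proj_spec hL u0).1
  set w := P.proj u0 with hwdef
  have hc := one_sub_inv_nonneg hpos
  have hd0 : pathExp K (fun i => P.dualBound u0 i 0) = P.dReal u0 :=
    pathExp_const hpos (P.dReal u0)
  have ha0 : P.expSq u0 K w 0 = P.distSq u0 := by
    rw [distSq, hP.normL_sq_eq]
    exact pathExp_const hpos (P.sqL (u0 - w))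
  have hx : ∀ k, 0 ≤ pathExp K (fun i => P.dualBound u0 i k) + P.F xs := by
    intro k
    have : -P.F xs ≤ pathExp K (fun i => P.dualBound u0 i k) := by
      rw [← pathExp_const (K := K) hpos (-P.F xs)]
      exact pathExp_mono fun i => hP.neg_F_le_dualBound hL hu0 hxs i k
    linarith
  have hmain := cycle_contraction hpos hκ (K := K) (a := P.expSq u0 K w)
    (x := fun k => pathExp K (fun i => P.dualBound u0 i k) + P.F xs)
    (y := fun k => pathExp K (fun i => P.distSq (P.uIter u0 i k)))
    (W := runAvg (n + p + m) (P.expSq u0 K w)) (s := P.expStep u0 K)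
    (T := (1 - 1 / ((n + p + m : ℕ) : ℝ)) * (P.dReal u0 + P.F xs) + P.distSq u0)
    (hP.expSq_nonneg w) (fun k _ => hx k) (hP.expStep_nonneg)
    (by
      simp only [hd0, ha0, potWeight]
      linarith)
    (fun k hk => hP.potential_decrease hL hpos hu0 hxs hw hk)
    (fun k hk => hP.expDist_succ hL hpos hk hw)
    (fun k _ => by
      have := potWeight_smul_runAvg_succ hpos (P.expSq u0 K w) k
      simp only [smul_eq_mul] at this
      rw [this]; ring)
    rfl
    (by
      rw [ha0]
      exact (pathExp_const (K := K) hpos (P.distSq u0)).le)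
    (by
      have h1 : ∀ i, P.distSq (P.uIter u0 i (K + 1))
          ≤ runAvg (n + p + m) (fun s => P.sqL (P.zIter u0 i s - w)) (K + 1) := fun i =>
        (hP.distSq_le hL _ hw).trans
          ((sqL_convexOn hP w).map_runAvg_le hpos fun s _ => Set.mem_univ _)
      refine (pathExp_mono h1).trans (le_of_eq ?_)
      have h2 : ∀ k, pathExp K (fun i => runAvg (n + p + m)
          (fun s => P.sqL (P.zIter u0 i s - w)) k) = runAvg (n + p + m) (P.expSq u0 K w) k := by
        intro k
        induction k with
        | zero => rfl
        | succ k ih =>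
          simp only [runAvg, smul_eq_mul, pathExp_add, pathExp_const_mul, pathExp_sub] at ih ⊢
          rw [ih]
          rfl
      exact h2 _)
    (fun k _ => by
      rw [← pathExp_const_mul, ← pathExp_const (K := K) hpos (P.F xs), ← pathExp_add]
      refine pathExp_mono fun i => ?_
      have h1 := hgrowth _ (hP.uIter_mem hL hu0 i k)
      have h2 := hP.dReal_uIter_le hL hu0 i k
      linarith)
  have hd : pathExp K (fun i => P.dReal (P.uIter u0 i (K + 1)))
      ≤ pathExp K (fun i => P.dualBound u0 i (K + 1)) :=
    pathExp_mono fun i => hP.dReal_uIter_le hL hu0 i _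
  have hmono := mul_le_mul_of_nonneg_left hd hc
  rw [restartRate]
  have hθ0 : theta (n + p + m) 0 = 1 / ((n + p + m : ℕ) : ℝ) := rfl
  rw [hθ0]
  linarith

end RunRate

end ConvexProblem

/-! ### The averaging window -/

/-- The normalized weight of iteration `k` in the average over the window `K₀, …, K`. -/
def avgWeight (nh K₀ K k : ℕ) : ℝ :=
  (potWeight nh (k + 1) - potWeight nh k) / (potWeight nh (K + 1) - potWeight nh K₀)

section AvgWeight

variable {nh : ℕ} (hnh : 0 < nh) {K₀ K : ℕ}

lemma sum_potWeight_sub (nh : ℕ) {k : ℕ} (hk : K₀ ≤ k) :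
    ∑ s ∈ Finset.Ico K₀ k, (potWeight nh (s + 1) - potWeight nh s)
      = potWeight nh k - potWeight nh K₀ :=
  Finset.sum_Ico_sub _ hk

lemma sum_avgWeight (hK : K₀ ≤ K + 1) (hgap : 0 < potWeight nh (K + 1) - potWeight nh K₀) :
    ∑ k ∈ Finset.Ico K₀ (K + 1), avgWeight nh K₀ K k = 1 := by
  simp only [avgWeight, ← Finset.sum_div]
  rw [sum_potWeight_sub nh hK, div_self hgap.ne']

include hnh in
lemma avgWeight_nonneg (hgap : 0 < potWeight nh (K + 1) - potWeight nh K₀) (k : ℕ) :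
    0 ≤ avgWeight nh K₀ K k :=
  div_nonneg (sub_nonneg.2 (potWeight_mono hnh (Nat.le_succ k))) hgap.le

end AvgWeight

/-- A telescoping sum of one-step inequalities. -/
lemma add_sum_Ico_le {e s : ℕ → ℝ} {K₀ K : ℕ} (h : ∀ k ≤ K, e (k + 1) + s k ≤ e k)
    {k : ℕ} (hk₀ : K₀ ≤ k) (hk : k ≤ K + 1) : e k + ∑ r ∈ Finset.Ico K₀ k, s r ≤ e K₀ := by
  induction k, hk₀ using Nat.le_induction with
  | base => simp
  | succ k hk₀ ih =>
    rw [Finset.sum_Ico_succ_top hk₀]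
    have h1 := h k (by omega)
    have h2 := ih (by omega)
    linarith

/-- The weighted Cauchy–Schwarz inequality. -/
lemma sum_mul_le_sqrt_weighted {ι : Type*} (S : Finset ι) {l : ι → ℝ} (hl : ∀ j, 0 < l j)
    (w r : ι → ℝ) :
    ∑ j ∈ S, w j * r j ≤ √(∑ j ∈ S, l j * w j ^ 2) * √(∑ j ∈ S, 1 / l j * r j ^ 2) := by
  have h := Real.sum_mul_le_sqrt_mul_sqrt S (fun j => √(l j) * w j) (fun j => r j / √(l j))
  refine (le_of_eq ?_).trans (h.trans (le_of_eq ?_))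
  · refine Finset.sum_congr rfl fun j _ => ?_
    have := Real.sqrt_pos.2 (hl j)
    field_simp
  · congr 2
    · refine Finset.sum_congr rfl fun j _ => ?_
      rw [mul_pow, Real.sq_sqrt (hl j).le]
    · refine Finset.sum_congr rfl fun j _ => ?_
      rw [div_pow, Real.sq_sqrt (hl j).le]
      ring

namespace ConvexProblem

variable {t n p m : ℕ} {P : ConvexProblem t n p m}

/-- The squared dual weighted norm. -/
def sqDual (P : ConvexProblem t n p m) (r : DualVec n p m) : ℝ := ∑ j, 1 / P.L j * r j ^ 2

/-- The averaged difference between the residuals and the slack variables. -/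
def resAvg (P : ConvexProblem t n p m) (u0 : DualVec n p m) (K₀ K : ℕ) (i : ℕ → DualIndex n p m) :
    DualVec n p m := fun j => ∑ k ∈ Finset.Ico K₀ (K + 1), avgWeight (n + p + m) K₀ K k
      * (P.res (P.xOf (P.vIter u0 i k)) j - P.slackIter u0 i k j)

/-- The averaged Lagrangian of the slack form. -/
def lagAvg (P : ConvexProblem t n p m) (u0 : DualVec n p m) (K₀ K : ℕ) (w : DualVec n p m)
    (i : ℕ → DualIndex n p m) : ℝ :=
  ∑ k ∈ Finset.Ico K₀ (K + 1), avgWeight (n + p + m) K₀ K k * P.lagIter u0 i k w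

lemma ardcaPrimal_eq (hpos : 0 < n + p + m) {u0 : DualVec n p m} {K₀ K : ℕ} (hK : K₀ ≤ K + 1)
    (hgap : 0 < potWeight (n + p + m) (K + 1) - potWeight (n + p + m) K₀)
    (i : ℕ → DualIndex n p m) :
    P.ardcaPrimal u0 K₀ K i = ∑ k ∈ Finset.Ico K₀ (K + 1),
      avgWeight (n + p + m) K₀ K k • P.xOf (P.vIter u0 i k) := by
  have hnpos : (0 : ℝ) < ((n + p + m : ℕ) : ℝ) := by exact_mod_cast hpos
  have h1 : ∀ k, 1 / theta (n + p + m) k = ((n + p + m : ℕ) : ℝ) ^ 2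
      * (potWeight (n + p + m) (k + 1) - potWeight (n + p + m) k) := by
    intro k
    have := invStep_succ_pos hpos k
    rw [theta_eq hpos, potWeight_sub hpos]
    field_simp
  rw [ardcaPrimal, ← Finset.Ico_add_one_right_eq_Icc]
  simp only [h1, ← Finset.mul_sum]
  rw [sum_potWeight_sub _ hK, Finset.smul_sum]
  refine Finset.sum_congr rfl fun k _ => ?_
  rw [smul_smul, avgWeight]
  congr 1
  field_simp

/-! ### From the slack form to the primal problem -/

section Primal

variable (hP : P.Standing) (hL : ∀ j, 0 < P.L j)

include hP in
lemma Standing.loss_constant_nonneg : 0 ≤ P.M * √(∑ i : Fin n, P.L (Sum.inl i)) := by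
  rcases isEmpty_or_nonempty (Fin n) with h | ⟨⟨i⟩⟩
  · simp
  · have h1 := hP.phi_lipschitz i 1 0
    have h2 : 0 ≤ P.M := by
      have := (abs_nonneg _).trans h1
      simpa using this
    exact mul_nonneg h2 (Real.sqrt_nonneg _)

include hP in
lemma Standing.slackCost_sub_le (i : Fin n) (x y : ℝ) :
    P.slackCost (Sum.inl i) x - P.slackCost (Sum.inl i : DualIndex n p m) y ≤ P.M * |x - y| := by
  have hn : (0 : ℝ) < n := by exact_mod_cast i.pos
  have h1 := (le_abs_self _).trans (hP.phi_lipschitz i (n * x) (n * y))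
  rw [← mul_sub, abs_mul, abs_of_pos hn] at h1
  simp only [slackCost]
  rw [← sub_div, div_le_iff₀ hn]
  linarith

include hL

lemma violation_sq (x : EuclideanSpace ℝ (Fin t)) : P.violation x ^ 2
    = (∑ i, 1 / P.L (Sum.inr (Sum.inl i)) * P.eqRes x i ^ 2)
      + ∑ i, 1 / P.L (Sum.inr (Sum.inr i)) * max 0 (P.g i x) ^ 2 :=
  Real.sq_sqrt (add_nonneg
    (Finset.sum_nonneg fun _ _ => mul_nonneg (one_div_pos.2 (hL _)).le (sq_nonneg _))
    (Finset.sum_nonneg fun _ _ => mul_nonneg (one_div_pos.2 (hL _)).le (sq_nonneg _)))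

lemma sqDual_nonneg (r : DualVec n p m) : 0 ≤ P.sqDual r :=
  Finset.sum_nonneg fun j _ => mul_nonneg (one_div_pos.2 (hL j)).le (sq_nonneg _)

include hP

/-- The optimal value is exceeded downwards by at most a multiple of the constraint violation. -/
lemma Standing.F_lower {xs : EuclideanSpace ℝ (Fin t)} (hxs : xs ∈ P.primalSol)
    {w : DualVec n p m} (hw : w ∈ P.dualSol) (x : EuclideanSpace ℝ (Fin t)) :
    P.F xs - P.normL w * P.violation x ≤ P.F x := by
  -- the slack variables nearest to the residuals
  obtain ⟨y, hy⟩ : ∃ y : DualVec n p m, y = Sum.elim (fun i => P.res x (Sum.inl i))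
    (Sum.elim (fun _ => 0) fun i => min 0 (P.g i x)) := ⟨_, rfl⟩
  have h1 := hP.neg_slackLagrangian_le (hP.mem_hDom_of_mem_dualSol hxs hw) x (y := y) (by
    rintro (i | i | i) <;> simp [hy, slackSet])
  rw [hP.D_real_of_mem_dualSol hxs hw, sum_slackCost] at h1
  have h2 := sum_mul_le_sqrt_weighted Finset.univ hL w (fun j => P.res x j - y j)
  have h3 : √(∑ j, 1 / P.L j * (P.res x j - y j) ^ 2) = P.violation x := by
    rw [violation]
    congr 1
    simp only [Fintype.sum_sum_type, hy, Sum.elim_inl, Sum.elim_inr, sub_self, res, sub_zero]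
    simp only [ne_eq, OfNat.ofNat_ne_zero, not_false_eq_true, zero_pow, mul_zero,
      Finset.sum_const_zero, zero_add]
    congr 1
    refine Finset.sum_congr rfl fun i _ => ?_
    have : P.g i x - min 0 (P.g i x) = max 0 (P.g i x) := by
      have := min_add_max 0 (P.g i x)
      linarith
    rw [this]
  rw [h3] at h2
  have h4 : P.F x = P.f x + ∑ i : Fin n, P.slackCost (Sum.inl i) (y (Sum.inl i)) := by
    rw [F_eq, hy]; rfl
  rw [h4]
  change _ ≤ P.normL w * P.violation x at h2
  linarith

variable {u0 : DualVec n p m} (hu0 : u0 ∈ P.domSet) {K₀ K : ℕ} (hK : K₀ ≤ K + 1)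
  (hgap : 0 < potWeight (n + p + m) (K + 1) - potWeight (n + p + m) K₀)
include hu0 hK hgap

omit hu0 hL in
lemma Standing.res_ardcaPrimal (i : ℕ → DualIndex n p m) (j : DualIndex n p m) :
    P.res (P.ardcaPrimal u0 K₀ K i) j ≤ P.resAvg u0 K₀ K i j
      + ∑ k ∈ Finset.Ico K₀ (K + 1), avgWeight (n + p + m) K₀ K k * P.slackIter u0 i k j := by
  have hpos := dim_pos i
  rw [ardcaPrimal_eq hpos hK hgap]
  refine ((hP.res_convexOn j).map_sum_le (fun k _ => avgWeight_nonneg hpos hgap k)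
    (sum_avgWeight hK hgap) fun k _ => Set.mem_univ _).trans (le_of_eq ?_)
  rw [resAvg, ← Finset.sum_add_distrib]
  refine Finset.sum_congr rfl fun k _ => ?_
  rw [smul_eq_mul]
  ring

omit hu0 hL in
lemma Standing.res_ardcaPrimal_of_not_ineq (i : ℕ → DualIndex n p m) {j : DualIndex n p m}
    (hj : ∀ i, j ≠ Sum.inr (Sum.inr i)) :
    P.res (P.ardcaPrimal u0 K₀ K i) j = P.resAvg u0 K₀ K i j
      + ∑ k ∈ Finset.Ico K₀ (K + 1), avgWeight (n + p + m) K₀ K k * P.slackIter u0 i k j := by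
  have hpos := dim_pos i
  have hconc : ConcaveOn ℝ Set.univ fun x => P.res x j :=
    ⟨convex_univ, fun x _ y _ a b _ _ hab => (res_combo_of_not_ineq hj x y hab).ge⟩
  rw [ardcaPrimal_eq hpos hK hgap]
  refine (le_antisymm ((hP.res_convexOn j).map_sum_le (fun k _ => avgWeight_nonneg hpos hgap k)
    (sum_avgWeight hK hgap) fun k _ => Set.mem_univ _)
    (hconc.le_map_sum (fun k _ => avgWeight_nonneg hpos hgap k)
    (sum_avgWeight hK hgap) fun k _ => Set.mem_univ _)).trans ?_
  rw [resAvg, ← Finset.sum_add_distrib]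
  refine Finset.sum_congr rfl fun k _ => ?_
  rw [smul_eq_mul]
  ring

/-- The averaged slack variables are feasible, so the constraint violation of the averaged primal
point is at most the averaged difference between the residuals and the slack variables. -/
lemma Standing.violation_sq_le (i : ℕ → DualIndex n p m) :
    P.violation (P.ardcaPrimal u0 K₀ K i) ^ 2 ≤ P.sqDual (P.resAvg u0 K₀ K i) := by
  have hpos := dim_pos i
  set x := P.ardcaPrimal u0 K₀ K i
  have hinv : ∀ j, 0 ≤ 1 / P.L j := fun j => (one_div_pos.2 (hL j)).le
  rw [violation_sq hL, sqDual]
  simp only [Fintype.sum_sum_type]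
  have h0 : 0 ≤ ∑ i' : Fin n, 1 / P.L (Sum.inl i') * P.resAvg u0 K₀ K i (Sum.inl i') ^ 2 :=
    Finset.sum_nonneg fun j _ => mul_nonneg (hinv _) (sq_nonneg _)
  have h1 : ∀ i' : Fin p, P.eqRes x i' = P.resAvg u0 K₀ K i (Sum.inr (Sum.inl i')) := by
    intro i'
    refine (hP.res_ardcaPrimal_of_not_ineq hK hgap i (j := Sum.inr (Sum.inl i'))
      (by simp)).trans ?_
    rw [Finset.sum_eq_zero, add_zero]
    intro k _
    have : P.slackIter u0 i k (Sum.inr (Sum.inl i')) = 0 :=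
      hP.slackIter_mem hL hu0 i k (Sum.inr (Sum.inl i'))
    rw [this, mul_zero]
  have h2 : ∀ i' : Fin m, max 0 (P.g i' x) ^ 2
      ≤ P.resAvg u0 K₀ K i (Sum.inr (Sum.inr i')) ^ 2 := by
    intro i'
    have h3 : P.g i' x ≤ P.resAvg u0 K₀ K i (Sum.inr (Sum.inr i')) := by
      refine (hP.res_ardcaPrimal hK hgap i (Sum.inr (Sum.inr i'))).trans ?_
      have : ∑ k ∈ Finset.Ico K₀ (K + 1), avgWeight (n + p + m) K₀ K k
          * P.slackIter u0 i k (Sum.inr (Sum.inr i')) ≤ 0 :=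
        Finset.sum_nonpos fun k _ => mul_nonpos_of_nonneg_of_nonpos
          (avgWeight_nonneg hpos hgap k)
          (hP.slackIter_mem hL hu0 i k (Sum.inr (Sum.inr i')))
      linarith
    rcases le_total 0 (P.g i' x) with h | h
    · rw [max_eq_right h]
      exact pow_le_pow_left₀ h h3 2
    · rw [max_eq_left h]
      simpa using sq_nonneg _
  have h4 : ∑ i', 1 / P.L (Sum.inr (Sum.inl i')) * P.eqRes x i' ^ 2
      = ∑ i', 1 / P.L (Sum.inr (Sum.inl i'))
        * P.resAvg u0 K₀ K i (Sum.inr (Sum.inl i')) ^ 2 :=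
    Finset.sum_congr rfl fun i' _ => by rw [h1]
  have h5 : ∑ i', 1 / P.L (Sum.inr (Sum.inr i')) * max 0 (P.g i' x) ^ 2
      ≤ ∑ i', 1 / P.L (Sum.inr (Sum.inr i'))
        * P.resAvg u0 K₀ K i (Sum.inr (Sum.inr i')) ^ 2 :=
    Finset.sum_le_sum fun i' _ => mul_le_mul_of_nonneg_left (h2 i') (hinv _)
  linarith

omit hu0 in
/-- Replacing the residuals of the losses by the averaged slack variables costs `M` per unit, and
the multiplier term of the averaged Lagrangian is bounded by the Cauchy–Schwarz inequality. -/
lemma Standing.F_upper (w : DualVec n p m) (i : ℕ → DualIndex n p m) :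
    P.F (P.ardcaPrimal u0 K₀ K i) ≤ P.lagAvg u0 K₀ K w i
      + (P.normL w + P.M * √(∑ i : Fin n, P.L (Sum.inl i))) * √(P.sqDual (P.resAvg u0 K₀ K i)) := by
  have hpos := dim_pos i
  set R := P.resAvg u0 K₀ K i with hR
  set x := P.ardcaPrimal u0 K₀ K i with hx
  obtain ⟨y, hy⟩ : ∃ y : DualVec n p m, y = fun j => ∑ k ∈ Finset.Ico K₀ (K + 1),
    avgWeight (n + p + m) K₀ K k * P.slackIter u0 i k j := ⟨_, rfl⟩
  have hf : P.f x ≤ ∑ k ∈ Finset.Ico K₀ (K + 1),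
      avgWeight (n + p + m) K₀ K k * P.f (P.xOf (P.vIter u0 i k)) := by
    rw [hx, ardcaPrimal_eq hpos hK hgap]
    exact hP.f_convexOn.map_sum_le (fun k _ => avgWeight_nonneg hpos hgap k)
      (sum_avgWeight hK hgap) fun k _ => Set.mem_univ _
  have hψ : ∑ j, P.slackCost j (y j) ≤ ∑ k ∈ Finset.Ico K₀ (K + 1),
      avgWeight (n + p + m) K₀ K k * ∑ j, P.slackCost j (P.slackIter u0 i k j) := by
    simp only [Finset.mul_sum]
    rw [Finset.sum_comm]
    refine Finset.sum_le_sum fun j _ => ?_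
    rw [hy]
    exact (hP.slackCost_convexOn j).map_sum_le (fun k _ => avgWeight_nonneg hpos hgap k)
      (sum_avgWeight hK hgap) fun k _ => Set.mem_univ _
  have hlag : P.lagAvg u0 K₀ K w i = ∑ k ∈ Finset.Ico K₀ (K + 1),
        avgWeight (n + p + m) K₀ K k * P.f (P.xOf (P.vIter u0 i k))
      + ∑ k ∈ Finset.Ico K₀ (K + 1),
        avgWeight (n + p + m) K₀ K k * ∑ j, P.slackCost j (P.slackIter u0 i k j)
      + ∑ j, w j * R j := by
    have : ∑ j, w j * R j = ∑ k ∈ Finset.Ico K₀ (K + 1), avgWeight (n + p + m) K₀ K k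
        * ∑ j, w j * (P.res (P.xOf (P.vIter u0 i k)) j - P.slackIter u0 i k j) := by
      simp only [hR, resAvg, Finset.mul_sum]
      rw [Finset.sum_comm]
      exact Finset.sum_congr rfl fun k _ => Finset.sum_congr rfl fun j _ => by ring
    rw [this, lagAvg, ← Finset.sum_add_distrib, ← Finset.sum_add_distrib]
    refine Finset.sum_congr rfl fun k _ => ?_
    rw [lagIter]
    ring
  have hloss : ∀ i' : Fin n, P.slackCost (Sum.inl i') (P.res x (Sum.inl i'))
      ≤ P.slackCost (Sum.inl i') (y (Sum.inl i')) + P.M * |R (Sum.inl i')| := by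
    intro i'
    have h1 := hP.res_ardcaPrimal_of_not_ineq (u0 := u0) hK hgap i (j := Sum.inl i') (by simp)
    have h2 := hP.slackCost_sub_le (p := p) (m := m) i' (P.res x (Sum.inl i')) (y (Sum.inl i'))
    have h3 : P.res x (Sum.inl i') - y (Sum.inl i') = R (Sum.inl i') := by
      rw [hx, h1, hy]; ring
    rw [h3] at h2
    linarith
  have hsum := Finset.sum_le_sum fun i' (_ : i' ∈ Finset.univ) => hloss i'
  rw [Finset.sum_add_distrib, ← Finset.mul_sum, ← sum_slackCost y] at hsum
  -- Cauchy–Schwarz for the multipliers and for the losses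
  have hw : -∑ j, w j * R j ≤ P.normL w * √(P.sqDual R) := by
    have h1 := sum_mul_le_sqrt_weighted Finset.univ hL (fun j => -w j) R
    simp only [neg_mul, Finset.sum_neg_distrib, neg_sq] at h1
    exact h1
  have hM : P.M * ∑ i' : Fin n, |R (Sum.inl i')|
      ≤ P.M * √(∑ i : Fin n, P.L (Sum.inl i)) * √(P.sqDual R) := by
    rcases isEmpty_or_nonempty (Fin n) with h | ⟨⟨i'⟩⟩
    · simp
    have hM0 : 0 ≤ P.M := by
      have := (abs_nonneg _).trans (hP.phi_lipschitz i' 1 0)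
      simpa using this
    have h1 := sum_mul_le_sqrt_weighted (Finset.univ : Finset (Fin n))
      (l := fun i' => P.L (Sum.inl i')) (fun _ => hL _) (fun _ => 1) (fun i' => |R (Sum.inl i')|)
    simp only [one_mul, one_pow, mul_one, sq_abs] at h1
    rw [mul_assoc]
    refine mul_le_mul_of_nonneg_left (h1.trans ?_) hM0
    refine mul_le_mul_of_nonneg_left (Real.sqrt_le_sqrt ?_) (Real.sqrt_nonneg _)
    rw [sqDual, Fintype.sum_sum_type]
    refine le_add_of_nonneg_right (Finset.sum_nonneg fun j _ => ?_)
    exact mul_nonneg (one_div_pos.2 (hL _)).le (sq_nonneg _)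
  rw [F_eq, hlag, add_mul]
  linarith

end Primal

/-! ### The expected residual along a run -/

section Residual

variable {u0 : DualVec n p m} {i : ℕ → DualIndex n p m}

/-- The deviation of the random step `z^{k+1} - z^k` from its conditional expectation. -/
def noise (P : ConvexProblem t n p m) (u0 : DualVec n p m) (i : ℕ → DualIndex n p m) (k : ℕ) :
    DualVec n p m :=
  P.zIter u0 i (k + 1) - P.zIter u0 i k
    - (1 / ((n + p + m : ℕ) : ℝ)) • (P.fullStep u0 i k - P.zIter u0 i k)

/-- The martingale with increments `noise`, started at iteration `K₀`. -/
def noiseSum (P : ConvexProblem t n p m) (u0 : DualVec n p m) (K₀ k : ℕ)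
    (i : ℕ → DualIndex n p m) : DualVec n p m := ∑ s ∈ Finset.Ico K₀ k, P.noise u0 i s

lemma noise_congr {i' : ℕ → DualIndex n p m} {k : ℕ} (h : ∀ s < k + 1, i s = i' s) :
    P.noise u0 i k = P.noise u0 i' k := by
  rw [noise, zIter_congr h, zIter_congr fun s hs => h s (by omega),
    fullStep_congr fun s hs => h s (by omega)]
  rfl

lemma noiseSum_congr {i' : ℕ → DualIndex n p m} {K₀ k : ℕ} (h : ∀ s < k, i s = i' s) :
    P.noiseSum u0 K₀ k i = P.noiseSum u0 K₀ k i' :=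
  Finset.sum_congr rfl fun s hs => noise_congr fun r hr => h r (by
    have := (Finset.mem_Ico.1 hs).2
    omega)

/-- The increment `noise` is centred given the past, and its second moment is at most that of the
random coordinate step. -/
lemma sqL_noise_step (hP : P.Standing) {K₀ k : ℕ} (hk : K₀ ≤ k) :
    (∑ j, P.sqL (P.noiseSum u0 K₀ (k + 1) (Function.update i k j))) / ((n + p + m : ℕ) : ℝ)
      ≤ P.sqL (P.noiseSum u0 K₀ k i)
        + P.sqL (P.fullStep u0 i k - P.zIter u0 i k) / ((n + p + m : ℕ) : ℝ) := by
  have hnpos : (0 : ℝ) < ((n + p + m : ℕ) : ℝ) := by exact_mod_cast dim_pos i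
  obtain ⟨N, hN⟩ : ∃ N : ℝ, N = ((n + p + m : ℕ) : ℝ) := ⟨_, rfl⟩
  rw [← hN] at hnpos ⊢
  set M := P.noiseSum u0 K₀ k i with hM
  set δ := P.fullStep u0 i k - P.zIter u0 i k with hδ
  have h1 : ∀ j, P.sqL (P.noiseSum u0 K₀ (k + 1) (Function.update i k j))
      = P.sqL (M - (1 / N) • δ) + P.L j * (2 * (M j - δ j / N) * δ j + δ j ^ 2) := by
    intro j
    have h2 : P.noiseSum u0 K₀ (k + 1) (Function.update i k j)
        = (M - (1 / N) • δ) + Pi.single j (δ j) := by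
      rw [noiseSum, Finset.sum_Ico_succ_top hk, ← noiseSum,
        noiseSum_congr (update_agree k j), ← hM, noise, zIter_update_succ,
        zIter_congr (update_agree k j), fullStep_congr (update_agree k j), ← hN, ← hδ,
        add_sub_cancel_left]
      change M + (Pi.single j (δ j) - _) = _
      abel
    rw [h2, sqL_add_single]
    simp only [Pi.sub_apply, Pi.smul_apply, smul_eq_mul]
    ring
  simp only [h1, Finset.sum_add_distrib, Finset.sum_const, Finset.card_univ, card_dualIndex,
    nsmul_eq_mul, ← hN]
  rw [add_div, mul_div_cancel_left₀ _ hnpos.ne']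
  have h3 : P.sqL (M - (1 / N) • δ)
        + (∑ j, P.L j * (2 * (M j - δ j / N) * δ j + δ j ^ 2)) / N
      = P.sqL M + P.sqL δ / N - P.sqL δ / N ^ 2 := by
    simp only [sqL, Finset.sum_div]
    rw [← Finset.sum_add_distrib, ← Finset.sum_add_distrib, ← Finset.sum_sub_distrib]
    refine Finset.sum_congr rfl fun j _ => ?_
    simp only [Pi.sub_apply, Pi.smul_apply, smul_eq_mul]
    field_simp
    ring
  have h4 : 0 ≤ P.sqL δ / N ^ 2 := div_nonneg (hP.sqL_nonneg δ) (by positivity)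
  linarith

lemma expNoise_le (hP : P.Standing) (hpos : 0 < n + p + m) {K₀ K : ℕ} {k : ℕ} (hk₀ : K₀ ≤ k)
    (hk : k ≤ K + 1) : pathExp K (fun i => P.sqL (P.noiseSum u0 K₀ k i))
      ≤ ∑ s ∈ Finset.Ico K₀ k, P.expStep u0 K s := by
  induction k, hk₀ using Nat.le_induction with
  | base =>
    simp only [noiseSum, Finset.Ico_self, Finset.sum_empty]
    rw [pathExp_const hpos]
    simp [sqL]
  | succ k hk₀ ih =>
    rw [Finset.sum_Ico_succ_top hk₀, pathExp_step hpos (by omega : k ≤ K)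
      fun i i' h => by rw [noiseSum_congr h]]
    refine (pathExp_mono fun i => sqL_noise_step hP hk₀).trans ?_
    rw [pathExp_add, pathExp_div_const]
    exact add_le_add_left (ih (by omega)) _

/-- The averaged difference between the residuals and the slack variables telescopes, up to
the noise. -/
lemma resAvg_eq (hpos : 0 < n + p + m) {K₀ K : ℕ} (hK : K₀ ≤ K + 1) (i : ℕ → DualIndex n p m)
    (j : DualIndex n p m) : P.resAvg u0 K₀ K i j
      = 2 / (potWeight (n + p + m) (K + 1) - potWeight (n + p + m) K₀) * P.L j
        * (P.zIter u0 i (K + 1) - P.zIter u0 i K₀ - P.noiseSum u0 K₀ (K + 1) i) j := by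
  have hnpos : (0 : ℝ) < ((n + p + m : ℕ) : ℝ) := by exact_mod_cast hpos
  have h1 : P.zIter u0 i (K + 1) - P.zIter u0 i K₀ - P.noiseSum u0 K₀ (K + 1) i
      = ∑ k ∈ Finset.Ico K₀ (K + 1), (1 / ((n + p + m : ℕ) : ℝ))
        • (P.fullStep u0 i k - P.zIter u0 i k) := by
    rw [← Finset.sum_Ico_sub (P.zIter u0 i) hK, noiseSum, ← Finset.sum_sub_distrib]
    refine Finset.sum_congr rfl fun k _ => ?_
    rw [noise]
    abel
  rw [h1, resAvg, Finset.sum_apply, Finset.mul_sum]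
  refine Finset.sum_congr rfl fun k _ => ?_
  have hr := invStep_succ_pos hpos k
  rw [avgWeight, potWeight_sub hpos, slackIter, theta_eq hpos]
  simp only [Pi.smul_apply, Pi.sub_apply, smul_eq_mul]
  field_simp
  ring

lemma sqDual_resAvg_le (hL : ∀ j, 0 < P.L j) (hpos : 0 < n + p + m)
    {K₀ K : ℕ} (hK : K₀ ≤ K + 1)
    (i : ℕ → DualIndex n p m) (w : DualVec n p m) :
    P.sqDual (P.resAvg u0 K₀ K i)
      ≤ 12 * (1 / (potWeight (n + p + m) (K + 1) - potWeight (n + p + m) K₀)) ^ 2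
        * (P.sqL (P.zIter u0 i (K + 1) - w) + P.sqL (P.zIter u0 i K₀ - w)
          + P.sqL (P.noiseSum u0 K₀ (K + 1) i)) := by
  set β := 1 / (potWeight (n + p + m) (K + 1) - potWeight (n + p + m) K₀) with hβ
  simp only [sqDual, sqL]
  rw [← Finset.sum_add_distrib, ← Finset.sum_add_distrib, Finset.mul_sum]
  refine Finset.sum_le_sum fun j _ => ?_
  rw [resAvg_eq hpos hK, ← mul_one_div 2, ← hβ]
  simp only [Pi.sub_apply]
  set a := P.zIter u0 i (K + 1) j
  set b := P.zIter u0 i K₀ j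
  set c := P.noiseSum u0 K₀ (K + 1) i j
  have hj := hL j
  have h1 : (a - b - c) ^ 2 ≤ 3 * ((a - w j) ^ 2 + (b - w j) ^ 2 + c ^ 2) := by
    nlinarith [sq_nonneg ((a - w j) + (b - w j)), sq_nonneg ((a - w j) + c),
      sq_nonneg ((b - w j) - c)]
  have h2 : 1 / P.L j * (2 * β * P.L j * (a - b - c)) ^ 2
      = 4 * β ^ 2 * P.L j * (a - b - c) ^ 2 := by
    field_simp
    ring
  rw [h2]
  have h3 := mul_le_mul_of_nonneg_left h1 (show 0 ≤ 4 * β ^ 2 * P.L j by positivity)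
  linarith

end Residual

/-! ### The primal rate of one run -/

section PrimalRate

variable (hP : P.Standing) (hL : ∀ j, 0 < P.L j) (hpos : 0 < n + p + m) {u0 : DualVec n p m}
  (hu0 : u0 ∈ P.domSet) {xs : EuclideanSpace ℝ (Fin t)} (hxs : xs ∈ P.primalSol)

/-- The potential at the beginning of a run. -/
def startPotential (P : ConvexProblem t n p m) (xs : EuclideanSpace ℝ (Fin t))
    (u : DualVec n p m) : ℝ :=
  (1 - 1 / ((n + p + m : ℕ) : ℝ)) * (P.dReal u + P.F xs) + P.distSq u

include hP hxs hpos in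
lemma Standing.startPotential_nonneg (hu0 : u0 ∈ P.domSet) : 0 ≤ P.startPotential xs u0 := by
  have h1 := hP.neg_F_le_D_real hxs hu0
  have h2 : 0 ≤ P.dReal u0 + P.F xs := by
    rw [dReal]; linarith
  exact add_nonneg (mul_nonneg (one_sub_inv_nonneg hpos) h2) (distSq_nonneg _)

include hP hL hpos hu0 hxs

/-- The potential inequality summed over the window `K₀, …, k - 1`. -/
lemma Standing.window_sum {K₀ K k : ℕ} (hk₀ : K₀ ≤ k) (hk : k ≤ K + 1) :
    P.expSq u0 K (P.proj u0) k + ∑ s ∈ Finset.Ico K₀ k, (P.expStep u0 K s / 2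
        + (potWeight (n + p + m) (s + 1) - potWeight (n + p + m) s)
          * (pathExp K (fun i => P.lagIter u0 i s (P.proj u0)) - P.F xs))
      ≤ P.startPotential xs u0 := by
  have hw := (hP.proj_spec hL u0).1
  set w := P.proj u0 with hwdef
  obtain ⟨e, he⟩ : ∃ e : ℕ → ℝ, e = fun k => P.expSq u0 K w k
    + potWeight (n + p + m) k * (pathExp K (fun i => P.dualBound u0 i k) + P.F xs) := ⟨_, rfl⟩
  have hstep : ∀ k ≤ K, e (k + 1) + (P.expStep u0 K k / 2
      + (potWeight (n + p + m) (k + 1) - potWeight (n + p + m) k)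
          * (pathExp K (fun i => P.lagIter u0 i k w) - P.F xs)) ≤ e k := by
    intro k hk
    have h1 := hP.potential_step hL hpos hu0 hk w
    rw [he]
    linarith
  have hdec : ∀ k ≤ K, e (k + 1) + 0 ≤ e k := by
    intro k hk
    have h1 := hP.potential_decrease hL hpos hu0 hxs hw hk
    have h2 := hP.expStep_nonneg (u0 := u0) (K := K) k
    rw [he]
    linarith
  have h0 : e 0 = P.startPotential xs u0 := by
    have hd0 : pathExp K (fun i => P.dualBound u0 i 0) = P.dReal u0 :=
      pathExp_const hpos (P.dReal u0)
    have ha0 : P.expSq u0 K w 0 = P.distSq u0 := by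
      rw [distSq, hP.normL_sq_eq]
      exact pathExp_const hpos (P.sqL (u0 - w))
    rw [he, startPotential]
    simp only [hd0, ha0, potWeight]
    ring
  have h1 := add_sum_Ico_le hdec (Nat.zero_le K₀) (hk₀.trans hk)
  have h2 := add_sum_Ico_le hstep hk₀ hk
  have h3 : 0 ≤ pathExp K (fun i => P.dualBound u0 i k) + P.F xs := by
    have : -P.F xs ≤ pathExp K (fun i => P.dualBound u0 i k) := by
      rw [← pathExp_const (K := K) hpos (-P.F xs)]
      exact pathExp_mono fun i => hP.neg_F_le_dualBound hL hu0 hxs i k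
    linarith
  have h4 := mul_nonneg (potWeight_nonneg hpos k) h3
  have h5 : e k = P.expSq u0 K w k
    + potWeight (n + p + m) k * (pathExp K (fun i => P.dualBound u0 i k) + P.F xs) := by rw [he]
  simp only [Finset.sum_const_zero, add_zero] at h1
  linarith

lemma Standing.lagGap_nonneg {K : ℕ} (s : ℕ) :
    0 ≤ (potWeight (n + p + m) (s + 1) - potWeight (n + p + m) s)
          * (pathExp K (fun i => P.lagIter u0 i s (P.proj u0)) - P.F xs) := by
  refine mul_nonneg (sub_nonneg.2 (potWeight_mono hpos (Nat.le_succ s))) (sub_nonneg.2 ?_)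
  rw [← pathExp_const (K := K) hpos (P.F xs)]
  exact pathExp_mono fun i => hP.F_le_lagIter hL hu0 hxs (hP.proj_spec hL u0).1 i s

variable {K₀ K : ℕ} (hK : K₀ ≤ K + 1)
  (hgap : 0 < potWeight (n + p + m) (K + 1) - potWeight (n + p + m) K₀)
include hK hgap

/-- The expected gap of the averaged Lagrangian, with the projection of the starting point as
multiplier. -/
lemma Standing.expLag_le : pathExp K (P.lagAvg u0 K₀ K (P.proj u0)) - P.F xs
    ≤ 1 / (potWeight (n + p + m) (K + 1) - potWeight (n + p + m) K₀)
      * P.startPotential xs u0 := by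
  have h1 := hP.window_sum hL hpos hu0 hxs hK le_rfl
  rw [Finset.sum_add_distrib] at h1
  have h2 : 0 ≤ ∑ s ∈ Finset.Ico K₀ (K + 1), P.expStep u0 K s / 2 :=
    Finset.sum_nonneg fun s _ => div_nonneg (hP.expStep_nonneg s) (by norm_num)
  have h3 := hP.expSq_nonneg (u0 := u0) (K := K) (P.proj u0) (K + 1)
  have h4 : pathExp K (P.lagAvg u0 K₀ K (P.proj u0)) - P.F xs
      = 1 / (potWeight (n + p + m) (K + 1) - potWeight (n + p + m) K₀)
        * ∑ s ∈ Finset.Ico K₀ (K + 1),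
          (potWeight (n + p + m) (s + 1) - potWeight (n + p + m) s)
          * (pathExp K (fun i => P.lagIter u0 i s (P.proj u0)) - P.F xs) := by
    have h5 : P.F xs = ∑ k ∈ Finset.Ico K₀ (K + 1), avgWeight (n + p + m) K₀ K k * P.F xs := by
      rw [← Finset.sum_mul, sum_avgWeight hK hgap, one_mul]
    have h6 : pathExp K (P.lagAvg u0 K₀ K (P.proj u0)) = ∑ k ∈ Finset.Ico K₀ (K + 1),
        avgWeight (n + p + m) K₀ K k * pathExp K (fun i => P.lagIter u0 i k (P.proj u0)) := by
      simp only [← pathExp_const_mul]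
      exact pathExp_sum _ _
    rw [h6]
    conv_lhs => rw [h5]
    rw [← Finset.sum_sub_distrib, Finset.mul_sum]
    refine Finset.sum_congr rfl fun k _ => ?_
    rw [avgWeight]
    ring
  rw [h4]
  exact mul_le_mul_of_nonneg_left (by linarith) (one_div_pos.2 hgap).le

/-- The three terms of the telescoped residual are bounded by the potential at both ends of the
window and by the accumulated step lengths. -/
lemma Standing.expRes_le : pathExp K (fun i => P.sqDual (P.resAvg u0 K₀ K i))
    ≤ 36 * (1 / (potWeight (n + p + m) (K + 1) - potWeight (n + p + m) K₀)) ^ 2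
      * P.startPotential xs u0 := by
  have h1 := hP.window_sum hL hpos hu0 hxs hK le_rfl
  rw [Finset.sum_add_distrib, ← Finset.sum_div] at h1
  have h2 : 0 ≤ ∑ s ∈ Finset.Ico K₀ (K + 1),
      (potWeight (n + p + m) (s + 1) - potWeight (n + p + m) s)
        * (pathExp K (fun i => P.lagIter u0 i s (P.proj u0)) - P.F xs) :=
    Finset.sum_nonneg fun s _ => hP.lagGap_nonneg hL hpos hu0 hxs s
  have h3 : P.expSq u0 K (P.proj u0) K₀ ≤ P.startPotential xs u0 := by
    have := hP.window_sum hL hpos hu0 hxs (le_refl K₀) hK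
    simpa using this
  have h4 := expNoise_le (u0 := u0) hP hpos hK le_rfl
  have h5 := hP.expSq_nonneg (u0 := u0) (K := K) (P.proj u0) (K + 1)
  have h6 := pathExp_mono (K := K) fun i => sqDual_resAvg_le (u0 := u0) hL hpos hK i (P.proj u0)
  rw [pathExp_const_mul, pathExp_add, pathExp_add] at h6
  refine h6.trans ?_
  have h7 : pathExp K (fun i => P.sqL (P.zIter u0 i (K + 1) - P.proj u0))
      + pathExp K (fun i => P.sqL (P.zIter u0 i K₀ - P.proj u0))
      + pathExp K (fun i => P.sqL (P.noiseSum u0 K₀ (K + 1) i))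
      ≤ 3 * P.startPotential xs u0 := by
    change P.expSq u0 K (P.proj u0) (K + 1) + P.expSq u0 K (P.proj u0) K₀ + _ ≤ _
    linarith
  have h8 := mul_le_mul_of_nonneg_left h7 (show 0 ≤ 12 *
    (1 / (potWeight (n + p + m) (K + 1) - potWeight (n + p + m) K₀)) ^ 2 by positivity)
  linarith

/-- The expected size of the residual, by Jensen's inequality. -/
lemma Standing.expRes_sqrt_le : pathExp K (fun i => √(P.sqDual (P.resAvg u0 K₀ K i)))
    ≤ 6 * (1 / (potWeight (n + p + m) (K + 1) - potWeight (n + p + m) K₀))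
      * √(P.startPotential xs u0) := by
  have hne : Nonempty (DualIndex n p m) :=
    Fintype.card_pos_iff.1 (by rw [card_dualIndex]; exact hpos)
  have hT := hP.startPotential_nonneg hpos hxs hu0
  have hβ := (one_div_pos.2 hgap).le
  refine uniformExp_le_of_sq (by positivity) (fun π => (Real.sq_sqrt (sqDual_nonneg hL _)).le) ?_
  refine (hP.expRes_le hL hpos hu0 hxs hK hgap).trans (le_of_eq ?_)
  rw [mul_pow, Real.sq_sqrt hT]
  ring

lemma Standing.expViolation_le : pathExp K (fun i => P.violation (P.ardcaPrimal u0 K₀ K i))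
    ≤ 6 * (1 / (potWeight (n + p + m) (K + 1) - potWeight (n + p + m) K₀))
      * √(P.startPotential xs u0) :=
  (pathExp_mono fun i => Real.le_sqrt_of_sq_le
    (hP.violation_sq_le hL hu0 hK hgap i)).trans (hP.expRes_sqrt_le hL hpos hu0 hxs hK hgap)

lemma Standing.expF_upper {C : ℝ} (hC : ∀ w ∈ P.dualSol, P.normL w ≤ C) :
    pathExp K (fun i => P.F (P.ardcaPrimal u0 K₀ K i)) - P.F xs
    ≤ (C + P.M * √(∑ i : Fin n, P.L (Sum.inl i)))
        * (6 * (1 / (potWeight (n + p + m) (K + 1) - potWeight (n + p + m) K₀))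
          * √(P.startPotential xs u0))
      + 1 / (potWeight (n + p + m) (K + 1) - potWeight (n + p + m) K₀)
        * P.startPotential xs u0 := by
  have hw := (hP.proj_spec hL u0).1
  have h1 := pathExp_mono (K := K) fun i => hP.F_upper hL hK hgap (P.proj u0) (u0 := u0) i
  rw [pathExp_add, pathExp_const_mul] at h1
  have h2 := hP.expLag_le hL hpos hu0 hxs hK hgap
  have h3 := hP.expRes_sqrt_le hL hpos hu0 hxs hK hgap
  have h4 := hP.loss_constant_nonneg
  have h5 : 0 ≤ pathExp K (fun i => √(P.sqDual (P.resAvg u0 K₀ K i))) :=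
    pathExp_nonneg fun _ => Real.sqrt_nonneg _
  have h6 : P.normL (P.proj u0) + P.M * √(∑ i : Fin n, P.L (Sum.inl i))
      ≤ C + P.M * √(∑ i : Fin n, P.L (Sum.inl i)) := by linarith [hC _ hw]
  have h7 := mul_le_mul h6 h3 h5 (by linarith [hC _ hw, P.normL_nonneg (P.proj u0)])
  have h8 : pathExp K (fun i => P.lagAvg u0 K₀ K (P.proj u0) i)
    = pathExp K (P.lagAvg u0 K₀ K (P.proj u0)) := rfl
  linarith

lemma Standing.expF_lower {C : ℝ} (hC : ∀ w ∈ P.dualSol, P.normL w ≤ C) :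
    P.F xs - C * (6 * (1 / (potWeight (n + p + m) (K + 1) - potWeight (n + p + m) K₀))
          * √(P.startPotential xs u0))
      ≤ pathExp K (fun i => P.F (P.ardcaPrimal u0 K₀ K i)) := by
  have hw := (hP.proj_spec hL u0).1
  have h1 := pathExp_mono (K := K) fun i => hP.F_lower hL hxs hw (P.ardcaPrimal u0 K₀ K i)
  rw [pathExp_sub, pathExp_const hpos, pathExp_const_mul] at h1
  have h2 := hP.expViolation_le hL hpos hu0 hxs hK hgap
  have h3 : 0 ≤ pathExp K (fun i => P.violation (P.ardcaPrimal u0 K₀ K i)) :=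
    pathExp_nonneg fun _ => Real.sqrt_nonneg _
  have h4 := mul_le_mul (hC _ hw) h2 h3 ((P.normL_nonneg _).trans (hC _ hw))
  linarith

end PrimalRate

end ConvexProblem

/-! ### Restarts -/

namespace ConvexProblem

variable {t n p m : ℕ} {P : ConvexProblem t n p m}

lemma restartDual_congr {u0 : DualVec n p m} {K : ℕ} {i i' : ℕ → ℕ → DualIndex n p m} {r : ℕ}
    (h : ∀ s < r, i s = i' s) : P.restartDual u0 K i r = P.restartDual u0 K i' r := by
  induction r with
  | zero => rfl
  | succ r ih =>
    simp only [restartDual, ih fun s hs => h s (by omega), h r (by omega)]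

lemma Standing.restartDual_mem (hP : P.Standing) (hL : ∀ j, 0 < P.L j) {u0 : DualVec n p m}
    (hu0 : u0 ∈ P.domSet) {K : ℕ} (i : ℕ → ℕ → DualIndex n p m) (r : ℕ) :
    P.restartDual u0 K i r ∈ P.domSet := by
  induction r with
  | zero => exact hu0
  | succ r ih =>
    rw [restartDual, ardcaDual_eq]
    exact hP.uIter_mem hL ih _ _

/-- The coordinates selected in outer iteration `r` are independent of the starting point of
that iteration. -/
lemma uniformExp_restart (hpos : 0 < n + p + m) {u0 : DualVec n p m} {K N r : ℕ} (hr : r ≤ N)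
    (X : DualVec n p m → (ℕ → DualIndex n p m) → ℝ) :
    uniformExp (fun ω : Selection n p m N K => X (P.restartDual u0 K ω.at r) (ω.at r))
      = uniformExp fun ω : Selection n p m N K => pathExp K (X (P.restartDual u0 K ω.at r)) := by
  have hne : Nonempty (DualIndex n p m) :=
    Fintype.card_pos_iff.1 (by rw [card_dualIndex]; exact hpos)
  refine (uniformExp_resample _ (Fin.ofNat (N + 1) r)).trans ?_
  congr 1
  funext ω
  rw [pathExp]
  congr 1
  funext b
  have h1 : P.restartDual u0 K
      (Selection.at (Function.update ω (Fin.ofNat (N + 1) r) b : Selection n p m N K)) r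
      = P.restartDual u0 K (Selection.at ω) r := by
    refine restartDual_congr fun s hs => ?_
    funext k
    simp only [Selection.at]
    rw [Function.update_of_ne]
    intro h
    have h1 := congrArg Fin.val h
    simp only [Fin.ofNat, Nat.mod_eq_of_lt (show s < N + 1 by omega),
      Nat.mod_eq_of_lt (show r < N + 1 by omega)] at h1
    omega
  have h2 : Selection.at (Function.update ω (Fin.ofNat (N + 1) r) b : Selection n p m N K) r
      = pathOf b := by
    funext k
    simp only [Selection.at, pathOf, Function.update_self]
  rw [h1, h2]

lemma restartRate_nonneg {nh : ℕ} (hnh : 0 < nh) {κ : ℝ} (hκ : 0 < κ) (K : ℕ) :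
    0 ≤ restartRate nh κ K := by
  have h1 := one_sub_inv_nonneg hnh
  have h2 : theta nh 0 = 1 / nh := rfl
  rw [restartRate, h2]
  positivity

lemma restartRate_lt_one {nh : ℕ} (hnh : 0 < nh) {κ : ℝ} (hκ : 0 < κ) {K : ℕ} (hK : nh ≤ K) :
    restartRate nh κ K < 1 := by
  have h0 : (0 : ℝ) < nh := by exact_mod_cast hnh
  have hK' : (nh : ℝ) ≤ K := by exact_mod_cast hK
  have h2 : theta nh 0 = 1 / nh := rfl
  have h3 : (1 : ℝ) / 2 ≤ K / (2 * nh) := by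
    rw [le_div_iff₀ (by positivity)]
    linarith
  have h4 : (9 : ℝ) / 4 ≤ (K / (2 * nh) + 1) ^ 2 := by nlinarith
  have h5 : (0 : ℝ) < 1 / nh := by positivity
  rw [restartRate, h2, div_lt_one (by positivity)]
  nlinarith [mul_le_mul_of_nonneg_left h4 hκ.le, mul_pos hκ h5]

lemma sqrt_pow_mul {ρ T : ℝ} (hρ : 0 ≤ ρ) (N : ℕ) :
    √(ρ ^ N * T) = ρ ^ ((N : ℝ) / 2) * √T := by
  rw [Real.sqrt_mul (pow_nonneg hρ N), Real.sqrt_eq_rpow, ← Real.rpow_natCast,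
    ← Real.rpow_mul hρ, mul_one_div]

section Restart

variable (hP : P.Standing) (hL : ∀ j, 0 < P.L j) (hpos : 0 < n + p + m) {u0 : DualVec n p m}
  (hu0 : u0 ∈ P.domSet) {xs : EuclideanSpace ℝ (Fin t)} (hxs : xs ∈ P.primalSol)
  {κ : ℝ} (hκ : 0 < κ) (hgrowth : ∀ u ∈ P.domSet, κ * P.distSq u ≤ P.dReal u + P.F xs)
  {N K : ℕ}
include hP hL hpos hu0 hxs hκ hgrowth

/-- The expected potential contracts by `restartRate` in each outer iteration. -/
lemma Standing.restart_contraction {r : ℕ} (hr : r ≤ N) :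
    uniformExp (fun ω : Selection n p m N K => P.startPotential xs (P.restartDual u0 K ω.at r))
      ≤ restartRate (n + p + m) κ K ^ r * P.startPotential xs u0 := by
  have hne : Nonempty (DualIndex n p m) :=
    Fintype.card_pos_iff.1 (by rw [card_dualIndex]; exact hpos)
  induction r with
  | zero =>
    rw [pow_zero, one_mul]
    exact (uniformExp_const (P.startPotential xs u0)).le
  | succ r ih =>
    have h1 := uniformExp_restart (P := P) (u0 := u0) (K := K) hpos (by omega : r ≤ N)
      fun u i => P.startPotential xs (P.uIter u i (K + 1))
    have h2 : ∀ ω : Selection n p m N K, P.restartDual u0 K ω.at (r + 1)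
        = P.uIter (P.restartDual u0 K ω.at r) (ω.at r) (K + 1) := fun ω => ardcaDual_eq K
    simp only [h2]
    rw [h1, pow_succ', mul_assoc]
    refine le_trans ?_ (mul_le_mul_of_nonneg_left (ih (by omega)) (restartRate_nonneg hpos hκ K))
    rw [← uniformExp_const_mul]
    refine uniformExp_mono fun ω => le_trans (le_of_eq ?_)
      (hP.run_contraction hL hpos (hP.restartDual_mem hL hu0 ω.at r) hxs hκ hgrowth)
    simp only [startPotential, pathExp_add, pathExp_const_mul, pathExp_const hpos]

lemma Standing.restart_sqrt_le :
    uniformExp (fun ω : Selection n p m N K => √(P.startPotential xs (P.restartDual u0 K ω.at N)))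
      ≤ restartRate (n + p + m) κ K ^ ((N : ℝ) / 2) * √(P.startPotential xs u0) := by
  have hne : Nonempty (DualIndex n p m) :=
    Fintype.card_pos_iff.1 (by rw [card_dualIndex]; exact hpos)
  have hρ := restartRate_nonneg hpos hκ K
  have hT := hP.startPotential_nonneg hpos hxs hu0
  rw [← sqrt_pow_mul hρ]
  refine uniformExp_le_of_sq (Real.sqrt_nonneg _) (fun ω => (Real.sq_sqrt
    (hP.startPotential_nonneg hpos hxs (hP.restartDual_mem hL hu0 ω.at N))).le) ?_
  rw [Real.sq_sqrt (mul_nonneg (pow_nonneg hρ N) hT)]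
  exact hP.restart_contraction hL hpos hu0 hxs hκ hgrowth le_rfl

variable {K₀ : ℕ} {ν : ℝ} (hν : 1 < ν)
  (hK : K₀ ≤ K + 1) (hgap : 1 - 1 / ν ≤ potWeight (n + p + m) (K + 1) - potWeight (n + p + m) K₀)
include hν hK hgap

lemma Standing.restart_violation_le :
    uniformExp (fun ω : Selection n p m N K => P.violation (P.restartPrimal u0 K₀ K ω.at N))
      ≤ constC3 (P.startPotential xs u0) ν * restartRate (n + p + m) κ K ^ ((N : ℝ) / 2) := by
  have h0 : 0 < 1 - 1 / ν := by
    rw [sub_pos, div_lt_one (by linarith)]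
    exact hν
  have hgap0 := h0.trans_le hgap
  have hβ := one_div_le_one_div_of_le h0 hgap
  have h1 := uniformExp_restart (P := P) (u0 := u0) (K := K) hpos (le_refl N)
    fun u i => P.violation (P.ardcaPrimal u K₀ K i)
  have h2 : ∀ ω : Selection n p m N K, pathExp K
      (fun i => P.violation (P.ardcaPrimal (P.restartDual u0 K ω.at N) K₀ K i))
      ≤ 6 * (1 / (1 - 1 / ν)) * √(P.startPotential xs (P.restartDual u0 K ω.at N)) := fun ω =>
    (hP.expViolation_le hL hpos (hP.restartDual_mem hL hu0 ω.at N) hxs hK hgap0).trans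
      (mul_le_mul_of_nonneg_right (by linarith) (Real.sqrt_nonneg _))
  have h3 := uniformExp_mono h2
  rw [uniformExp_const_mul] at h3
  have h4 := mul_le_mul_of_nonneg_left
    (hP.restart_sqrt_le hL hpos hu0 hxs hκ hgrowth (N := N) (K := K))
    (show 0 ≤ 6 * (1 / (1 - 1 / ν)) by positivity)
  refine (le_of_eq h1).trans (h3.trans (h4.trans (le_of_eq ?_)))
  rw [constC3]
  ring

/-- The term with `√m` and half of `constC2` are not needed for the bound. -/
lemma Standing.restart_F_le {C : ℝ} (hC : ∀ w ∈ P.dualSol, P.normL w ≤ C) :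
    |uniformExp (fun ω : Selection n p m N K => P.F (P.restartPrimal u0 K₀ K ω.at N)) - P.F xs|
      ≤ P.constC1 (P.startPotential xs u0) C ν * restartRate (n + p + m) κ K ^ ((N : ℝ) / 2)
        + constC2 (P.startPotential xs u0) ν * restartRate (n + p + m) κ K ^ N := by
  have hne : Nonempty (DualIndex n p m) :=
    Fintype.card_pos_iff.1 (by rw [card_dualIndex]; exact hpos)
  have h0 : 0 < 1 - 1 / ν := by
    rw [sub_pos, div_lt_one (by linarith)]
    exact hν
  have hgap0 := h0.trans_le hgap
  have hβ := one_div_le_one_div_of_le h0 hgap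
  have hβ0 := (one_div_pos.2 hgap0).le
  have hC0 : 0 ≤ C := by
    obtain ⟨w, hw⟩ := hP.dualSol_nonempty hxs
    exact (P.normL_nonneg w).trans (hC w hw)
  have hM := hP.loss_constant_nonneg
  have hT := hP.startPotential_nonneg hpos hxs hu0
  have hρ := restartRate_nonneg hpos hκ K
  have hmem := fun ω : Selection n p m N K => hP.restartDual_mem hL hu0 (K := K) ω.at N
  have hsqrt := hP.restart_sqrt_le hL hpos hu0 hxs hκ hgrowth (N := N) (K := K)
  have hlin := hP.restart_contraction hL hpos hu0 hxs hκ hgrowth (K := K) (le_refl N)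
  set β' := 1 / (1 - 1 / ν) with hβ'
  set S := P.M * √(∑ i : Fin n, P.L (Sum.inl i)) with hS
  set T := P.startPotential xs u0 with hTdef
  set ρ := restartRate (n + p + m) κ K with hρdef
  have h1 : uniformExp (fun ω : Selection n p m N K => P.F (P.restartPrimal u0 K₀ K ω.at N))
      = uniformExp fun ω : Selection n p m N K => pathExp K
        fun i => P.F (P.ardcaPrimal (P.restartDual u0 K ω.at N) K₀ K i) :=
    uniformExp_restart hpos (le_refl N) fun u i => P.F (P.ardcaPrimal u K₀ K i)
  have hup : ∀ ω : Selection n p m N K, pathExp K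
      (fun i => P.F (P.ardcaPrimal (P.restartDual u0 K ω.at N) K₀ K i))
      ≤ P.F xs + (C + S) * (6 * β') * √(P.startPotential xs (P.restartDual u0 K ω.at N))
        + β' * P.startPotential xs (P.restartDual u0 K ω.at N) := by
    intro ω
    have h2 := hP.expF_upper hL hpos (hmem ω) hxs hK hgap0 hC
    have h3 := mul_le_mul_of_nonneg_right hβ (hP.startPotential_nonneg hpos hxs (hmem ω))
    have h4 := mul_le_mul_of_nonneg_left hβ (mul_nonneg (add_nonneg hC0 hM)
      (Real.sqrt_nonneg (P.startPotential xs (P.restartDual u0 K ω.at N))))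
    linarith
  have hlow : ∀ ω : Selection n p m N K,
      P.F xs - C * (6 * β') * √(P.startPotential xs (P.restartDual u0 K ω.at N))
      ≤ pathExp K (fun i => P.F (P.ardcaPrimal (P.restartDual u0 K ω.at N) K₀ K i)) := by
    intro ω
    have h2 := hP.expF_lower hL hpos (hmem ω) hxs hK hgap0 hC
    have h4 := mul_le_mul_of_nonneg_left hβ (mul_nonneg hC0
      (Real.sqrt_nonneg (P.startPotential xs (P.restartDual u0 K ω.at N))))
    linarith
  have hup' := uniformExp_mono hup
  have hlow' := uniformExp_mono hlow
  rw [uniformExp_add, uniformExp_add, uniformExp_const_mul, uniformExp_const_mul,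
    uniformExp_const] at hup'
  rw [uniformExp_sub, uniformExp_const_mul, uniformExp_const] at hlow'
  have hβ'0 : 0 ≤ β' := hβ0.trans hβ
  have e1 := mul_le_mul_of_nonneg_left hsqrt
    (mul_nonneg (add_nonneg hC0 hM) (mul_nonneg (by norm_num : (0 : ℝ) ≤ 6) hβ'0))
  have e2 := mul_le_mul_of_nonneg_left hlin hβ'0
  have e3 := mul_le_mul_of_nonneg_left hsqrt
    (mul_nonneg hC0 (mul_nonneg (by norm_num : (0 : ℝ) ≤ 6) hβ'0))
  have hr2 : 0 ≤ ρ ^ ((N : ℝ) / 2) := Real.rpow_nonneg hρ _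
  have hrT : 0 ≤ ρ ^ ((N : ℝ) / 2) * √T := mul_nonneg hr2 (Real.sqrt_nonneg _)
  have hextra : 0 ≤ 2 * √(m : ℝ) * C * √T / √(1 - 1 / ν) * ρ ^ ((N : ℝ) / 2) := by positivity
  have hC1 : P.constC1 T C ν * ρ ^ ((N : ℝ) / 2)
      = (C + S) * (6 * β') * (ρ ^ ((N : ℝ) / 2) * √T)
        + 2 * √(m : ℝ) * C * √T / √(1 - 1 / ν) * ρ ^ ((N : ℝ) / 2) := by
    rw [constC1, hS, hβ']
    ring
  have hC2 : constC2 T ν * ρ ^ N = 2 * (β' * (ρ ^ N * T)) := by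
    rw [constC2, hβ']
    ring
  have e4 : 0 ≤ β' * (ρ ^ N * T) := mul_nonneg hβ'0 (mul_nonneg (pow_nonneg hρ N) hT)
  have e5 : 0 ≤ S * (6 * β') * (ρ ^ ((N : ℝ) / 2) * √T) :=
    mul_nonneg (mul_nonneg hM (mul_nonneg (by norm_num) hβ'0)) hrT
  rw [h1, abs_le, hC1, hC2]
  constructor <;> linarith

end Restart

end ConvexProblem

end

theorem theorem2 {t n p m : ℕ} (P : ConvexProblem t n p m) (hn : 0 < n + p + m)
    (hP : P.Standing) (hL : ∀ j, 0 < P.L j)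
    (κ : ℝ) (hκ : 0 < κ) (hgrowth : P.QuadraticGrowth κ)
    (u0 : DualVec n p m) (hu0 : u0 ∈ P.dualFeasible) (hDu0 : P.D u0 ≠ ⊤) (N K : ℕ) :
    P.primalSol.Nonempty ∧ P.dualSol.Nonempty ∧
    (n + p + m ≤ K → restartRate (n + p + m) κ K < 1) ∧
    (∀ ω : Selection n p m N K,
      P.D (P.restartDual u0 K ω.at N) ≠ ⊤ ∧ P.D (P.restartDual u0 K ω.at N) ≠ ⊥) ∧
    ∀ xstar ∈ P.primalSol, ∀ ustar ∈ P.dualSol,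
      (1 - theta (n + p + m) 0) * (uniformExp (fun ω : Selection n p m N K =>
              (P.D (P.restartDual u0 K ω.at N)).toReal) - (P.D ustar).toReal)
          + uniformExp (fun ω : Selection n p m N K =>
              P.normL (P.restartDual u0 K ω.at N - P.proj (P.restartDual u0 K ω.at N)) ^ 2)
        ≤ restartRate (n + p + m) κ K ^ N * P.initialPotential u0 ustar ∧
      ∀ C : ℝ, (∀ w ∈ P.dualSol, P.normL w ≤ C) →
        ∀ ν : ℝ, 1 < ν → n + p + m ≤ K →
        ∀ K₀ : ℕ, K₀ ≤ ⌊(K : ℝ) / (ν * (1 + 1 / ((n + p + m : ℕ) : ℝ))) + 1⌋₊ →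
          |uniformExp (fun ω : Selection n p m N K =>
              P.F (P.restartPrimal u0 K₀ K ω.at N)) - P.F xstar|
            ≤ P.constC1 (P.initialPotential u0 ustar) C ν
                * restartRate (n + p + m) κ K ^ ((N : ℝ) / 2)
              + constC2 (P.initialPotential u0 ustar) ν * restartRate (n + p + m) κ K ^ N ∧
          uniformExp (fun ω : Selection n p m N K =>
              P.violation (P.restartPrimal u0 K₀ K ω.at N))
            ≤ constC3 (P.initialPotential u0 ustar) ν
                * restartRate (n + p + m) κ K ^ ((N : ℝ) / 2) := by
  have hdom : u0 ∈ P.domSet := ConvexProblem.mem_hDom_of_D_ne_top hDu0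
  have hmem := fun ω : Selection n p m N K => hP.restartDual_mem hL hdom (K := K) ω.at N
  obtain ⟨xs, hxs⟩ := hP.primalSol_nonempty
  refine ⟨⟨xs, hxs⟩, hP.dualSol_nonempty hxs, ConvexProblem.restartRate_lt_one hn hκ,
    fun ω => ⟨?_, ConvexProblem.D_ne_bot _⟩, ?_⟩
  · rw [ConvexProblem.D_eq (hmem ω)]
    exact EReal.coe_ne_top _
  intro xstar hx ustar hu
  have hD : (P.D ustar).toReal = -P.F xstar := by
    rw [hP.D_eq_of_mem_dualSol hx hu, EReal.toReal_coe]
  have hg : ∀ u ∈ P.domSet, κ * P.distSq u ≤ P.dReal u + P.F xstar := by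
    intro u hu'
    have h1 := hgrowth ustar hu u
    rw [hP.D_eq_of_mem_dualSol hx hu, ConvexProblem.D_eq hu', ← EReal.coe_add,
      EReal.coe_le_coe_iff] at h1
    rw [ConvexProblem.distSq, ConvexProblem.dReal]
    linarith
  have hT : P.initialPotential u0 ustar = P.startPotential xstar u0 := by
    rw [ConvexProblem.initialPotential, hD, ConvexProblem.D_toReal hdom, sub_neg_eq_add]
    rfl
  rw [hT]
  refine ⟨?_, fun C hC ν hν hK K₀ hK₀ => ?_⟩
  · have hne : Nonempty (DualIndex n p m) :=
      Fintype.card_pos_iff.1 (by rw [ConvexProblem.card_dualIndex]; exact hn)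
    have h1 := hP.restart_contraction hL hn hdom hx hκ hg (K := K) (le_refl N)
    simp only [ConvexProblem.startPotential, uniformExp_add, uniformExp_const_mul,
      uniformExp_const] at h1
    simp only [ConvexProblem.D_toReal (hmem _), hD, sub_neg_eq_add]
    exact h1
  · obtain ⟨hgap, hK'⟩ := window_weight hn hν hK hK₀
    exact ⟨hP.restart_F_le hL hn hdom hx hκ hg hν hK' hgap hC,
      hP.restart_violation_le hL hn hdom hx hκ hg hν hK' hgap⟩
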